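/- **Classification of equations of the second heavenly type.** Let $D$ be a connected open subset of the space $J^1=\{(x,u,p)\}=\mathbb R^4\times\mathbb R\times\mathbb R^4$ of first jets of functions $u(x_1,x_2,x_3,x_4)$, let $f:D\to\mathbb R$ be smooth, and consider the equation $$u_{13}+u_{24}+f(x,u,Du)\,(u_{11}u_{22}-u_{12}^2)=0. \qquad (E_f)$$ A solution is a smooth function $u$ on an open set $\Omega\subseteq\mathbb R^4$ whose first jets lie in $D$ and which satisfies $(E_f)$ on $\Omega$. The inverse of its characteristic quadratic form is represented, up to a constant factor, by the metric $$g=dx_1dx_3+dx_2dx_4-fu_{22}\,dx_3^2+2fu_{12}\,dx_3dx_4-fu_{11}\,dx_4^2 ,$$ where $f$ is evaluated at $(x,u,Du)$. Let $W$ be the Weyl tensor of $g$, $W_\pm=\frac12(W\pm *W)$, where $$*W^i{}_{jkl}=\tfrac12\sqrt{\det g}\;g^{ia}g^{bc}\epsilon_{ajbd}W^d{}_{ckl},\qquad \epsilon_{1234}=1,$$ with the positive square root. 1. $W_-$ vanishes on every solution of $(E_f)$ if and only if there are real constants $c_0,\dots,c_5$ with $c_1c_3+c_2c_4-c_0c_5=0$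 such that on $D$ $$f=c_0(x_1x_3+x_2x_4)+c_1x_1+c_2x_2+c_3x_3+c_4x_4+c_5 .$$ In contrast, $W_+$ vanishes on every solution if and only if $f=0$ on $D$. 2. Let $f$ be as in 1 (on all of $J^1$) with $(c_0,\dots,c_5)\neq 0$. There is exactly one of the four normal forms $$x_1x_3+x_2x_4,\qquad x_1,\qquad x_3,\qquad 1$$ such that $(E_f)$ is carried to the equation with this normal form as coefficient by an invertible affine change $X=Ax+b$ of the independent variables together with $U=u$ or $U=-u$. If $c_0\ge 0$, then a change with $U=u$ exists. 3. The first two normal forms give point-equivalent equations: the prolongation of $$X_1=x_1+\tfrac{x_2x_4}{x_3},\quad X_2=\tfrac{x_2}{x_3},\quad X_3=-\tfrac1{x_3},\quad X_4=\tfrac{x_4}{x_3},\quad U=x_3u$$ is a contact diffeomorphism of $\{x_3\ne0\}\subset J^1$ onto $\{X_3\neq 0\}\subset J^1$ that carries the equation with $f=x_1x_3+x_2x_4$ to the equation with $f=x_1$. So do the last two: the prolongation of $$X_1=x_1x_3,\quad X_2=\tfrac{x_2}{x_3^2},\quad X_3=-\tfrac1{2x_3^2},\quad X_4=x_4,\quad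 U=x_3u+\tfrac{x_1x_2^2}{2x_3}$$ is a contact diffeomorphism of $\{x_3>0\}\subset J^1$ onto $\{X_3<0\}\subset J^1$ that carries the equation with $f=x_3$ to the equation with $f=1$. 4. No contact diffeomorphism between non-empty open subsets of $J^1$ carries the equation of one of the first two normal forms to the equation of one of the last two. So the four normal forms make up exactly two contact-inequivalent classes. -/

import Mathlib

open scoped ContDiff

noncomputable section

namespace SecondHeavenly

/-! Indices: the coordinate labels 1, 2, 3, 4 are the elements 0, 1, 2, 3 of `Fin 4`. -/

/-- Points of the space of independent variables. -/
abbrev Pt := Fin 4 → ℝ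

/-- The space of first jets `(x, u, p)`, where `p i` stands for the derivative `u_i`. -/
abbrev J1 := Pt × ℝ × Pt

/-- Four by four real matrices. -/
abbrev Mat4 := Matrix (Fin 4) (Fin 4) ℝ

/-- The partial derivative in direction `x_i`. -/
def pd (i : Fin 4) (h : Pt → ℝ) (x : Pt) : ℝ := fderiv ℝ h x (Pi.single i 1)

/-- The first jet of `u` at `x`. -/
def jet1 (u : Pt → ℝ) (x : Pt) : J1 := (x, u x, fun i => pd i u x)

/-- The Hessian matrix of `u` at `x`. -/
def hess (u : Pt → ℝ) (x : Pt) : Mat4 := Matrix.of fun i j => pd i (pd j u) x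

/-! ### The equation -/

/-- `u₁₃ + u₂₄ + f (u₁₁ u₂₂ - u₁₂²)` at a 2-jet `(a, H)`, `a = (x, u, Du)`, `H = D²u`. -/
def heavenlyOp (f : J1 → ℝ) (a : J1) (H : Mat4) : ℝ :=
  H 0 2 + H 1 3 + f a * (H 0 0 * H 1 1 - H 0 1 ^ 2)

/-- The equation holds for `u` at the point `x`. -/
def SolvesAt (f : J1 → ℝ) (u : Pt → ℝ) (x : Pt) : Prop :=
  heavenlyOp f (jet1 u x) (hess u x) = 0

/-- `u` is a smooth solution on the open set `Ω`; the coefficient `f` is defined on `D ⊆ J1`, so the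
first jet of `u` has to take values in `D`. -/
structure IsSolutionOn (D : Set J1) (f : J1 → ℝ) (Ω : Set Pt) (u : Pt → ℝ) : Prop where
  isOpen : IsOpen Ω
  smooth : ContDiffOn ℝ ∞ u Ω
  mem : ∀ x ∈ Ω, jet1 u x ∈ D
  eq : ∀ x ∈ Ω, SolvesAt f u x

/-! ### The conformal structure -/

/-- The matrix of the characteristic quadratic form `∑_{α ≤ β} (∂F/∂u_{αβ}) p_α p_β`;
`c` is the value of `f`. -/
def charMatrix (c : ℝ) (H : Mat4) : Mat4 :=
  !![c * H 1 1, -(c * H 0 1), 1 / 2, 0;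
     -(c * H 0 1), c * H 0 0, 0, 1 / 2;
     1 / 2, 0, 0, 0;
     0, 1 / 2, 0, 0]

/-- The matrix of
`dx₁dx₃ + dx₂dx₄ - f u₂₂ dx₃² + 2 f u₁₂ dx₃dx₄ - f u₁₁ dx₄²`; `c` is the value of `f`. -/
def metricMatrix (c : ℝ) (H : Mat4) : Mat4 :=
  !![0, 0, 1 / 2, 0;
     0, 0, 0, 1 / 2;
     1 / 2, 0, -(c * H 1 1), c * H 0 1;
     0, 1 / 2, c * H 0 1, -(c * H 0 0)]

/-- `charMatrix` is the symbol of the equation: its quadratic form is the derivative of the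
left-hand side in the direction of the rank one Hessian `p ⊗ p`. -/
theorem hasDerivAt_heavenlyOp (f : J1 → ℝ) (a : J1) (H : Mat4) (p : Pt) :
    HasDerivAt (fun t : ℝ => heavenlyOp f a (H + t • Matrix.vecMulVec p p))
      (p ⬝ᵥ (charMatrix (f a) H).mulVec p) 0 := by
  have h : ∀ i j : Fin 4,
      HasDerivAt (fun t : ℝ => H i j + t * (p i * p j)) (p i * p j) 0 := by
    intro i j
    simpa using ((hasDerivAt_id (0 : ℝ)).mul_const (p i * p j)).const_add (H i j)
  have key := ((h 0 2).add (h 1 3)).add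
    ((((h 0 0).mul (h 1 1)).sub ((h 0 1).pow 2)).const_mul (f a))
  refine (key.congr_deriv ?_).congr_of_eventuallyEq (Filter.Eventually.of_forall fun t => ?_)
  · simp [charMatrix, Matrix.mulVec, dotProduct, Fin.sum_univ_four]
    ring
  · simp [heavenlyOp, Matrix.vecMulVec]

/-- The metric represents the inverse of the characteristic quadratic form, up to the constant
factor 4. -/
theorem charMatrix_mul_metricMatrix (c : ℝ) (H : Mat4) :
    charMatrix c H * ((4 : ℝ) • metricMatrix c H) = 1 := by
  ext i j
  fin_cases i <;> fin_cases j <;>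
    simp [charMatrix, metricMatrix, Matrix.mul_apply, Fin.sum_univ_four] <;> ring

/-- The representative of the conformal structure defined by `u`. -/
def metric (f : J1 → ℝ) (u : Pt → ℝ) (x : Pt) : Mat4 :=
  metricMatrix (f (jet1 u x)) (hess u x)

/-! ### Curvature of a (pseudo-)Riemannian metric in coordinates -/

/-- Christoffel symbols `Γ^i_{jk}`. -/
def christoffel (g : Pt → Mat4) (i j k : Fin 4) (x : Pt) : ℝ :=
  1 / 2 * ∑ l, (g x)⁻¹ i l *
    (pd j (fun y => g y l k) x + pd k (fun y => g y l j) x - pd l (fun y => g y j k) x)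

/-- The curvature tensor `R^i_{jkl}`. -/
def riemann (g : Pt → Mat4) (i j k l : Fin 4) (x : Pt) : ℝ :=
  pd k (christoffel g i l j) x - pd l (christoffel g i k j) x +
    ∑ m, (christoffel g i k m x * christoffel g m l j x -
      christoffel g i l m x * christoffel g m k j x)

/-- The Ricci tensor. -/
def ricci (g : Pt → Mat4) (j l : Fin 4) (x : Pt) : ℝ := ∑ i, riemann g i j i l x

/-- The scalar curvature. -/
def scalarCurv (g : Pt → Mat4) (x : Pt) : ℝ := ∑ j, ∑ l, (g x)⁻¹ j l * ricci g j l x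

/-- The Schouten tensor in dimension four. -/
def schouten (g : Pt → Mat4) (i j : Fin 4) (x : Pt) : ℝ :=
  1 / 2 * ricci g i j x - scalarCurv g x / 12 * g x i j

/-- The Weyl tensor with all indices lowered, `W_{ijkl}`. -/
def weylLow (g : Pt → Mat4) (i j k l : Fin 4) (x : Pt) : ℝ :=
  (∑ s, g x i s * riemann g s j k l x) - schouten g i k x * g x j l - schouten g j l x * g x i k +
    schouten g j k x * g x i l + schouten g i l x * g x j k

/-- The Weyl tensor `W^i_{jkl}`. -/
def weyl (g : Pt → Mat4) (i j k l : Fin 4) (x : Pt) : ℝ :=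
  ∑ s, (g x)⁻¹ i s * weylLow g s j k l x

/-- The Levi-Civita symbol, `leviCivita 0 1 2 3 = 1`. -/
def leviCivita (a b c d : Fin 4) : ℝ :=
  Matrix.det (Matrix.of fun r s : Fin 4 => if ![a, b, c, d] r = s then (1 : ℝ) else 0)

/-- The Hodge star acting on the Weyl tensor,
`(*W)^i_{jkl} = ½ √(det g) g^{ia} g^{bc} ε_{ajbd} W^d_{ckl}`. -/
def hodgeWeyl (g : Pt → Mat4) (i j k l : Fin 4) (x : Pt) : ℝ :=
  1 / 2 * √((g x).det) * ∑ a, ∑ b, ∑ c, ∑ d,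
    (g x)⁻¹ i a * (g x)⁻¹ b c * leviCivita a j b d * weyl g d c k l x

/-- The part `W₋ = ½ (W - *W)`. -/
def weylMinus (g : Pt → Mat4) (i j k l : Fin 4) (x : Pt) : ℝ :=
  1 / 2 * (weyl g i j k l x - hodgeWeyl g i j k l x)

/-- The part `W₊ = ½ (W + *W)`. -/
def weylPlus (g : Pt → Mat4) (i j k l : Fin 4) (x : Pt) : ℝ :=
  1 / 2 * (weyl g i j k l x + hodgeWeyl g i j k l x)

/-- `W₋` vanishes on every solution of the equation with coefficient `f` on `D`. -/
def WeylMinusVanishes (D : Set J1) (f : J1 → ℝ) : Prop :=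
  ∀ (Ω : Set Pt) (u : Pt → ℝ), IsSolutionOn D f Ω u →
    ∀ x ∈ Ω, ∀ i j k l, weylMinus (metric f u) i j k l x = 0

/-- `W₊` vanishes on every solution of the equation with coefficient `f` on `D`. -/
def WeylPlusVanishes (D : Set J1) (f : J1 → ℝ) : Prop :=
  ∀ (Ω : Set Pt) (u : Pt → ℝ), IsSolutionOn D f Ω u →
    ∀ x ∈ Ω, ∀ i j k l, weylPlus (metric f u) i j k l x = 0

/-! ### The coefficients -/

/-- `c₀ (x₁x₃ + x₂x₄) + c₁x₁ + c₂x₂ + c₃x₃ + c₄x₄ + c₅`, as a function on first jets. -/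
def quadCoeff (c : Fin 6 → ℝ) (a : J1) : ℝ :=
  c 0 * (a.1 0 * a.1 2 + a.1 1 * a.1 3) +
    c 1 * a.1 0 + c 2 * a.1 1 + c 3 * a.1 2 + c 4 * a.1 3 + c 5

/-- The constraint `c₁c₃ + c₂c₄ - c₀c₅ = 0`. -/
def Constraint (c : Fin 6 → ℝ) : Prop := c 1 * c 3 + c 2 * c 4 - c 0 * c 5 = 0

/-- The four normal forms `x₁x₃ + x₂x₄`, `x₁`, `x₃`, `1`. -/
def normalForm : Fin 4 → J1 → ℝ :=
  ![fun a => a.1 0 * a.1 2 + a.1 1 * a.1 3, fun a => a.1 0, fun a => a.1 2, fun _ => 1]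

/-- The change of variables `X = A x`, `U = ε u` carries the equation with coefficient `f` to the
equation with coefficient `h`. -/
def AffineCarries (A : Pt ≃ᵃ[ℝ] Pt) (ε : ℝ) (f h : J1 → ℝ) : Prop :=
  ∀ u : Pt → ℝ, ContDiff ℝ ∞ u → ∀ x : Pt,
    SolvesAt f u x ↔ SolvesAt h (fun y => ε * u (A.symm y)) (A x)

/-! ### Contact equivalence -/

/-- The contact form `du - ∑ p_i dx_i` at `a`, evaluated on a tangent vector `v`. -/
def contactForm (a v : J1) : ℝ := v.2.1 - ∑ i, a.2.2 i * v.1 i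

/-- The 4-plane in the tangent space of `J1` at `a` that the 2-jet `(a, H)` defines; it is spanned
by the vectors `∂_i + p_i ∂_u + ∑_j H_{ij} ∂_{p_j}`. -/
def jetPlane (a : J1) (H : Mat4) : Submodule ℝ J1 where
  carrier := {v | v.2.1 = ∑ i, a.2.2 i * v.1 i ∧ v.2.2 = H.mulVec v.1}
  add_mem' := by
    rintro v w ⟨h1, h2⟩ ⟨h3, h4⟩
    refine ⟨?_, ?_⟩
    · simp [h1, h3, mul_add, Finset.sum_add_distrib]
    · simp [h2, h4, Matrix.mulVec_add]
  zero_mem' := by simp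
  smul_mem' := by
    rintro r v ⟨h1, h2⟩
    refine ⟨?_, ?_⟩
    · simp only [Prod.smul_snd, Prod.smul_fst, smul_eq_mul, Pi.smul_apply, h1, Finset.mul_sum]
      exact Finset.sum_congr rfl fun i _ => by ring
    · simp [h2, Matrix.mulVec_smul]

/-- `Φ`, a diffeomorphism between open subsets of `J1`, is a contact transformation whose
prolongation to second jets carries the equation with coefficient `f` to the equation with
coefficient `h`. -/
structure IsContactEquivalence (Φ : OpenPartialHomeomorph J1 J1) (f h : J1 → ℝ) : Prop where
  smooth : ContDiffOn ℝ ∞ Φ Φ.source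
  smooth_symm : ContDiffOn ℝ ∞ Φ.symm Φ.target
  contact : ∀ a ∈ Φ.source, ∃ ρ : ℝ, ρ ≠ 0 ∧
    ∀ v : J1, contactForm (Φ a) (fderiv ℝ Φ a v) = ρ * contactForm a v
  equation : ∀ a ∈ Φ.source, ∀ H H' : Mat4, H.IsSymm → H'.IsSymm →
    (jetPlane a H).map (fderiv ℝ Φ a : J1 →ₗ[ℝ] J1) = jetPlane (Φ a) H' →
    (heavenlyOp f a H = 0 ↔ heavenlyOp h (Φ a) H' = 0)

end SecondHeavenly

end

namespace SecondHeavenly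
open scoped Topology

/-! ### Partial derivatives -/

/-! Half-flatness. The metric is a Walker metric with coefficients F u₂₂, F u₁₂, F u₁₁, where F =
f(x, u, Du). For such metrics W₋ is governed by three scalars (`WalkerJet.weylLow_selfdual`). On a
solution, the equation and its first and second derivatives eliminate the higher derivatives of u
outside those of F, and W₋ = 0 becomes three equations, linear in the second derivatives of F apart
from a product of first derivatives (`weylMinus_coeffMetric_iff`). A function with u₁₃ + u₂₄ = 0 and
u₁₁u₂₂ = u₁₂² solves the equation for every f, and such functions exist through every first jet.
Evaluating the three equations on them gives in turn f_p = 0, f_u = 0 and the second derivatives in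
x (`dd_ep_eq_zero`, `dd_eu_eq_zero`, `dd_dd_ex`). On a connected domain this integrates to the
six-parameter family (`eqOn_quadCoeff`). On that family only (c₁c₃ + c₂c₄ - c₀c₅)(u₁₁u₂₂ - u₁₂²) = 0
is left, and a rational solution with nondegenerate block yields the constraint. For W₊, one
component is -∂₂²(f u₂₂), which a quartic polynomial reduces to -f.

Normal forms. Existence is completion of the square together with rotations and scalings. For
uniqueness, testing on quadratic polynomials shows that X₃, X₄ depend only on x₃, x₄ and that the
two coefficients are proportional (`AffineCarries.block`, `AffineCarries.exists_factor`). The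
successive vanishing of c₀, of (c₁, c₂) and of (c₃, c₄) is then invariant. The explicit equivalences
are checked by the chain rule on lifted tangent vectors.

Inequivalence. At a point, a contact transformation is a conformally symplectic map with blocks P,
Q, R, S, acting on Hessians by H ↦ (R + SH)(P + QH)⁻¹. Adding rank one terms n ⊗ n to a Hessian on
the equation shows that the null covectors of the symbols correspond. Adding two of them relates the
determinant terms, and this compatibility is so rigid that Q = 0 (`TransfersOp.eq_zero`): every
equivalence is a point transformation. The action on Hessians is then affine, and comparing
coefficients determines P up to a scalar σ, gives the law ρh = fσ³δ, where δ is the determinant of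
∂(X₃, X₄)/∂(x₃, x₄), and gives one relation for the inhomogeneous part (`coeffs_of_point_iff`).
These identities hold on an open set of jets and are polynomial in p, so differentiating them in p₁
separates them: X depends only on x, and neither σ nor ρ depends on x₁. Since X₃ depends only on x₃
and x₄, a target coefficient X₃ or 1 does not involve x₁ either, so ∂f/∂x₁ = 0
(`ContactSystem.dd_coeff_eq_zero`). This fails for x₁x₃ + x₂x₄ where x₃ ≠ 0, and for x₁. -/

theorem forall_fin_four {p : Fin 4 → Prop} : (∀ i, p i) ↔ p 0 ∧ p 1 ∧ p 2 ∧ p 3 := by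
  simp [Fin.forall_fin_succ]

section PartialDerivatives

variable {Ω : Set Pt} {h k : Pt → ℝ} {x : Pt} {i j : Fin 4}

theorem pd_congr (e : h =ᶠ[𝓝 x] k) : pd i h x = pd i k x := by
  simp only [pd, e.fderiv_eq]

theorem pd_const (c : ℝ) : pd i (fun _ => c) x = 0 := by simp [pd]

theorem pd_neg : pd i (fun y => -h y) x = -pd i h x := by simp [pd]

theorem pd_add (hh : DifferentiableAt ℝ h x) (hk : DifferentiableAt ℝ k x) :
    pd i (fun y => h y + k y) x = pd i h x + pd i k x := by
  simp only [pd, fderiv_fun_add hh hk, _root_.add_apply]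

theorem pd_sub (hh : DifferentiableAt ℝ h x) (hk : DifferentiableAt ℝ k x) :
    pd i (fun y => h y - k y) x = pd i h x - pd i k x := by
  simp only [pd, fderiv_fun_sub hh hk, _root_.sub_apply]

theorem pd_mul (hh : DifferentiableAt ℝ h x) (hk : DifferentiableAt ℝ k x) :
    pd i (fun y => h y * k y) x = pd i h x * k x + h x * pd i k x := by
  simp only [pd, fderiv_fun_mul hh hk, _root_.add_apply,
    _root_.smul_apply, smul_eq_mul]
  ring

theorem pd_const_mul (c : ℝ) (hh : DifferentiableAt ℝ h x) :
    pd i (fun y => c * h y) x = c * pd i h x := by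
  rw [pd_mul (differentiableAt_const c) hh, pd_const]
  ring

theorem pd_sum {ι : Type*} {s : Finset ι} {h : ι → Pt → ℝ}
    (hh : ∀ a ∈ s, DifferentiableAt ℝ (h a) x) :
    pd i (fun y => ∑ a ∈ s, h a y) x = ∑ a ∈ s, pd i (h a) x := by
  simp only [pd, fderiv_fun_sum hh, _root_.sum_apply]

theorem pd_comm_of_contDiffAt (hh : ContDiffAt ℝ 2 h x) : pd i (pd j h) x = pd j (pd i h) x := by
  have hs : IsSymmSndFDerivAt ℝ h x := hh.isSymmSndFDerivAt (by simp)
  have hd : DifferentiableAt ℝ (fderiv ℝ h) x :=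
    (hh.fderiv_right (m := 1) (by norm_num)).differentiableAt (by norm_num)
  have key : ∀ a b : Fin 4, pd a (pd b h) x =
      fderiv ℝ (fderiv ℝ h) x (Pi.single a 1) (Pi.single b 1) := by
    intro a b
    have : pd b h = fun y => fderiv ℝ h y (Pi.single b 1) := rfl
    rw [this, pd, fderiv_clm_apply hd (differentiableAt_const _)]
    simp
  rw [key, key, hs]

theorem smooth_pd (hΩ : IsOpen Ω) (hh : ContDiffOn ℝ ∞ h Ω) (i : Fin 4) :
    ContDiffOn ℝ ∞ (pd i h) Ω :=
  (hh.fderiv_of_isOpen hΩ (by simp)).clm_apply contDiffOn_const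

theorem differentiableAt_of_smooth (hΩ : IsOpen Ω) (hh : ContDiffOn ℝ ∞ h Ω) (hx : x ∈ Ω) :
    DifferentiableAt ℝ h x :=
  (hh.contDiffAt (hΩ.mem_nhds hx)).differentiableAt (by simp)

theorem pd_comm (hΩ : IsOpen Ω) (hh : ContDiffOn ℝ ∞ h Ω) (hx : x ∈ Ω) :
    pd i (pd j h) x = pd j (pd i h) x :=
  pd_comm_of_contDiffAt ((hh.contDiffAt (hΩ.mem_nhds hx)).of_le (by norm_cast))

theorem pd_congr_on (hΩ : IsOpen Ω) (hx : x ∈ Ω) (e : ∀ y ∈ Ω, h y = k y) :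
    pd i h x = pd i k x :=
  pd_congr (Filter.eventuallyEq_of_mem (hΩ.mem_nhds hx) e)

end PartialDerivatives

/-! ### Curvature in terms of the two-jet of the metric -/

/-- The Christoffel symbols as a function of the one-jet of the metric. -/
noncomputable def chrN (G : Mat4) (dg : Fin 4 → Mat4) (i j k : Fin 4) : ℝ :=
  1 / 2 * ∑ l, G i l * (dg j l k + dg k l j - dg l j k)

/-- The derivatives of the Christoffel symbols as a function of the two-jet of the metric. -/
noncomputable def dchrN (G : Mat4) (dG dg : Fin 4 → Mat4) (ddg : Fin 4 → Fin 4 → Mat4) (m i j k : Fin 4) : ℝ :=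
  1 / 2 * ∑ l, (dG m i l * (dg j l k + dg k l j - dg l j k) +
    G i l * (ddg m j l k + ddg m k l j - ddg m l j k))

/-- The curvature tensor as a function of the two-jet of the metric. -/
noncomputable def riemN (G : Mat4) (dG dg : Fin 4 → Mat4) (ddg : Fin 4 → Fin 4 → Mat4) (i j k l : Fin 4) : ℝ :=
  dchrN G dG dg ddg k i l j - dchrN G dG dg ddg l i k j +
    ∑ m, (chrN G dg i k m * chrN G dg m l j - chrN G dg i l m * chrN G dg m k j)

/-- The inverse metric enters as a separate function `G`, so that its derivatives come from an
explicit formula instead of the derivative of matrix inversion. -/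
theorem riemann_eq_riemN {g G : Pt → Mat4} {Ω : Set Pt} {x : Pt} (hΩ : IsOpen Ω) (hx : x ∈ Ω)
    (hG : ∀ y, (g y)⁻¹ = G y) (hg : ∀ i j, ContDiffOn ℝ ∞ (fun y => g y i j) Ω)
    (hG' : ∀ i j, ContDiffOn ℝ ∞ (fun y => G y i j) Ω) (i j k l : Fin 4) :
    riemann g i j k l x = riemN (G x) (fun m => Matrix.of fun a b => pd m (fun y => G y a b) x)
      (fun m => Matrix.of fun a b => pd m (fun y => g y a b) x)
      (fun m n => Matrix.of fun a b => pd m (pd n (fun y => g y a b)) x) i j k l := by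
  have d1 : ∀ a b, DifferentiableAt ℝ (fun y => G y a b) x := fun a b =>
    differentiableAt_of_smooth hΩ (hG' a b) hx
  have d2 : ∀ n a b, DifferentiableAt ℝ (pd n (fun y => g y a b)) x := fun n a b =>
    differentiableAt_of_smooth hΩ (smooth_pd hΩ (hg a b) n) hx
  have hc : ∀ i j k, christoffel g i j k = fun y => 1 / 2 * ∑ l, G y i l *
      (pd j (fun y => g y l k) y + pd k (fun y => g y l j) y - pd l (fun y => g y j k) y) := by
    intro i j k; ext y; simp only [christoffel, hG]
  have hd : ∀ m i j k, pd m (christoffel g i j k) x = dchrN (G x)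
      (fun m => Matrix.of fun a b => pd m (fun y => G y a b) x)
      (fun m => Matrix.of fun a b => pd m (fun y => g y a b) x)
      (fun m n => Matrix.of fun a b => pd m (pd n (fun y => g y a b)) x) m i j k := by
    intro m i j k
    have e1 : ∀ l, DifferentiableAt ℝ (fun y => pd j (fun y => g y l k) y +
        pd k (fun y => g y l j) y - pd l (fun y => g y j k) y) x := fun l =>
      ((d2 _ _ _).fun_add (d2 _ _ _)).fun_sub (d2 _ _ _)
    have e2 : ∀ l, DifferentiableAt ℝ (fun y => G y i l * (pd j (fun y => g y l k) y +
        pd k (fun y => g y l j) y - pd l (fun y => g y j k) y)) x := fun l =>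
      (d1 i l).fun_mul (e1 l)
    rw [hc, pd_const_mul _ (DifferentiableAt.fun_sum fun l _ => e2 l), pd_sum fun l _ => e2 l]
    simp only [dchrN, Matrix.of_apply]
    congr 1
    refine Finset.sum_congr rfl fun l _ => ?_
    rw [pd_mul (d1 _ _) (e1 l), pd_sub ((d2 _ _ _).fun_add (d2 _ _ _)) (d2 _ _ _),
      pd_add (d2 _ _ _) (d2 _ _ _)]
  simp only [riemann, riemN, hd]
  simp only [hc, chrN, Matrix.of_apply]

/-! ### Walker metrics -/

/-- The metric `dx₁dx₃ + dx₂dx₄ - a dx₃² + 2 b dx₃dx₄ - c dx₄²` at a point. -/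
noncomputable def walkerMetric (a b c : ℝ) : Mat4 :=
  !![0, 0, 1 / 2, 0; 0, 0, 0, 1 / 2; 1 / 2, 0, -a, b; 0, 1 / 2, b, -c]

/-- The inverse of `walkerMetric`. -/
def walkerInv (a b c : ℝ) : Mat4 :=
  !![4 * a, -4 * b, 2, 0; -4 * b, 4 * c, 0, 2; 2, 0, 0, 0; 0, 2, 0, 0]

/-- The derivative of `walkerMetric`. -/
def walkerDir (a b c : ℝ) : Mat4 := !![0, 0, 0, 0; 0, 0, 0, 0; 0, 0, -a, b; 0, 0, b, -c]

/-- The derivative of `walkerInv`. -/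
def walkerInvDir (a b c : ℝ) : Mat4 :=
  !![4 * a, -4 * b, 0, 0; -4 * b, 4 * c, 0, 0; 0, 0, 0, 0; 0, 0, 0, 0]

/-- The skew-symmetric matrix with given entries above the diagonal. -/
def skew (p q r s t v : ℝ) : Mat4 :=
  !![0, p, q, r; -p, 0, s, t; -q, -s, 0, v; -r, -t, -v, 0]

section Entries
variable (a b c p q r s t v : ℝ)

/-- These tables act as rewriting rules: index sums expand into polynomials without unfolding matrix
literals. -/
theorem walkerMetric_entries :
    walkerMetric a b c 0 0 = 0 ∧ walkerMetric a b c 0 1 = 0 ∧ walkerMetric a b c 0 2 = 1 / 2 ∧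
    walkerMetric a b c 0 3 = 0 ∧ walkerMetric a b c 1 0 = 0 ∧ walkerMetric a b c 1 1 = 0 ∧
    walkerMetric a b c 1 2 = 0 ∧ walkerMetric a b c 1 3 = 1 / 2 ∧
    walkerMetric a b c 2 0 = 1 / 2 ∧ walkerMetric a b c 2 1 = 0 ∧ walkerMetric a b c 2 2 = -a ∧
    walkerMetric a b c 2 3 = b ∧ walkerMetric a b c 3 0 = 0 ∧ walkerMetric a b c 3 1 = 1 / 2 ∧
    walkerMetric a b c 3 2 = b ∧ walkerMetric a b c 3 3 = -c :=
  ⟨rfl, rfl, rfl, rfl, rfl, rfl, rfl, rfl, rfl, rfl, rfl, rfl, rfl, rfl, rfl, rfl⟩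

theorem walkerInv_entries :
    walkerInv a b c 0 0 = 4 * a ∧ walkerInv a b c 0 1 = -4 * b ∧ walkerInv a b c 0 2 = 2 ∧
    walkerInv a b c 0 3 = 0 ∧ walkerInv a b c 1 0 = -4 * b ∧ walkerInv a b c 1 1 = 4 * c ∧
    walkerInv a b c 1 2 = 0 ∧ walkerInv a b c 1 3 = 2 ∧
    walkerInv a b c 2 0 = 2 ∧ walkerInv a b c 2 1 = 0 ∧ walkerInv a b c 2 2 = 0 ∧
    walkerInv a b c 2 3 = 0 ∧ walkerInv a b c 3 0 = 0 ∧ walkerInv a b c 3 1 = 2 ∧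
    walkerInv a b c 3 2 = 0 ∧ walkerInv a b c 3 3 = 0 :=
  ⟨rfl, rfl, rfl, rfl, rfl, rfl, rfl, rfl, rfl, rfl, rfl, rfl, rfl, rfl, rfl, rfl⟩

theorem walkerDir_entries :
    walkerDir a b c 0 0 = 0 ∧ walkerDir a b c 0 1 = 0 ∧ walkerDir a b c 0 2 = 0 ∧
    walkerDir a b c 0 3 = 0 ∧ walkerDir a b c 1 0 = 0 ∧ walkerDir a b c 1 1 = 0 ∧
    walkerDir a b c 1 2 = 0 ∧ walkerDir a b c 1 3 = 0 ∧
    walkerDir a b c 2 0 = 0 ∧ walkerDir a b c 2 1 = 0 ∧ walkerDir a b c 2 2 = -a ∧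
    walkerDir a b c 2 3 = b ∧ walkerDir a b c 3 0 = 0 ∧ walkerDir a b c 3 1 = 0 ∧
    walkerDir a b c 3 2 = b ∧ walkerDir a b c 3 3 = -c :=
  ⟨rfl, rfl, rfl, rfl, rfl, rfl, rfl, rfl, rfl, rfl, rfl, rfl, rfl, rfl, rfl, rfl⟩

theorem walkerInvDir_entries :
    walkerInvDir a b c 0 0 = 4 * a ∧ walkerInvDir a b c 0 1 = -4 * b ∧
    walkerInvDir a b c 0 2 = 0 ∧
    walkerInvDir a b c 0 3 = 0 ∧ walkerInvDir a b c 1 0 = -4 * b ∧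
    walkerInvDir a b c 1 1 = 4 * c ∧
    walkerInvDir a b c 1 2 = 0 ∧ walkerInvDir a b c 1 3 = 0 ∧
    walkerInvDir a b c 2 0 = 0 ∧ walkerInvDir a b c 2 1 = 0 ∧ walkerInvDir a b c 2 2 = 0 ∧
    walkerInvDir a b c 2 3 = 0 ∧ walkerInvDir a b c 3 0 = 0 ∧ walkerInvDir a b c 3 1 = 0 ∧
    walkerInvDir a b c 3 2 = 0 ∧ walkerInvDir a b c 3 3 = 0 :=
  ⟨rfl, rfl, rfl, rfl, rfl, rfl, rfl, rfl, rfl, rfl, rfl, rfl, rfl, rfl, rfl, rfl⟩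

theorem skew_entries :
    skew p q r s t v 0 0 = 0 ∧ skew p q r s t v 0 1 = p ∧ skew p q r s t v 0 2 = q ∧
    skew p q r s t v 0 3 = r ∧ skew p q r s t v 1 0 = -p ∧ skew p q r s t v 1 1 = 0 ∧
    skew p q r s t v 1 2 = s ∧ skew p q r s t v 1 3 = t ∧ skew p q r s t v 2 0 = -q ∧
    skew p q r s t v 2 1 = -s ∧ skew p q r s t v 2 2 = 0 ∧ skew p q r s t v 2 3 = v ∧
    skew p q r s t v 3 0 = -r ∧ skew p q r s t v 3 1 = -t ∧ skew p q r s t v 3 2 = -v ∧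
    skew p q r s t v 3 3 = 0 :=
  ⟨rfl, rfl, rfl, rfl, rfl, rfl, rfl, rfl, rfl, rfl, rfl, rfl, rfl, rfl, rfl, rfl⟩

end Entries

theorem walkerMetric_inv (a b c : ℝ) : (walkerMetric a b c)⁻¹ = walkerInv a b c := by
  refine Matrix.inv_eq_left_inv ?_
  ext i j
  revert i j
  simp only [forall_fin_four, Matrix.mul_apply, Fin.sum_univ_four, walkerInv_entries,
    walkerMetric_entries, Matrix.one_apply_eq]
  refine ⟨⟨?_, ?_, ?_, ?_⟩, ⟨?_, ?_, ?_, ?_⟩, ⟨?_, ?_, ?_, ?_⟩, ?_, ?_, ?_, ?_⟩ <;>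
    first | (rw [Matrix.one_apply_ne (by decide)]; ring) | ring

theorem sqrt_det_walkerMetric (a b c : ℝ) : √(walkerMetric a b c).det = 1 / 4 := by
  have : (walkerMetric a b c).det = (1 / 4) ^ 2 := by
    simp [walkerMetric, Matrix.det_succ_row_zero, Fin.sum_univ_succ, Fin.succAbove]
    norm_num
  rw [this, Real.sqrt_sq (by norm_num)]

section Tables
variable (a b c : ℝ) (da db dc : Fin 4 → ℝ) (dda ddb ddc : Fin 4 → Fin 4 → ℝ)

/-- The Christoffel symbols of a Walker metric. -/
def walkerChr : Fin 4 → Mat4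
  | 0 => !![0, 0, -da 0, db 0;
           0, 0, -da 1, db 1;
           -da 0, -da 1, 2 * a * da 0 - 2 * b * da 1 - da 2, 2 * b * db 1 - 2 * a * db 0 - da 3;
           db 0, db 1, 2 * b * db 1 - 2 * a * db 0 - da 3,
             2 * a * dc 0 - 2 * b * dc 1 + 2 * db 3 + dc 2]
  | 1 => !![0, 0, db 0, -dc 0;
           0, 0, db 1, -dc 1;
           db 0, db 1, 2 * c * da 1 - 2 * b * da 0 + 2 * db 2 + da 3,
             2 * b * db 0 - 2 * c * db 1 - dc 2;
           -dc 0, -dc 1, 2 * b * db 0 - 2 * c * db 1 - dc 2,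
             2 * c * dc 1 - 2 * b * dc 0 - dc 3]
  | 2 => !![0, 0, 0, 0; 0, 0, 0, 0; 0, 0, da 0, -db 0; 0, 0, -db 0, dc 0]
  | 3 => !![0, 0, 0, 0; 0, 0, 0, 0; 0, 0, da 1, -db 1; 0, 0, -db 1, dc 1]

theorem chrN_walker (i j k : Fin 4) :
    chrN (walkerInv a b c) (fun m => walkerDir (da m) (db m) (dc m)) i j k =
      walkerChr a b c da db dc i j k := by
  revert i j k
  simp only [forall_fin_four, chrN, Fin.sum_univ_four, walkerInv_entries, walkerDir_entries]
  refine ⟨?_, ?_, ?_, ?_⟩ <;>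
  refine ⟨⟨?_, ?_, ?_, ?_⟩, ⟨?_, ?_, ?_, ?_⟩, ⟨?_, ?_, ?_, ?_⟩, ?_, ?_, ?_, ?_⟩ <;>
    simp [walkerChr] <;> ring

theorem walkerChr_zero_entries :
    walkerChr a b c da db dc 0 0 0 = 0 ∧
    walkerChr a b c da db dc 0 0 1 = 0 ∧
    walkerChr a b c da db dc 0 0 2 = -da 0 ∧
    walkerChr a b c da db dc 0 0 3 = db 0 ∧
    walkerChr a b c da db dc 0 1 0 = 0 ∧
    walkerChr a b c da db dc 0 1 1 = 0 ∧
    walkerChr a b c da db dc 0 1 2 = -da 1 ∧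
    walkerChr a b c da db dc 0 1 3 = db 1 ∧
    walkerChr a b c da db dc 0 2 0 = -da 0 ∧
    walkerChr a b c da db dc 0 2 1 = -da 1 ∧
    walkerChr a b c da db dc 0 2 2 = 2 * a * da 0 - 2 * b * da 1 - da 2 ∧
    walkerChr a b c da db dc 0 2 3 = 2 * b * db 1 - 2 * a * db 0 - da 3 ∧
    walkerChr a b c da db dc 0 3 0 = db 0 ∧
    walkerChr a b c da db dc 0 3 1 = db 1 ∧
    walkerChr a b c da db dc 0 3 2 = 2 * b * db 1 - 2 * a * db 0 - da 3 ∧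
    walkerChr a b c da db dc 0 3 3 = 2 * a * dc 0 - 2 * b * dc 1 + 2 * db 3 + dc 2 :=
  ⟨rfl, rfl, rfl, rfl, rfl, rfl, rfl, rfl, rfl, rfl, rfl, rfl, rfl, rfl, rfl, rfl⟩

theorem walkerChr_one_entries :
    walkerChr a b c da db dc 1 0 0 = 0 ∧
    walkerChr a b c da db dc 1 0 1 = 0 ∧
    walkerChr a b c da db dc 1 0 2 = db 0 ∧
    walkerChr a b c da db dc 1 0 3 = -dc 0 ∧
    walkerChr a b c da db dc 1 1 0 = 0 ∧
    walkerChr a b c da db dc 1 1 1 = 0 ∧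
    walkerChr a b c da db dc 1 1 2 = db 1 ∧
    walkerChr a b c da db dc 1 1 3 = -dc 1 ∧
    walkerChr a b c da db dc 1 2 0 = db 0 ∧
    walkerChr a b c da db dc 1 2 1 = db 1 ∧
    walkerChr a b c da db dc 1 2 2 = 2 * c * da 1 - 2 * b * da 0 + 2 * db 2 + da 3 ∧
    walkerChr a b c da db dc 1 2 3 = 2 * b * db 0 - 2 * c * db 1 - dc 2 ∧
    walkerChr a b c da db dc 1 3 0 = -dc 0 ∧
    walkerChr a b c da db dc 1 3 1 = -dc 1 ∧
    walkerChr a b c da db dc 1 3 2 = 2 * b * db 0 - 2 * c * db 1 - dc 2 ∧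
    walkerChr a b c da db dc 1 3 3 = 2 * c * dc 1 - 2 * b * dc 0 - dc 3 :=
  ⟨rfl, rfl, rfl, rfl, rfl, rfl, rfl, rfl, rfl, rfl, rfl, rfl, rfl, rfl, rfl, rfl⟩

theorem walkerChr_two_entries :
    walkerChr a b c da db dc 2 0 0 = 0 ∧
    walkerChr a b c da db dc 2 0 1 = 0 ∧
    walkerChr a b c da db dc 2 0 2 = 0 ∧
    walkerChr a b c da db dc 2 0 3 = 0 ∧
    walkerChr a b c da db dc 2 1 0 = 0 ∧
    walkerChr a b c da db dc 2 1 1 = 0 ∧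
    walkerChr a b c da db dc 2 1 2 = 0 ∧
    walkerChr a b c da db dc 2 1 3 = 0 ∧
    walkerChr a b c da db dc 2 2 0 = 0 ∧
    walkerChr a b c da db dc 2 2 1 = 0 ∧
    walkerChr a b c da db dc 2 2 2 = da 0 ∧
    walkerChr a b c da db dc 2 2 3 = -db 0 ∧
    walkerChr a b c da db dc 2 3 0 = 0 ∧
    walkerChr a b c da db dc 2 3 1 = 0 ∧
    walkerChr a b c da db dc 2 3 2 = -db 0 ∧
    walkerChr a b c da db dc 2 3 3 = dc 0 :=
  ⟨rfl, rfl, rfl, rfl, rfl, rfl, rfl, rfl, rfl, rfl, rfl, rfl, rfl, rfl, rfl, rfl⟩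

theorem walkerChr_three_entries :
    walkerChr a b c da db dc 3 0 0 = 0 ∧
    walkerChr a b c da db dc 3 0 1 = 0 ∧
    walkerChr a b c da db dc 3 0 2 = 0 ∧
    walkerChr a b c da db dc 3 0 3 = 0 ∧
    walkerChr a b c da db dc 3 1 0 = 0 ∧
    walkerChr a b c da db dc 3 1 1 = 0 ∧
    walkerChr a b c da db dc 3 1 2 = 0 ∧
    walkerChr a b c da db dc 3 1 3 = 0 ∧
    walkerChr a b c da db dc 3 2 0 = 0 ∧
    walkerChr a b c da db dc 3 2 1 = 0 ∧
    walkerChr a b c da db dc 3 2 2 = da 1 ∧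
    walkerChr a b c da db dc 3 2 3 = -db 1 ∧
    walkerChr a b c da db dc 3 3 0 = 0 ∧
    walkerChr a b c da db dc 3 3 1 = 0 ∧
    walkerChr a b c da db dc 3 3 2 = -db 1 ∧
    walkerChr a b c da db dc 3 3 3 = dc 1 :=
  ⟨rfl, rfl, rfl, rfl, rfl, rfl, rfl, rfl, rfl, rfl, rfl, rfl, rfl, rfl, rfl, rfl⟩

/-- The quadratic terms and second derivatives in the curvature of a Walker metric. -/
noncomputable def walkerCurv : Fin 5 → ℝ
  | 0 => -(dda 0 3 + ddb 0 2 + da 1 * dc 0 - db 0 * db 1) / 2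
  | 1 => (ddb 0 3 + ddc 0 2 - db 0 ^ 2 + da 0 * dc 0 - db 0 * dc 1 + db 1 * dc 0) / 2
  | 2 => (db 1 ^ 2 - dda 1 3 - ddb 1 2 + da 0 * db 1 - da 1 * db 0 - da 1 * dc 1) / 2
  | 3 => (ddb 1 3 + ddc 1 2 + da 1 * dc 0 - db 0 * db 1) / 2
  | 4 => (dda 3 3 + ddc 2 2) / 2 + ddb 2 3 + a * (db 0 ^ 2 - da 0 * dc 0) +
      c * (db 1 ^ 2 - da 1 * dc 1) + b * (da 0 * dc 1 + da 1 * dc 0 - 2 * db 0 * db 1) -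
      da 0 * db 3 + da 3 * db 0 + db 1 * dc 2 - db 2 * dc 1 +
      (da 1 * dc 3 - da 0 * dc 2 + da 2 * dc 0 - da 3 * dc 1) / 2

/-- The curvature tensor of a Walker metric with all indices lowered; the last two indices are
fixed. -/
noncomputable def walkerRiem (k l i j : Fin 4) : ℝ :=
  ∑ s, walkerMetric a b c i s * riemN (walkerInv a b c)
    (fun m => walkerInvDir (da m) (db m) (dc m)) (fun m => walkerDir (da m) (db m) (dc m))
    (fun m n => walkerDir (dda m n) (ddb m n) (ddc m n)) s j k l

/-- Six pairs k < l suffice by antisymmetry. The four quantities `walkerCurv` 0 to 3 occur both in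
the pairs (0,2), ..., (1,3) and in the pair (2,3), as pair symmetry of the curvature requires. -/
theorem walkerRiem_eq (ha : ∀ m n, dda m n = dda n m) (hb : ∀ m n, ddb m n = ddb n m)
    (hc : ∀ m n, ddc m n = ddc n m) (i j : Fin 4) :
    walkerRiem a b c da db dc dda ddb ddc 0 1 i j = 0 ∧
    walkerRiem a b c da db dc dda ddb ddc 0 2 i j = skew 0 (dda 0 0 / 2) (-ddb 0 0 / 2)
      (dda 0 1 / 2) (-ddb 0 1 / 2) (walkerCurv a b c da db dc dda ddb ddc 0) i j ∧
    walkerRiem a b c da db dc dda ddb ddc 0 3 i j = skew 0 (-ddb 0 0 / 2) (ddc 0 0 / 2)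
      (-ddb 0 1 / 2) (ddc 0 1 / 2) (walkerCurv a b c da db dc dda ddb ddc 1) i j ∧
    walkerRiem a b c da db dc dda ddb ddc 1 2 i j = skew 0 (dda 0 1 / 2) (-ddb 0 1 / 2)
      (dda 1 1 / 2) (-ddb 1 1 / 2) (walkerCurv a b c da db dc dda ddb ddc 2) i j ∧
    walkerRiem a b c da db dc dda ddb ddc 1 3 i j = skew 0 (-ddb 0 1 / 2) (ddc 0 1 / 2)
      (-ddb 1 1 / 2) (ddc 1 1 / 2) (walkerCurv a b c da db dc dda ddb ddc 3) i j ∧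
    walkerRiem a b c da db dc dda ddb ddc 2 3 i j = skew 0
      (walkerCurv a b c da db dc dda ddb ddc 0) (walkerCurv a b c da db dc dda ddb ddc 1)
      (walkerCurv a b c da db dc dda ddb ddc 2) (walkerCurv a b c da db dc dda ddb ddc 3)
      (walkerCurv a b c da db dc dda ddb ddc 4) i j := by
  revert i j
  simp only [forall_fin_four, walkerRiem, riemN, dchrN, chrN_walker, Fin.sum_univ_four,
    walkerInv_entries, walkerInvDir_entries, walkerDir_entries, walkerMetric_entries,
    skew_entries, walkerChr_zero_entries, walkerChr_one_entries, walkerChr_two_entries,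
    walkerChr_three_entries, walkerCurv, ha 1 0, ha 2 0, ha 3 0, ha 2 1, ha 3 1, ha 3 2,
    hb 1 0, hb 2 0, hb 3 0, hb 2 1, hb 3 1, hb 3 2, hc 1 0, hc 2 0, hc 3 0, hc 2 1, hc 3 1,
    hc 3 2, mul_zero, zero_mul, add_zero, zero_add, sub_zero, zero_sub, neg_zero, sub_self]
  refine ⟨⟨?_, ?_, ?_, ?_⟩, ⟨?_, ?_, ?_, ?_⟩, ⟨?_, ?_, ?_, ?_⟩, ?_, ?_, ?_, ?_⟩ <;>
    refine ⟨?_, ?_, ?_, ?_, ?_, ?_⟩ <;> first | trivial | ring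

end Tables

section Tables
variable (a b c : ℝ) (da db dc : Fin 4 → ℝ) (dda ddb ddc : Fin 4 → Fin 4 → ℝ)

theorem riemN_swap (G : Mat4) (dG dg : Fin 4 → Mat4) (ddg : Fin 4 → Fin 4 → Mat4)
    (i j k l : Fin 4) : riemN G dG dg ddg i j l k = -riemN G dG dg ddg i j k l := by
  simp only [riemN, Finset.sum_sub_distrib]
  ring

theorem walkerRiem_swap (i j k l : Fin 4) : walkerRiem a b c da db dc dda ddb ddc l k i j =
    -walkerRiem a b c da db dc dda ddb ddc k l i j := by
  simp only [walkerRiem, riemN_swap _ _ _ _ _ _ k l, mul_neg, Finset.sum_neg_distrib]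

theorem walkerRiem_self (i j k : Fin 4) : walkerRiem a b c da db dc dda ddb ddc k k i j = 0 := by
  have := walkerRiem_swap a b c da db dc dda ddb ddc i j k k
  linarith

/-- The Ricci tensor of a Walker metric. -/
noncomputable def walkerRic (j l : Fin 4) : ℝ :=
  ∑ i, ∑ s, walkerInv a b c i s * walkerRiem a b c da db dc dda ddb ddc i l s j

theorem walkerRic_eq (ha : ∀ m n, dda m n = dda n m) (hb : ∀ m n, ddb m n = ddb n m)
    (hc : ∀ m n, ddc m n = ddc n m) (j l : Fin 4) :
    walkerRic a b c da db dc dda ddb ddc j l =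
      !![0, 0, ddb 0 1 - dda 0 0, ddb 0 0 - ddc 0 1;
         0, 0, ddb 1 1 - dda 0 1, ddb 0 1 - ddc 1 1;
         ddb 0 1 - dda 0 0, ddb 1 1 - dda 0 1,
           2 * a * dda 0 0 - 4 * b * dda 0 1 + 2 * c * dda 1 1 -
             4 * walkerCurv a b c da db dc dda ddb ddc 2,
           -2 * a * ddb 0 0 + 4 * b * ddb 0 1 - 2 * c * ddb 1 1 +
             2 * walkerCurv a b c da db dc dda ddb ddc 0 -
             2 * walkerCurv a b c da db dc dda ddb ddc 3;
         ddb 0 0 - ddc 0 1, ddb 0 1 - ddc 1 1,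
           -2 * a * ddb 0 0 + 4 * b * ddb 0 1 - 2 * c * ddb 1 1 +
             2 * walkerCurv a b c da db dc dda ddb ddc 0 -
             2 * walkerCurv a b c da db dc dda ddb ddc 3,
           2 * a * ddc 0 0 - 4 * b * ddc 0 1 + 2 * c * ddc 1 1 +
             4 * walkerCurv a b c da db dc dda ddb ddc 1] j l := by
  have T := walkerRiem_eq a b c da db dc dda ddb ddc ha hb hc
  have S := fun i j => walkerRiem_swap a b c da db dc dda ddb ddc i j
  revert j l
  simp only [forall_fin_four, walkerRic, Fin.sum_univ_four, walkerRiem_self, T,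
    fun i j => S i j 0 1, fun i j => S i j 0 2, fun i j => S i j 0 3, fun i j => S i j 1 2,
    fun i j => S i j 1 3, fun i j => S i j 2 3, walkerInv_entries, skew_entries]
  refine ⟨⟨?_, ?_, ?_, ?_⟩, ⟨?_, ?_, ?_, ?_⟩, ⟨?_, ?_, ?_, ?_⟩, ?_, ?_, ?_, ?_⟩ <;>
    simp <;> ring

end Tables

/-! ### The Hodge star on two-forms of a Walker metric -/

section Star

/-- The sign of a permutation is a quotient of Vandermonde products, and 12 is the product at (0, 1,
2, 3). Repeated indices give zero on both sides. The finitely many cases are decided over the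
integers. -/
theorem leviCivita_eq (a b c d : Fin 4) : leviCivita a b c d =
    (((b : ℝ) - a) * (c - a) * (d - a) * (c - b) * (d - b) * (d - c)) / 12 := by
  have h : ∀ a b c d : Fin 4, 12 * (Matrix.of fun r s : Fin 4 =>
      if ![a, b, c, d] r = s then (1 : ℤ) else 0).det =
      ((b : ℤ) - a) * (c - a) * (d - a) * (c - b) * (d - b) * (d - c) := by
    simp only [Matrix.det_succ_row_zero, Fin.sum_univ_succ]
    simp [Fin.succAbove]
    decide +kernel
  have e : leviCivita a b c d = (((Matrix.of fun r s : Fin 4 =>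
      if ![a, b, c, d] r = s then (1 : ℤ) else 0).det : ℤ) : ℝ) := by
    rw [leviCivita, Int.cast_det]
    congr 1
    ext r s
    simp [apply_ite]
  have := h a b c d
  rw [e, eq_div_iff (by norm_num)]
  exact_mod_cast (mul_comm _ _).trans this

theorem sum_leviCivita (X : Fin 4 → Fin 4 → Fin 4 → ℝ) :
    (∑ a, ∑ b, ∑ d, leviCivita a 0 b d * X a b d =
      -X 1 2 3 + X 1 3 2 + X 2 1 3 - X 2 3 1 - X 3 1 2 + X 3 2 1) ∧
    (∑ a, ∑ b, ∑ d, leviCivita a 1 b d * X a b d =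
      X 0 2 3 - X 0 3 2 - X 2 0 3 + X 2 3 0 + X 3 0 2 - X 3 2 0) ∧
    (∑ a, ∑ b, ∑ d, leviCivita a 2 b d * X a b d =
      -X 0 1 3 + X 0 3 1 + X 1 0 3 - X 1 3 0 - X 3 0 1 + X 3 1 0) ∧
    (∑ a, ∑ b, ∑ d, leviCivita a 3 b d * X a b d =
      X 0 1 2 - X 0 2 1 - X 1 0 2 + X 1 2 0 + X 2 0 1 - X 2 1 0) := by
  have e3 : ((3 : Fin 4) : ℕ) = 3 := rfl
  refine ⟨?_, ?_, ?_, ?_⟩ <;> simp only [Fin.sum_univ_four, leviCivita_eq] <;> norm_num [e3] <;>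
    ring

/-- For fixed last indices the Weyl tensor is a two-form in the first two, and 1/4 is √det g. Only
p, q + t and v + ar - 2bt - cs occur on the right: they are coordinates on the three-dimensional
image of 1 - *. -/
theorem skew_sub_star (a b c p q r s t v : ℝ) (i j : Fin 4) :
    (∑ e, walkerInv a b c i e * skew p q r s t v e j) - 1 / 2 * (1 / 4) * ∑ e, ∑ f, ∑ h, ∑ d,
      walkerInv a b c i e * walkerInv a b c f h * leviCivita e j f d *
        ∑ m, walkerInv a b c d m * skew p q r s t v m h =
      2 * !![2 * b * p - q - t, 2 * a * p, 2 * a * (q + t),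
          2 * (v + a * r - 2 * b * t - c * s);
        -2 * c * p, -q - t - 2 * b * p, -2 * (v + a * r + 2 * b * q - c * s), 2 * c * (q + t);
        0, 2 * p, q + t + 2 * b * p, -2 * c * p;
        -2 * p, 0, 2 * a * p, q + t - 2 * b * p] i j := by
  have key : ∀ i j : Fin 4, ∑ e, ∑ f, ∑ h, ∑ d,
      walkerInv a b c i e * walkerInv a b c f h * leviCivita e j f d *
        ∑ m, walkerInv a b c d m * skew p q r s t v m h =
      ∑ e, ∑ f, ∑ d, leviCivita e j f d * (walkerInv a b c i e *
        ∑ h, walkerInv a b c f h * ∑ m, walkerInv a b c d m * skew p q r s t v m h) := by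
    intro i j
    refine Finset.sum_congr rfl fun e _ => Finset.sum_congr rfl fun f _ => ?_
    rw [Finset.sum_comm]
    refine Finset.sum_congr rfl fun d _ => ?_
    simp only [Finset.mul_sum]
    exact Finset.sum_congr rfl fun h _ => Finset.sum_congr rfl fun m _ => by ring
  revert i j
  simp only [forall_fin_four, key, sum_leviCivita]
  simp only [Fin.sum_univ_four, walkerInv_entries, skew_entries]
  refine ⟨⟨?_, ?_, ?_, ?_⟩, ⟨?_, ?_, ?_, ?_⟩, ⟨?_, ?_, ?_, ?_⟩, ?_, ?_, ?_, ?_⟩ <;>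
    simp <;> ring

end Star

/-! ### The Weyl tensor of a Walker metric -/

section Weyl
variable {g : Pt → Mat4} {x : Pt}

theorem riemann_swap (i j k l : Fin 4) : riemann g i j l k x = -riemann g i j k l x := by
  simp only [riemann, Finset.sum_sub_distrib]
  ring

theorem weylLow_swap (i j k l : Fin 4) : weylLow g i j l k x = -weylLow g i j k l x := by
  simp only [weylLow, riemann_swap _ _ k l, mul_neg, Finset.sum_neg_distrib]
  ring

theorem weylMinus_swap (i j k l : Fin 4) : weylMinus g i j l k x = -weylMinus g i j k l x := by
  simp only [weylMinus, hodgeWeyl, weyl, weylLow_swap _ _ k l, mul_neg, Finset.sum_neg_distrib]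
  ring

variable {a b c : ℝ} {da db dc : Fin 4 → ℝ} {dda ddb ddc : Fin 4 → Fin 4 → ℝ}

theorem weylMinus_eq_of_skew (hg : g x = walkerMetric a b c) {k l : Fin 4}
    {p q r s t v : ℝ} (hN : ∀ i j, weylLow g i j k l x = skew p q r s t v i j) (i j : Fin 4) :
    weylMinus g i j k l x =
      !![2 * b * p - q - t, 2 * a * p, 2 * a * (q + t),
          2 * (v + a * r - 2 * b * t - c * s);
        -2 * c * p, -q - t - 2 * b * p, -2 * (v + a * r + 2 * b * q - c * s), 2 * c * (q + t);
        0, 2 * p, q + t + 2 * b * p, -2 * c * p;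
        -2 * p, 0, 2 * a * p, q + t - 2 * b * p] i j := by
  have := skew_sub_star a b c p q r s t v i j
  simp only [weylMinus, hodgeWeyl, weyl, hN, hg, walkerMetric_inv, sqrt_det_walkerMetric]
  linarith

/-- The scalar curvature of a Walker metric, up to a factor. -/
def walkerS (dda ddb ddc : Fin 4 → Fin 4 → ℝ) : ℝ := dda 0 0 - 2 * ddb 0 1 + ddc 1 1

/-- The second component of the part `W₋` of the Weyl tensor of a Walker metric. -/
def walkerPsi (a b c : ℝ) (dda ddb ddc : Fin 4 → Fin 4 → ℝ) : ℝ :=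
  dda 0 3 + ddb 0 2 - ddb 1 3 - ddc 1 2 + a * (ddb 0 0 - ddc 0 1) -
    2 * b * (ddb 0 1 - ddc 1 1) + c * (dda 0 1 - ddb 1 1)

/-- The third component of the part `W₋` of the Weyl tensor of a Walker metric. -/
def walkerChi (a b c : ℝ) (da db dc : Fin 4 → ℝ) (dda ddb ddc : Fin 4 → Fin 4 → ℝ) : ℝ :=
  dda 3 3 + 2 * ddb 2 3 + ddc 2 2 + 2 * a * (ddb 0 3 + ddc 0 2) - 4 * b * (ddb 1 3 + ddc 1 2) +
    2 * c * (dda 1 3 + ddb 1 2) + a ^ 2 * ddc 0 0 + c ^ 2 * dda 1 1 + 4 * b ^ 2 * ddc 1 1 -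
    4 * a * b * ddc 0 1 + 2 * a * c * ddb 0 1 - 4 * b * c * ddb 1 1 -
    2 * da 0 * db 3 + 2 * da 3 * db 0 - da 0 * dc 2 + da 2 * dc 0 + da 1 * dc 3 - da 3 * dc 1 +
    2 * db 1 * dc 2 - 2 * db 2 * dc 1 - 2 * a * (db 0 * dc 1 - db 1 * dc 0) +
    2 * b * (da 0 * dc 1 - da 1 * dc 0) - 2 * c * (da 0 * db 1 - da 1 * db 0)

/-- The metric `g` agrees at `x` to second order with the Walker metric whose coefficients have the
given two-jets. -/
structure WalkerJet (g : Pt → Mat4) (x : Pt) (a b c : ℝ) (da db dc : Fin 4 → ℝ)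
    (dda ddb ddc : Fin 4 → Fin 4 → ℝ) : Prop where
  metric : g x = walkerMetric a b c
  riemann : ∀ i j k l, riemann g i j k l x = riemN (walkerInv a b c)
    (fun m => walkerInvDir (da m) (db m) (dc m)) (fun m => walkerDir (da m) (db m) (dc m))
    (fun m n => walkerDir (dda m n) (ddb m n) (ddc m n)) i j k l
  symm_a : ∀ m n, dda m n = dda n m
  symm_b : ∀ m n, ddb m n = ddb n m
  symm_c : ∀ m n, ddc m n = ddc n m

namespace WalkerJet

theorem lowRiemann (W : WalkerJet g x a b c da db dc dda ddb ddc) (i j k l : Fin 4) :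
    ∑ s, g x i s * SecondHeavenly.riemann g s j k l x =
      walkerRiem a b c da db dc dda ddb ddc k l i j := by
  simp only [walkerRiem, W.metric, W.riemann]

theorem riemann_eq_sum (W : WalkerJet g x a b c da db dc dda ddb ddc) (i j k l : Fin 4) :
    SecondHeavenly.riemann g i j k l x =
      ∑ s, walkerInv a b c i s * walkerRiem a b c da db dc dda ddb ddc k l s j := by
  have h : ∀ (v : Fin 4 → ℝ) (i : Fin 4),
      v i = ∑ s, walkerInv a b c i s * ∑ r, walkerMetric a b c s r * v r := by
    intro v
    simp only [forall_fin_four, Fin.sum_univ_four, walkerInv_entries, walkerMetric_entries]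
    refine ⟨?_, ?_, ?_, ?_⟩ <;> ring
  rw [h (fun i => SecondHeavenly.riemann g i j k l x) i]
  simp only [← W.metric, W.lowRiemann]

theorem ricci_eq (W : WalkerJet g x a b c da db dc dda ddb ddc) (j l : Fin 4) :
    ricci g j l x = walkerRic a b c da db dc dda ddb ddc j l := by
  simp only [ricci, walkerRic, W.riemann_eq_sum]

theorem scalarCurv_eq (W : WalkerJet g x a b c da db dc dda ddb ddc) :
    scalarCurv g x = -4 * walkerS dda ddb ddc := by
  simp only [scalarCurv, W.ricci_eq, W.metric, walkerMetric_inv, Fin.sum_univ_four,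
    walkerInv_entries, walkerRic_eq a b c da db dc dda ddb ddc W.symm_a W.symm_b W.symm_c,
    walkerS]
  simp
  ring

/-- Needed in order to treat the first index pair as a two-form. The last pair is reduced to k < l,
where antisymmetry is visible in the table of `walkerRiem_eq`. -/
theorem weylLow_skew (W : WalkerJet g x a b c da db dc dda ddb ddc) (i j k l : Fin 4) :
    weylLow g i j k l x = -weylLow g j i k l x := by
  have hanti : ∀ k l i j, walkerRiem a b c da db dc dda ddb ddc k l i j =
      -walkerRiem a b c da db dc dda ddb ddc k l j i := by
    have hs : ∀ p q r s t v : ℝ, ∀ i j, skew p q r s t v i j = -skew p q r s t v j i := by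
      intro p q r s t v
      simp only [forall_fin_four, skew_entries]
      simp
    have T := walkerRiem_eq a b c da db dc dda ddb ddc W.symm_a W.symm_b W.symm_c
    have S := fun k l i j => walkerRiem_swap a b c da db dc dda ddb ddc i j k l
    have h0 := fun k i j => walkerRiem_self a b c da db dc dda ddb ddc i j k
    intro k l i j
    obtain ⟨t1, t2, t3, t4, t5, t6⟩ := T i j
    obtain ⟨t1', t2', t3', t4', t5', t6'⟩ := T j i
    have a1 := t1.trans (by rw [t1']; simp : _ = -walkerRiem a b c da db dc dda ddb ddc 0 1 j i)
    have a2 := t2.trans ((hs _ _ _ _ _ _ i j).trans (congrArg Neg.neg t2'.symm))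
    have a3 := t3.trans ((hs _ _ _ _ _ _ i j).trans (congrArg Neg.neg t3'.symm))
    have a4 := t4.trans ((hs _ _ _ _ _ _ i j).trans (congrArg Neg.neg t4'.symm))
    have a5 := t5.trans ((hs _ _ _ _ _ _ i j).trans (congrArg Neg.neg t5'.symm))
    have a6 := t6.trans ((hs _ _ _ _ _ _ i j).trans (congrArg Neg.neg t6'.symm))
    clear t1 t2 t3 t4 t5 t6 t1' t2' t3' t4' t5' t6'
    revert k l
    simp only [forall_fin_four, h0, S 0 1, S 0 2, S 0 3, S 1 2, S 1 3, S 2 3, neg_inj]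
    simp only [a1, a2, a3, a4, a5, a6, neg_zero, and_self]
  have hsym : ∀ i j, g x i j = g x j i := by
    rw [W.metric]
    simp only [forall_fin_four, walkerMetric_entries, and_self]
  simp only [weylLow, W.lowRiemann]
  rw [hanti k l i j]
  ring

theorem weylLow_eq_skew (W : WalkerJet g x a b c da db dc dda ddb ddc) (k l i j : Fin 4) :
    weylLow g i j k l x = skew (weylLow g 0 1 k l x) (weylLow g 0 2 k l x) (weylLow g 0 3 k l x)
      (weylLow g 1 2 k l x) (weylLow g 1 3 k l x) (weylLow g 2 3 k l x) i j := by
  have h := fun i j => W.weylLow_skew i j k l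
  have h0 : ∀ i, weylLow g i i k l x = 0 := fun i => by linarith [h i i]
  revert i j
  simp only [forall_fin_four, skew_entries, h0, h 1 0, h 2 0, h 3 0, h 2 1, h 3 1, h 3 2,
    and_self]

/-- The three groups are the combinations p, q + t and v + ar - 2bt - cs of `skew_sub_star`,
evaluated for the six last pairs. Everything reduces to three scalars, which is why three scalar
conditions characterise W₋ = 0. -/
theorem weylLow_selfdual (W : WalkerJet g x a b c da db dc dda ddb ddc) :
    (weylLow g 0 1 0 1 x = 0 ∧ weylLow g 0 1 0 2 x = 0 ∧ weylLow g 0 1 0 3 x = 0 ∧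
      weylLow g 0 1 1 2 x = 0 ∧ weylLow g 0 1 1 3 x = 0 ∧
      weylLow g 0 1 2 3 x = walkerS dda ddb ddc / 12) ∧
    (weylLow g 0 2 0 1 x + weylLow g 1 3 0 1 x = 0 ∧
      weylLow g 0 2 0 2 x + weylLow g 1 3 0 2 x = walkerS dda ddb ddc / 6 ∧
      weylLow g 0 2 0 3 x + weylLow g 1 3 0 3 x = 0 ∧
      weylLow g 0 2 1 2 x + weylLow g 1 3 1 2 x = 0 ∧
      weylLow g 0 2 1 3 x + weylLow g 1 3 1 3 x = walkerS dda ddb ddc / 6 ∧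
      weylLow g 0 2 2 3 x + weylLow g 1 3 2 3 x =
        -walkerPsi a b c dda ddb ddc / 2 + b * walkerS dda ddb ddc / 2) ∧
    (weylLow g 2 3 0 1 x + a * weylLow g 0 3 0 1 x - 2 * b * weylLow g 1 3 0 1 x -
        c * weylLow g 1 2 0 1 x = walkerS dda ddb ddc / 12 ∧
      weylLow g 2 3 0 2 x + a * weylLow g 0 3 0 2 x - 2 * b * weylLow g 1 3 0 2 x -
        c * weylLow g 1 2 0 2 x =
        -walkerPsi a b c dda ddb ddc / 4 + b * walkerS dda ddb ddc / 6 ∧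
      weylLow g 2 3 0 3 x + a * weylLow g 0 3 0 3 x - 2 * b * weylLow g 1 3 0 3 x -
        c * weylLow g 1 2 0 3 x = -c * walkerS dda ddb ddc / 12 ∧
      weylLow g 2 3 1 2 x + a * weylLow g 0 3 1 2 x - 2 * b * weylLow g 1 3 1 2 x -
        c * weylLow g 1 2 1 2 x = a * walkerS dda ddb ddc / 12 ∧
      weylLow g 2 3 1 3 x + a * weylLow g 0 3 1 3 x - 2 * b * weylLow g 1 3 1 3 x -
        c * weylLow g 1 2 1 3 x = -walkerPsi a b c dda ddb ddc / 4 ∧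
      weylLow g 2 3 2 3 x + a * weylLow g 0 3 2 3 x - 2 * b * weylLow g 1 3 2 3 x -
        c * weylLow g 1 2 2 3 x = walkerChi a b c da db dc dda ddb ddc / 2 -
          b * walkerPsi a b c dda ddb ddc / 2) := by
  simp only [weylLow, W.lowRiemann]
  simp only [schouten, W.scalarCurv_eq, W.ricci_eq, W.metric,
    walkerRic_eq a b c da db dc dda ddb ddc W.symm_a W.symm_b W.symm_c,
    walkerRiem_eq a b c da db dc dda ddb ddc W.symm_a W.symm_b W.symm_c, skew_entries,
    walkerMetric_entries, walkerCurv, walkerS, walkerPsi, walkerChi]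
  refine ⟨⟨?_, ?_, ?_, ?_, ?_, ?_⟩, ⟨?_, ?_, ?_, ?_, ?_, ?_⟩, ?_, ?_, ?_, ?_, ?_, ?_⟩ <;>
    simp <;> ring

/-- The components of `W₋` that determine it. -/
theorem weylMinus_components (W : WalkerJet g x a b c da db dc dda ddb ddc) :
    weylMinus g 2 1 2 3 x = walkerS dda ddb ddc / 6 ∧
    weylMinus g 2 2 2 3 x =
      -walkerPsi a b c dda ddb ddc / 2 + 2 * b * walkerS dda ddb ddc / 3 ∧
    weylMinus g 0 3 2 3 x = walkerChi a b c da db dc dda ddb ddc -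
      b * walkerPsi a b c dda ddb ddc := by
  obtain ⟨⟨-, -, -, -, -, h1⟩, ⟨-, -, -, -, -, h2⟩, -, -, -, -, -, h3⟩ := W.weylLow_selfdual
  refine ⟨?_, ?_, ?_⟩ <;> rw [weylMinus_eq_of_skew W.metric (W.weylLow_eq_skew _ _)] <;> simp
  · linarith
  · linear_combination h2 + 2 * b * h1
  · linear_combination 2 * h3

theorem weylMinus_eq_zero (W : WalkerJet g x a b c da db dc dda ddb ddc)
    (h1 : walkerS dda ddb ddc = 0) (h2 : walkerPsi a b c dda ddb ddc = 0)
    (h3 : walkerChi a b c da db dc dda ddb ddc = 0) (i j k l : Fin 4) :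
    weylMinus g i j k l x = 0 := by
  have T := W.weylLow_selfdual
  simp only [h1, h2, h3, zero_div, neg_zero, mul_zero, add_zero, sub_zero] at T
  obtain ⟨P, Q, R⟩ := T
  have key : ∀ k l, weylLow g 0 1 k l x = 0 → weylLow g 0 2 k l x + weylLow g 1 3 k l x = 0 →
      weylLow g 2 3 k l x + a * weylLow g 0 3 k l x - 2 * b * weylLow g 1 3 k l x -
        c * weylLow g 1 2 k l x = 0 → ∀ i j, weylMinus g i j k l x = 0 := by
    intro k l e1 e2 e3 i j
    rw [weylMinus_eq_of_skew W.metric (W.weylLow_eq_skew _ _), e1]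
    have e4 : weylLow g 0 2 k l x = -weylLow g 1 3 k l x := by linarith
    have e5 : weylLow g 2 3 k l x = -(a * weylLow g 0 3 k l x) + 2 * b * weylLow g 1 3 k l x +
        c * weylLow g 1 2 k l x := by linarith
    rw [e4, e5]
    revert i j
    simp only [forall_fin_four]
    refine ⟨⟨?_, ?_, ?_, ?_⟩, ⟨?_, ?_, ?_, ?_⟩, ⟨?_, ?_, ?_, ?_⟩, ?_, ?_, ?_, ?_⟩ <;> simp <;> ring
  have h0 : ∀ k, weylMinus g i j k k x = 0 := fun k => by
    linarith [weylMinus_swap (g := g) (x := x) i j k k]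
  have k01 := key 0 1 P.1 Q.1 R.1 i j
  have k02 := key 0 2 P.2.1 Q.2.1 R.2.1 i j
  have k03 := key 0 3 P.2.2.1 Q.2.2.1 R.2.2.1 i j
  have k12 := key 1 2 P.2.2.2.1 Q.2.2.2.1 R.2.2.2.1 i j
  have k13 := key 1 3 P.2.2.2.2.1 Q.2.2.2.2.1 R.2.2.2.2.1 i j
  have k23 := key 2 3 P.2.2.2.2.2 Q.2.2.2.2.2 R.2.2.2.2.2 i j
  have S := fun k l => weylMinus_swap (g := g) (x := x) i j k l
  revert k l
  simp only [forall_fin_four, h0, S 0 1, S 0 2, S 0 3, S 1 2, S 1 3, S 2 3, k01, k02, k03, k12,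
    k13, k23, neg_zero, and_self]

/-- This component is linear in the two-jet of the metric: its W₋ part vanishes, and all products
cancel. With a = f u₂₂ it contains the term -f u₂₂₂₂. -/
theorem weylPlus_component (W : WalkerJet g x a b c da db dc dda ddb ddc) :
    weylPlus g 0 1 1 2 x = -dda 1 1 := by
  have e : weylPlus g 0 1 1 2 x = weyl g 0 1 1 2 x - weylMinus g 0 1 1 2 x := by
    rw [weylPlus, weylMinus]
    ring
  rw [e, weylMinus_eq_of_skew W.metric (W.weylLow_eq_skew _ _), W.weylLow_selfdual.1.2.2.2.1, weyl]
  simp only [Fin.sum_univ_four, W.metric, walkerMetric_inv, walkerInv_entries]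
  have h1 : weylLow g 1 1 1 2 x = 0 := by linarith [W.weylLow_skew 1 1 1 2]
  rw [h1, W.weylLow_selfdual.1.2.2.2.1, W.weylLow_skew 2 1 1 2]
  simp only [weylLow, W.lowRiemann]
  simp only [schouten, W.ricci_eq, W.metric,
    walkerRic_eq a b c da db dc dda ddb ddc W.symm_a W.symm_b W.symm_c,
    walkerRiem_eq a b c da db dc dda ddb ddc W.symm_a W.symm_b W.symm_c, skew_entries,
    walkerMetric_entries]
  simp
  ring

end WalkerJet

theorem walkerJet {A B C : Pt → ℝ} {Ω : Set Pt} (hΩ : IsOpen Ω) (hx : x ∈ Ω)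
    (hA : ContDiffOn ℝ ∞ A Ω) (hB : ContDiffOn ℝ ∞ B Ω) (hC : ContDiffOn ℝ ∞ C Ω) :
    WalkerJet (fun y => walkerMetric (A y) (B y) (C y)) x (A x) (B x) (C x)
      (fun m => pd m A x) (fun m => pd m B x) (fun m => pd m C x)
      (fun m n => pd m (pd n A) x) (fun m n => pd m (pd n B) x)
      (fun m n => pd m (pd n C) x) where
  metric := rfl
  riemann i j k l := by
    have dA := differentiableAt_of_smooth hΩ hA hx
    have dB := differentiableAt_of_smooth hΩ hB hx
    have dC := differentiableAt_of_smooth hΩ hC hx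
    have n0 : ∀ (m : Fin 4) (r : ℝ), pd m (fun _ => r) = fun _ => 0 := fun m r => by
      ext y; exact pd_const r
    have nn : ∀ (m : Fin 4) (h : Pt → ℝ), pd m (fun y => -h y) = fun y => -pd m h y :=
      fun m h => by ext y; exact pd_neg
    have c4 : ∀ (m : Fin 4) (r : ℝ) {h : Pt → ℝ}, DifferentiableAt ℝ h x →
      pd m (fun y => r * h y) x = r * pd m h x := fun m r h hh => pd_const_mul r hh
    rw [riemann_eq_riemN (G := fun y => walkerInv (A y) (B y) (C y)) hΩ hx
      (fun y => walkerMetric_inv _ _ _)]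
    · congr 1
      · funext m
        ext i j
        revert i j
        simp only [forall_fin_four, Matrix.of_apply, walkerInv_entries, walkerInvDir_entries,
          n0, c4 _ _ dA, c4 _ _ dB, c4 _ _ dC, and_self]
      · funext m
        ext i j
        revert i j
        simp only [forall_fin_four, Matrix.of_apply, walkerMetric_entries, walkerDir_entries,
          n0, nn, and_self]
      · funext m n
        ext i j
        revert i j
        simp only [forall_fin_four, Matrix.of_apply, walkerMetric_entries, walkerDir_entries,
          n0, nn, and_self]
    · have c0 : ∀ r : ℝ, ContDiffOn ℝ ∞ (fun _ : Pt => r) Ω := fun r => contDiffOn_const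
      simp only [forall_fin_four, walkerMetric_entries, c0, hB, hA.neg, hC.neg, and_self]
    · have c0 : ∀ r : ℝ, ContDiffOn ℝ ∞ (fun _ : Pt => r) Ω := fun r => contDiffOn_const
      simp only [forall_fin_four, walkerInv_entries, c0, (c0 4).mul hA, (c0 (-4)).mul hB,
        (c0 4).mul hC, and_self]
  symm_a _ _ := pd_comm hΩ hA hx
  symm_b _ _ := pd_comm hΩ hB hx
  symm_c _ _ := pd_comm hΩ hC hx

end Weyl

/-! ### The Weyl tensor on solutions -/

/-- Here p, q, r stand for u₁₁, u₁₂, u₂₂ and G for F(pr - q²). The hypotheses `e0`, ..., `e13` are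
first and second derivatives of the equation, and `dX`, `ddX` encode the Leibniz rule for F·v. The
first scalar needs only the symmetry of third and fourth derivatives of u. In the other two, the
derivatives of p, q, r cancel by the displayed combinations of the hypotheses. -/
theorem walker_components_of_equation (F p q r : ℝ) (dF dp dq dr : Fin 4 → ℝ)
    (ddF ddp ddq ddr : Fin 4 → Fin 4 → ℝ)
    (sF : ∀ m n, ddF m n = ddF n m) (sp : ∀ m n, ddp m n = ddp n m)
    (sq : ∀ m n, ddq m n = ddq n m) (sr : ∀ m n, ddr m n = ddr n m)
    (pq : dp 1 = dq 0) (qr : dq 1 = dr 0)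
    (ppq : ∀ m, ddp m 1 = ddq m 0) (qqr : ∀ m, ddq m 1 = ddr m 0)
    (dG : Fin 4 → ℝ) (ddG : Fin 4 → Fin 4 → ℝ)
    (hG : ∀ i, dG i = dF i * (p * r - q ^ 2) + F * (dp i * r + p * dr i - 2 * q * dq i))
    (hGG : ∀ m n, ddG m n = ddF m n * (p * r - q ^ 2) +
      dF n * (dp m * r + p * dr m - 2 * q * dq m) + dF m * (dp n * r + p * dr n - 2 * q * dq n) +
      F * (ddp m n * r + dp n * dr m + dp m * dr n + p * ddr m n - 2 * dq m * dq n -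
        2 * q * ddq m n))
    (e0 : dp 2 + dq 3 + dG 0 = 0) (e1 : dq 2 + dr 3 + dG 1 = 0)
    (e00 : ddp 0 2 + ddq 0 3 + ddG 0 0 = 0) (e01 : ddq 0 2 + ddr 0 3 + ddG 0 1 = 0)
    (e11 : ddq 1 2 + ddr 1 3 + ddG 1 1 = 0)
    (e02 : ddp 2 2 + ddq 2 3 + ddG 2 0 = 0) (e13 : ddq 3 2 + ddr 3 3 + ddG 3 1 = 0)
    (dX : Fin 4 → ℝ → (Fin 4 → ℝ) → ℝ) (ddX : Fin 4 → Fin 4 → ℝ → (Fin 4 → ℝ) →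
      (Fin 4 → Fin 4 → ℝ) → ℝ)
    (hX : ∀ m v dv, dX m v dv = dF m * v + F * dv m)
    (hXX : ∀ m n v dv ddv, ddX m n v dv ddv =
      ddF m n * v + dF n * dv m + dF m * dv n + F * ddv m n) :
    walkerS (fun m n => ddX m n r dr ddr) (fun m n => ddX m n q dq ddq)
        (fun m n => ddX m n p dp ddp) = ddF 0 0 * r - 2 * ddF 0 1 * q + ddF 1 1 * p ∧
    walkerPsi (F * r) (F * q) (F * p) (fun m n => ddX m n r dr ddr)
        (fun m n => ddX m n q dq ddq) (fun m n => ddX m n p dp ddp) =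
      (ddF 0 2 - ddF 1 3) * q + ddF 0 3 * r - ddF 1 2 * p +
        F * q * (ddF 0 0 * r - 2 * ddF 0 1 * q + ddF 1 1 * p) ∧
    walkerChi (F * r) (F * q) (F * p) (fun m => dX m r dr) (fun m => dX m q dq)
        (fun m => dX m p dp) (fun m n => ddX m n r dr ddr)
        (fun m n => ddX m n q dq ddq) (fun m n => ddX m n p dp ddp) =
      ddF 2 2 * p + 2 * ddF 2 3 * q + ddF 3 3 * r +
        (F * (ddF 0 2 + ddF 1 3) - 2 * (dF 0 * dF 2 + dF 1 * dF 3)) * (p * r - q ^ 2) +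
        2 * F * q * ((ddF 0 2 - ddF 1 3) * q + ddF 0 3 * r - ddF 1 2 * p) +
        F ^ 2 * q ^ 2 * (ddF 0 0 * r - 2 * ddF 0 1 * q + ddF 1 1 * p) := by
  have p01 := ppq 0
  have q11 := (qqr 1).trans (sr 1 0)
  have q01 := qqr 0
  have p11 := (ppq 1).trans ((sq 1 0).trans q01)
  have p12 := (sp 1 2).trans ((ppq 2).trans (sq 2 0))
  have p13 := (sp 1 3).trans ((ppq 3).trans (sq 3 0))
  have q12 := (sq 1 2).trans ((qqr 2).trans (sr 2 0))
  have q13 := (sq 1 3).trans ((qqr 3).trans (sr 3 0))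
  simp only [hG, hGG, pq, qr, p01, q01, p11, p13, q12, q13, q11, sp 2 0, sp 3 1,
    sq 2 0, sq 3 1, sr 2 0, sr 3 1, sq 3 2, sF 2 0, sF 3 1] at e0 e1 e00 e01 e11 e02 e13
  refine ⟨?_, ?_, ?_⟩ <;>
    simp only [walkerS, walkerPsi, walkerChi, hX, hXX, pq, qr, p01, q01, p11, p12, q12,
      q13, q11]
  · ring
  · linear_combination dF 0 * e1 - dF 1 * e0
  · linear_combination F * (e02 + e13) + 2 * dF 2 * e0 + 2 * dF 3 * e1 +
      F ^ 2 * (r * e00 - 2 * q * e01 + p * e11) + 2 * F * q * (dF 0 * e1 - dF 1 * e0)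

section Smooth
variable {Ω : Set Pt} {F v w : Pt → ℝ} {x : Pt}

theorem pd_mul_on (hΩ : IsOpen Ω) (hF : ContDiffOn ℝ ∞ F Ω) (hv : ContDiffOn ℝ ∞ v Ω)
    (hx : x ∈ Ω) (n : Fin 4) :
    pd n (fun y => F y * v y) x = pd n F x * v x + F x * pd n v x :=
  pd_mul (differentiableAt_of_smooth hΩ hF hx) (differentiableAt_of_smooth hΩ hv hx)

theorem pd_pd_mul_on (hΩ : IsOpen Ω) (hF : ContDiffOn ℝ ∞ F Ω) (hv : ContDiffOn ℝ ∞ v Ω)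
    (hx : x ∈ Ω) (m n : Fin 4) :
    pd m (pd n (fun y => F y * v y)) x = pd m (pd n F) x * v x + pd n F x * pd m v x +
      pd m F x * pd n v x + F x * pd m (pd n v) x := by
  have hF' := smooth_pd hΩ hF n
  have hv' := smooth_pd hΩ hv n
  rw [pd_congr_on hΩ hx fun y hy => pd_mul_on hΩ hF hv hy n,
    pd_add (differentiableAt_of_smooth hΩ (hF'.mul hv) hx)
      (differentiableAt_of_smooth hΩ (hF.mul hv') hx),
    pd_mul_on hΩ hF' hv hx, pd_mul_on hΩ hF hv' hx]
  ring

theorem pd_add_on (hΩ : IsOpen Ω) (hv : ContDiffOn ℝ ∞ v Ω) (hw : ContDiffOn ℝ ∞ w Ω)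
    (hx : x ∈ Ω) (n : Fin 4) : pd n (fun y => v y + w y) x = pd n v x + pd n w x :=
  pd_add (differentiableAt_of_smooth hΩ hv hx) (differentiableAt_of_smooth hΩ hw hx)

theorem pd_sub_on (hΩ : IsOpen Ω) (hv : ContDiffOn ℝ ∞ v Ω) (hw : ContDiffOn ℝ ∞ w Ω)
    (hx : x ∈ Ω) (n : Fin 4) : pd n (fun y => v y - w y) x = pd n v x - pd n w x :=
  pd_sub (differentiableAt_of_smooth hΩ hv hx) (differentiableAt_of_smooth hΩ hw hx)

theorem pd_eq_zero_on (hΩ : IsOpen Ω) (hv : ∀ y ∈ Ω, v y = 0) (hx : x ∈ Ω) (n : Fin 4) :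
    pd n v x = 0 := by
  rw [pd_congr_on hΩ hx hv, pd_const]

end Smooth

theorem smooth_jet1 {Ω : Set Pt} {u : Pt → ℝ} (hΩ : IsOpen Ω) (hu : ContDiffOn ℝ ∞ u Ω) :
    ContDiffOn ℝ ∞ (jet1 u) Ω :=
  contDiffOn_id.prodMk (hu.prodMk (contDiffOn_pi.2 fun i => smooth_pd hΩ hu i))

section Solution
variable {Ω : Set Pt} {u F : Pt → ℝ} {x : Pt}

/-- The metric of a function `u`, with an arbitrary coefficient function. -/
noncomputable def coeffMetric (F u : Pt → ℝ) (y : Pt) : Mat4 :=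
  walkerMetric (F y * pd 1 (pd 1 u) y) (F y * pd 0 (pd 1 u) y) (F y * pd 0 (pd 0 u) y)

/-- The conditions on a solution `u` for the vanishing of `W₋`. -/
noncomputable def condS (F u : Pt → ℝ) (x : Pt) : ℝ :=
  pd 0 (pd 0 F) x * pd 1 (pd 1 u) x - 2 * pd 0 (pd 1 F) x * pd 0 (pd 1 u) x +
    pd 1 (pd 1 F) x * pd 0 (pd 0 u) x

/-- The second condition. -/
noncomputable def condPsi (F u : Pt → ℝ) (x : Pt) : ℝ :=
  (pd 0 (pd 2 F) x - pd 1 (pd 3 F) x) * pd 0 (pd 1 u) x + pd 0 (pd 3 F) x * pd 1 (pd 1 u) x -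
    pd 1 (pd 2 F) x * pd 0 (pd 0 u) x

/-- The third condition. -/
noncomputable def condChi (F u : Pt → ℝ) (x : Pt) : ℝ :=
  pd 2 (pd 2 F) x * pd 0 (pd 0 u) x + 2 * pd 2 (pd 3 F) x * pd 0 (pd 1 u) x +
    pd 3 (pd 3 F) x * pd 1 (pd 1 u) x +
    (F x * (pd 0 (pd 2 F) x + pd 1 (pd 3 F) x) -
      2 * (pd 0 F x * pd 2 F x + pd 1 F x * pd 3 F x)) *
      (pd 0 (pd 0 u) x * pd 1 (pd 1 u) x - pd 0 (pd 1 u) x ^ 2)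

/-- The three components of W₋ and the three conditions are related by a triangular substitution:
the corrections are multiples of F u₁₂ times the earlier conditions. -/
theorem weylMinus_coeffMetric_iff (hΩ : IsOpen Ω) (hu : ContDiffOn ℝ ∞ u Ω)
    (hF : ContDiffOn ℝ ∞ F Ω)
    (hE : ∀ y ∈ Ω, pd 0 (pd 2 u) y + pd 1 (pd 3 u) y +
      F y * (pd 0 (pd 0 u) y * pd 1 (pd 1 u) y - pd 0 (pd 1 u) y ^ 2) = 0) (hx : x ∈ Ω) :
    (∀ i j k l, weylMinus (coeffMetric F u) i j k l x = 0) ↔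
      condS F u x = 0 ∧ condPsi F u x = 0 ∧ condChi F u x = 0 := by
  have su := fun i => smooth_pd hΩ hu i
  have hp := smooth_pd hΩ (su 0) 0
  have hq := smooth_pd hΩ (su 1) 0
  have hr := smooth_pd hΩ (su 1) 1
  have h2 := smooth_pd hΩ (su 2) 0
  have h3 := smooth_pd hΩ (su 3) 1
  have hd : ContDiffOn ℝ ∞ (fun y => pd 0 (pd 0 u) y * pd 1 (pd 1 u) y -
      pd 0 (pd 1 u) y * pd 0 (pd 1 u) y) Ω := (hp.mul hr).sub (hq.mul hq)
  have hG : ContDiffOn ℝ ∞ (fun y => F y * (pd 0 (pd 0 u) y * pd 1 (pd 1 u) y -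
      pd 0 (pd 1 u) y * pd 0 (pd 1 u) y)) Ω := hF.mul hd
  set G := fun y => F y * (pd 0 (pd 0 u) y * pd 1 (pd 1 u) y -
      pd 0 (pd 1 u) y * pd 0 (pd 1 u) y) with hGdef
  have comm : ∀ (i j : Fin 4), ∀ y ∈ Ω, pd i (pd j u) y = pd j (pd i u) y :=
    fun i j y hy => pd_comm hΩ hu hy
  have comm3 : ∀ (i j k : Fin 4), ∀ y ∈ Ω, pd i (pd j (pd k u)) y = pd j (pd k (pd i u)) y := by
    intro i j k y hy
    rw [pd_comm hΩ (su k) hy]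
    exact pd_congr_on hΩ hy (comm i k)
  have E0 : ∀ y ∈ Ω, pd 0 (pd 2 u) y + pd 1 (pd 3 u) y + G y = 0 := by
    intro y hy
    rw [← hE y hy, hGdef]
    ring
  have E1 : ∀ (i : Fin 4), ∀ y ∈ Ω,
      pd i (pd 0 (pd 2 u)) y + pd i (pd 1 (pd 3 u)) y + pd i G y = 0 := by
    intro i y hy
    rw [← pd_add_on hΩ h2 h3 hy, ← pd_add_on hΩ (h2.add h3) hG hy]
    exact pd_eq_zero_on hΩ E0 hy i
  have e0 : ∀ y ∈ Ω, pd 2 (pd 0 (pd 0 u)) y + pd 3 (pd 0 (pd 1 u)) y + pd 0 G y = 0 := by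
    intro y hy
    rw [comm3 2 0 0 y hy, comm3 3 0 1 y hy]
    exact E1 0 y hy
  have e1 : ∀ y ∈ Ω, pd 2 (pd 0 (pd 1 u)) y + pd 3 (pd 1 (pd 1 u)) y + pd 1 G y = 0 := by
    intro y hy
    rw [comm3 2 0 1 y hy, comm3 3 1 1 y hy, pd_comm hΩ (su 2) hy]
    exact E1 1 y hy
  have e0m : ∀ m, pd m (pd 2 (pd 0 (pd 0 u))) x + pd m (pd 3 (pd 0 (pd 1 u))) x +
      pd m (pd 0 G) x = 0 := by
    intro m
    have a1 := smooth_pd hΩ hp 2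
    have a2 := smooth_pd hΩ hq 3
    rw [← pd_add_on hΩ a1 a2 hx, ← pd_add_on hΩ (a1.add a2) (smooth_pd hΩ hG 0) hx]
    exact pd_eq_zero_on hΩ e0 hx m
  have e1m : ∀ m, pd m (pd 2 (pd 0 (pd 1 u))) x + pd m (pd 3 (pd 1 (pd 1 u))) x +
      pd m (pd 1 G) x = 0 := by
    intro m
    have a1 := smooth_pd hΩ hq 2
    have a2 := smooth_pd hΩ hr 3
    rw [← pd_add_on hΩ a1 a2 hx, ← pd_add_on hΩ (a1.add a2) (smooth_pd hΩ hG 1) hx]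
    exact pd_eq_zero_on hΩ e1 hx m
  have W := walkerJet (x := x) hΩ hx (hF.mul hr) (hF.mul hq) (hF.mul hp)
  have key := walker_components_of_equation (F x) (pd 0 (pd 0 u) x) (pd 0 (pd 1 u) x)
    (pd 1 (pd 1 u) x) (fun i => pd i F x) (fun i => pd i (pd 0 (pd 0 u)) x)
    (fun i => pd i (pd 0 (pd 1 u)) x) (fun i => pd i (pd 1 (pd 1 u)) x)
    (fun m n => pd m (pd n F) x) (fun m n => pd m (pd n (pd 0 (pd 0 u))) x)
    (fun m n => pd m (pd n (pd 0 (pd 1 u))) x) (fun m n => pd m (pd n (pd 1 (pd 1 u))) x)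
    (fun _ _ => pd_comm hΩ hF hx) (fun _ _ => pd_comm hΩ hp hx) (fun _ _ => pd_comm hΩ hq hx)
    (fun _ _ => pd_comm hΩ hr hx) (comm3 1 0 0 x hx)
    (comm3 1 0 1 x hx) (fun m => pd_congr_on hΩ hx (comm3 1 0 0))
    (fun m => pd_congr_on hΩ hx (comm3 1 0 1))
    (fun i => pd i G x) (fun m n => pd m (pd n G) x)
    (fun i => by
      rw [pd_mul_on hΩ hF hd hx, pd_sub_on hΩ (hp.mul hr) (hq.mul hq) hx,
        pd_mul_on hΩ hp hr hx, pd_mul_on hΩ hq hq hx]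
      ring)
    (fun m n => by
      have hsub : pd m (pd n (fun y => pd 0 (pd 0 u) y * pd 1 (pd 1 u) y -
          pd 0 (pd 1 u) y * pd 0 (pd 1 u) y)) x =
          pd m (pd n (fun y => pd 0 (pd 0 u) y * pd 1 (pd 1 u) y)) x -
          pd m (pd n (fun y => pd 0 (pd 1 u) y * pd 0 (pd 1 u) y)) x := by
        rw [pd_congr_on hΩ hx fun y hy => pd_sub_on hΩ (hp.mul hr) (hq.mul hq) hy n]
        exact pd_sub_on hΩ (smooth_pd hΩ (hp.mul hr) n) (smooth_pd hΩ (hq.mul hq) n) hx m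
      rw [pd_pd_mul_on hΩ hF hd hx, hsub, pd_pd_mul_on hΩ hp hr hx, pd_pd_mul_on hΩ hq hq hx,
        pd_sub_on hΩ (hp.mul hr) (hq.mul hq) hx, pd_sub_on hΩ (hp.mul hr) (hq.mul hq) hx]
      simp only [pd_mul_on hΩ hp hr hx, pd_mul_on hΩ hq hq hx]
      ring)
    (e0 x hx) (e1 x hx) (e0m 0) (e1m 0) (e1m 1) (e0m 2) (e1m 3)
    (fun m v dv => pd m F x * v + F x * dv m)
    (fun m n v dv ddv => pd m (pd n F) x * v + pd n F x * dv m + pd m F x * dv n +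
      F x * ddv m n) (fun _ _ _ => rfl) (fun _ _ _ _ _ => rfl)
  simp only [pd_mul_on hΩ hF hr hx, pd_mul_on hΩ hF hq hx, pd_mul_on hΩ hF hp hx,
    pd_pd_mul_on hΩ hF hr hx, pd_pd_mul_on hΩ hF hq hx, pd_pd_mul_on hΩ hF hp hx] at W
  obtain ⟨k1, k2, k3⟩ := key
  constructor
  · intro h
    obtain ⟨c1, c2, c3⟩ := W.weylMinus_components
    have c1' := (h 2 1 2 3).symm.trans c1
    have c2' := (h 2 2 2 3).symm.trans c2
    have c3' := (h 0 3 2 3).symm.trans c3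
    rw [k1] at c1' c2'
    rw [k2] at c2' c3'
    rw [k3] at c3'
    have r1 : condS F u x = 0 := by
      rw [condS]
      linarith
    have r2 : condPsi F u x = 0 := by
      rw [condS] at r1
      rw [condPsi]
      linear_combination 2 * c2' + 1 / 3 * F x * pd 0 (pd 1 u) x * r1
    refine ⟨r1, r2, ?_⟩
    rw [condS] at r1
    rw [condPsi] at r2
    rw [condChi]
    linear_combination -c3' - F x * pd 0 (pd 1 u) x * r2
  · rintro ⟨r1, r2, r3⟩
    rw [condS] at r1
    rw [condPsi] at r2
    rw [condChi] at r3
    refine W.weylMinus_eq_zero (k1.trans r1) (k2.trans ?_) (k3.trans ?_)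
    · linear_combination r2 + F x * pd 0 (pd 1 u) x * r1
    · linear_combination r3 + 2 * F x * pd 0 (pd 1 u) x * r2 +
        F x ^ 2 * pd 0 (pd 1 u) x ^ 2 * r1

end Solution

/-! ### Directional derivatives on the space of first jets -/

/-- The derivative of `h` in the direction of the fixed vector `v`. -/
noncomputable def dd (v : J1) (h : J1 → ℝ) (a : J1) : ℝ := fderiv ℝ h a v

/-- The coordinate vector of `x_i`. -/
def ex (i : Fin 4) : J1 := (Pi.single i 1, 0, 0)

/-- The coordinate vector of `u`. -/
def eu : J1 := (0, 1, 0)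

/-- The coordinate vector of `p_i`. -/
def ep (i : Fin 4) : J1 := (0, 0, Pi.single i 1)

theorem ex_fst (i : Fin 4) : (ex i).1 = Pi.single i 1 := rfl

theorem eu_fst : eu.1 = 0 := rfl

theorem ep_fst (i : Fin 4) : (ep i).1 = 0 := rfl

section Directional
variable {D : Set J1} {h k : J1 → ℝ} {a : J1}

theorem J1_decomp (v : J1) :
    v = ∑ i, v.1 i • ex i + v.2.1 • eu + ∑ i, v.2.2 i • ep i := by
  have e : ∀ w : Pt, w = ∑ i, w i • (Pi.single i 1 : Pt) := fun w => by
    ext j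
    simp [Finset.sum_apply, Pi.single_apply]
  refine Prod.ext ?_ (Prod.ext ?_ ?_)
  · simpa [ex, eu, ep, Prod.fst_sum] using e v.1
  · simp [ex, eu, ep, Prod.fst_sum, Prod.snd_sum]
  · simpa [ex, eu, ep, Prod.snd_sum] using e v.2.2

theorem dd_decomp (v : J1) (h : J1 → ℝ) (a : J1) :
    dd v h a = ∑ i, v.1 i * dd (ex i) h a + v.2.1 * dd eu h a + ∑ i, v.2.2 i * dd (ep i) h a := by
  conv_lhs => rw [J1_decomp v]
  simp only [dd, map_add, map_sum, map_smul, smul_eq_mul]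

theorem smooth_dd (hD : IsOpen D) (hh : ContDiffOn ℝ ∞ h D) (v : J1) :
    ContDiffOn ℝ ∞ (dd v h) D :=
  (hh.fderiv_of_isOpen hD (by simp)).clm_apply contDiffOn_const

theorem diffAt_of_smooth (hD : IsOpen D) (hh : ContDiffOn ℝ ∞ h D) (ha : a ∈ D) :
    DifferentiableAt ℝ h a :=
  (hh.contDiffAt (hD.mem_nhds ha)).differentiableAt (by simp)

theorem dd_comm (hD : IsOpen D) (hh : ContDiffOn ℝ ∞ h D) (ha : a ∈ D) (v w : J1) :
    dd v (dd w h) a = dd w (dd v h) a := by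
  have h2 : ContDiffAt ℝ 2 h a := (hh.contDiffAt (hD.mem_nhds ha)).of_le (by norm_cast)
  have hs : IsSymmSndFDerivAt ℝ h a := h2.isSymmSndFDerivAt (by simp)
  have hd : DifferentiableAt ℝ (fderiv ℝ h) a :=
    (h2.fderiv_right (m := 1) (by norm_num)).differentiableAt (by norm_num)
  have key : ∀ v w : J1, dd v (dd w h) a = fderiv ℝ (fderiv ℝ h) a v w := by
    intro v w
    have : dd w h = fun y => fderiv ℝ h y w := rfl
    rw [this, dd, fderiv_clm_apply hd (differentiableAt_const _)]
    simp
  rw [key, key, hs]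

theorem dd_congr_on (hD : IsOpen D) (ha : a ∈ D) (e : ∀ b ∈ D, h b = k b) (v : J1) :
    dd v h a = dd v k a := by
  simp only [dd, (Filter.eventuallyEq_of_mem (hD.mem_nhds ha) e).fderiv_eq]

theorem dd_const (v : J1) (c : ℝ) (a : J1) : dd v (fun _ => c) a = 0 := by simp [dd]

theorem dd_eq_zero_on (hD : IsOpen D) (ha : a ∈ D) (e : ∀ b ∈ D, h b = 0) (v : J1) :
    dd v h a = 0 := by
  rw [dd_congr_on hD ha e, dd_const]

theorem fderiv_eq_of_dd {a : J1} (h1 : ∀ i, dd (ex i) h a = dd (ex i) k a)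
    (h2 : dd eu h a = dd eu k a) (h3 : ∀ i, dd (ep i) h a = dd (ep i) k a) :
    fderiv ℝ h a = fderiv ℝ k a := by
  refine ContinuousLinearMap.ext fun v => ?_
  change dd v h a = dd v k a
  rw [dd_decomp v h, dd_decomp v k]
  simp only [h1, h2, h3]

theorem hasFDerivAt_fst_apply (i : Fin 4) (a : J1) :
    HasFDerivAt (fun b : J1 => b.1 i)
      ((ContinuousLinearMap.proj i).comp (ContinuousLinearMap.fst ℝ Pt (ℝ × Pt))) a :=
  ((ContinuousLinearMap.proj (R := ℝ) (φ := fun _ : Fin 4 => ℝ) i).comp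
    (ContinuousLinearMap.fst ℝ Pt (ℝ × Pt))).hasFDerivAt

theorem dd_fst (v : J1) (i : Fin 4) (a : J1) : dd v (fun b => b.1 i) a = v.1 i := by
  rw [dd, (hasFDerivAt_fst_apply i a).fderiv]
  rfl

end Directional

/-! ### Calculus of explicit functions of `x` -/

section Explicit
variable {h k : Pt → ℝ} {x : Pt} {i : Fin 4}

theorem pd_coord (j : Fin 4) : pd i (fun y => y j) x = if j = i then 1 else 0 := by
  have : HasFDerivAt (fun y : Pt => y j)
      (ContinuousLinearMap.proj (R := ℝ) (φ := fun _ : Fin 4 => ℝ) j) x :=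
    (ContinuousLinearMap.proj (R := ℝ) (φ := fun _ : Fin 4 => ℝ) j).hasFDerivAt
  rw [pd, this.fderiv]
  simp [Pi.single_apply]

theorem pd_pow (hh : DifferentiableAt ℝ h x) (n : ℕ) :
    pd i (fun y => h y ^ n) x = n * h x ^ (n - 1) * pd i h x := by
  rw [pd, fderiv_fun_pow n hh]
  simp [pd]

theorem pd_inv (hh : DifferentiableAt ℝ h x) (h0 : h x ≠ 0) :
    pd i (fun y => (h y)⁻¹) x = -pd i h x / h x ^ 2 := by
  have : HasFDerivAt (fun y => (h y)⁻¹) _ x := (hasDerivAt_inv h0).comp_hasFDerivAt x hh.hasFDerivAt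
  rw [pd, this.fderiv]
  simp [pd]
  ring

end Explicit

/-! ### Total derivatives -/

section Chain
variable {D : Set J1} {Ω : Set Pt} {f g : J1 → ℝ} {u v : Pt → ℝ} {x : Pt}

theorem pd_comp_jet1 (hΩ : IsOpen Ω) (hu : ContDiffOn ℝ ∞ u Ω) (hx : x ∈ Ω)
    (hg : DifferentiableAt ℝ g (jet1 u x)) (i : Fin 4) :
    pd i (fun y => g (jet1 u y)) x = dd (ex i) g (jet1 u x) + dd eu g (jet1 u x) * pd i u x +
      ∑ j, dd (ep j) g (jet1 u x) * pd i (pd j u) x := by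
  have hJ : HasFDerivAt (jet1 u) ((ContinuousLinearMap.id ℝ Pt).prod ((fderiv ℝ u x).prod
      (ContinuousLinearMap.pi fun j => fderiv ℝ (pd j u) x))) x :=
    (hasFDerivAt_id x).prodMk ((differentiableAt_of_smooth hΩ hu hx).hasFDerivAt.prodMk
      (hasFDerivAt_pi.2 fun j =>
        (differentiableAt_of_smooth hΩ (smooth_pd hΩ hu j) hx).hasFDerivAt))
  have := hg.hasFDerivAt.comp x hJ
  have e : pd i (fun y => g (jet1 u y)) x = dd (Pi.single i 1, pd i u x, fun j =>
      pd i (pd j u) x) g (jet1 u x) := by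
    rw [pd]
    change fderiv ℝ (g ∘ jet1 u) x _ = _
    rw [this.fderiv]
    rfl
  rw [e, dd_decomp]
  simp [Pi.single_apply, mul_comm]

theorem pd_pd_comp_jet1 (hD : IsOpen D) (hf : ContDiffOn ℝ ∞ f D) (hΩ : IsOpen Ω)
    (hu : ContDiffOn ℝ ∞ u Ω) (hJ : ∀ y ∈ Ω, jet1 u y ∈ D) (hx : x ∈ Ω) (k i : Fin 4) :
    pd k (pd i (fun y => f (jet1 u y))) x =
      pd k (fun y => dd (ex i) f (jet1 u y)) x +
        pd k (fun y => dd eu f (jet1 u y)) x * pd i u x +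
        ∑ j, pd k (fun y => dd (ep j) f (jet1 u y)) x * pd i (pd j u) x +
        dd eu f (jet1 u x) * pd k (pd i u) x +
        ∑ j, dd (ep j) f (jet1 u x) * pd k (pd i (pd j u)) x := by
  have sm : ∀ w, ContDiffOn ℝ ∞ (fun y => dd w f (jet1 u y)) Ω := fun w =>
    (smooth_dd hD hf w).comp (smooth_jet1 hΩ hu) hJ
  have d1 := fun w => differentiableAt_of_smooth hΩ (sm w) hx
  have d2 := fun i => differentiableAt_of_smooth hΩ (smooth_pd hΩ hu i) hx
  have d3 := fun i j => differentiableAt_of_smooth hΩ (smooth_pd hΩ (smooth_pd hΩ hu j) i) hx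
  rw [pd_congr_on hΩ hx fun y hy =>
    pd_comp_jet1 hΩ hu hy (diffAt_of_smooth hD hf (hJ y hy)) i,
    pd_add ((d1 _).fun_add ((d1 _).fun_mul (d2 _)))
      (DifferentiableAt.fun_sum fun j _ => (d1 _).fun_mul (d3 _ _)),
    pd_add (d1 _) ((d1 _).fun_mul (d2 _)), pd_mul (d1 _) (d2 _),
    pd_sum fun j _ => (d1 _).fun_mul (d3 _ _)]
  simp only [pd_mul (d1 _) (d3 _ _), Finset.sum_add_distrib]
  ring

/-- Third derivatives of u enter a second total derivative of f only linearly, with coefficients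
f_{p_j}. Two functions with the same lower derivatives at the point therefore isolate f_{p_j}. -/
theorem pd_pd_comp_jet1_sub (hD : IsOpen D) (hf : ContDiffOn ℝ ∞ f D) (hΩ : IsOpen Ω)
    (hu : ContDiffOn ℝ ∞ u Ω) (hJ : ∀ y ∈ Ω, jet1 u y ∈ D) (hx : x ∈ Ω)
    {Ω' : Set Pt} (hΩ' : IsOpen Ω') (hv : ContDiffOn ℝ ∞ v Ω') (hJ' : ∀ y ∈ Ω', jet1 v y ∈ D)
    (hx' : x ∈ Ω') (k i : Fin 4) (h1 : jet1 u x = jet1 v x)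
    (h2 : ∀ j, pd k (pd j u) x = pd k (pd j v) x) (h3 : ∀ j, pd i (pd j u) x = pd i (pd j v) x) :
    pd k (pd i (fun y => f (jet1 u y))) x - pd k (pd i (fun y => f (jet1 v y))) x =
      ∑ j, dd (ep j) f (jet1 u x) * (pd k (pd i (pd j u)) x - pd k (pd i (pd j v)) x) := by
  have e : ∀ w, pd k (fun y => dd w f (jet1 u y)) x = pd k (fun y => dd w f (jet1 v y)) x := by
    intro w
    have hw := smooth_dd hD hf w
    rw [pd_comp_jet1 hΩ hu hx (diffAt_of_smooth hD hw (hJ x hx)),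
      pd_comp_jet1 hΩ' hv hx' (diffAt_of_smooth hD hw (hJ' x hx')), h1]
    have : pd k u x = pd k v x := congrFun (congrArg (fun a : J1 => a.2.2) h1) k
    simp only [h2, this]
  have hi : pd i u x = pd i v x := congrFun (congrArg (fun a : J1 => a.2.2) h1) i
  rw [pd_pd_comp_jet1 hD hf hΩ hu hJ hx, pd_pd_comp_jet1 hD hf hΩ' hv hJ' hx']
  simp only [e, h1, h2, h3, hi, mul_sub, Finset.sum_sub_distrib]
  ring

theorem pd_comp_jet1_of_base (hΩ : IsOpen Ω) (hu : ContDiffOn ℝ ∞ u Ω) (hx : x ∈ Ω)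
    (hg : DifferentiableAt ℝ g (jet1 u x)) (h1 : dd eu g (jet1 u x) = 0)
    (h2 : ∀ j, dd (ep j) g (jet1 u x) = 0) (i : Fin 4) :
    pd i (fun y => g (jet1 u y)) x = dd (ex i) g (jet1 u x) := by
  rw [pd_comp_jet1 hΩ hu hx hg]
  simp [h1, h2]

end Chain

/-! ### Solutions with degenerate Hessian -/

section Degenerate
variable {D : Set J1} {f : J1 → ℝ} {u : Pt → ℝ} {a : J1}

theorem continuous_jet1 (hu : ContDiff ℝ ∞ u) : Continuous (jet1 u) :=
  (contDiffOn_univ.1 (smooth_jet1 isOpen_univ hu.contDiffOn)).continuous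

/-- The coefficient drops out, so the same function is a solution whatever f is. -/
theorem isSolutionOn_of_degenerate (hD : IsOpen D) (hu : ContDiff ℝ ∞ u)
    (h1 : ∀ y, pd 0 (pd 2 u) y + pd 1 (pd 3 u) y = 0)
    (h2 : ∀ y, pd 0 (pd 0 u) y * pd 1 (pd 1 u) y - pd 0 (pd 1 u) y ^ 2 = 0) :
    IsSolutionOn D f (jet1 u ⁻¹' D) u where
  isOpen := hD.preimage (continuous_jet1 hu)
  smooth := hu.contDiffOn
  mem _ hx := hx
  eq y _ := by
    simp only [SolvesAt, heavenlyOp, hess, Matrix.of_apply, h1, h2]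
    ring

theorem weylMinus_metric_iff {Ω : Set Pt} {x : Pt} (hf : ContDiffOn ℝ ∞ f D)
    (hu : IsSolutionOn D f Ω u) (hx : x ∈ Ω) :
    (∀ i j k l, weylMinus (metric f u) i j k l x = 0) ↔
      condS (fun y => f (jet1 u y)) u x = 0 ∧ condPsi (fun y => f (jet1 u y)) u x = 0 ∧
        condChi (fun y => f (jet1 u y)) u x = 0 :=
  weylMinus_coeffMetric_iff hu.isOpen hu.smooth
    (hf.comp (smooth_jet1 hu.isOpen hu.smooth) hu.mem) hu.eq hx

/-- A polynomial with first jet `a` at `a.1`, which solves the equation for every coefficient. -/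
noncomputable def testFn (a : J1) (t : ℝ) (c : Pt) (x : Pt) : ℝ :=
  a.2.1 + a.2.2 0 * (x 0 - a.1 0) + a.2.2 1 * (x 1 - a.1 1) + a.2.2 2 * (x 2 - a.1 2) +
    a.2.2 3 * (x 3 - a.1 3) + 1 / 2 * (x 1 - a.1 1) ^ 2 + t * (1 / 2) * (x 3 - a.1 3) ^ 2 +
    c 0 * (1 / 2) * (x 0 - a.1 0) * (x 3 - a.1 3) ^ 2 +
    c 1 * (1 / 2 * (x 1 - a.1 1) * (x 3 - a.1 3) ^ 2 -
      (x 0 - a.1 0) * (x 2 - a.1 2) * (x 3 - a.1 3)) +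
    c 2 * (1 / 2) * (x 2 - a.1 2) * (x 3 - a.1 3) ^ 2 + c 3 * (1 / 6) * (x 3 - a.1 3) ^ 3

theorem testFn_contDiff (a : J1) (t : ℝ) (c : Pt) : ContDiff ℝ ∞ (testFn a t c) := by
  unfold testFn
  fun_prop

theorem testFn_pd (a : J1) (t : ℝ) (c : Pt) :
    pd 0 (testFn a t c) = (fun x => a.2.2 0 + c 0 * (1 / 2) * (x 3 - a.1 3) ^ 2 -
      c 1 * (x 2 - a.1 2) * (x 3 - a.1 3)) ∧
    pd 1 (testFn a t c) = (fun x => a.2.2 1 + (x 1 - a.1 1) +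
      c 1 * (1 / 2) * (x 3 - a.1 3) ^ 2) ∧
    pd 2 (testFn a t c) = (fun x => a.2.2 2 - c 1 * (x 0 - a.1 0) * (x 3 - a.1 3) +
      c 2 * (1 / 2) * (x 3 - a.1 3) ^ 2) ∧
    pd 3 (testFn a t c) = (fun x => a.2.2 3 + t * (x 3 - a.1 3) +
      c 0 * (x 0 - a.1 0) * (x 3 - a.1 3) + c 1 * ((x 1 - a.1 1) * (x 3 - a.1 3) -
        (x 0 - a.1 0) * (x 2 - a.1 2)) + c 2 * (x 2 - a.1 2) * (x 3 - a.1 3) +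
      c 3 * (1 / 2) * (x 3 - a.1 3) ^ 2) := by
  refine ⟨?_, ?_, ?_, ?_⟩ <;> ext x <;> unfold testFn <;>
    simp (disch := fun_prop) only [pd_add, pd_mul, pd_sub, pd_pow, pd_const, pd_coord] <;>
    simp <;> ring

theorem testFn_jet1 (a : J1) (t : ℝ) (c : Pt) : jet1 (testFn a t c) a.1 = a := by
  obtain ⟨h0, h1, h2, h3⟩ := testFn_pd a t c
  refine Prod.ext rfl (Prod.ext ?_ ?_)
  · simp [jet1, testFn]
  · funext i
    revert i
    simp [forall_fin_four, jet1, h0, h1, h2, h3]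

theorem testFn_hess (a : J1) (t : ℝ) (c : Pt) (i j : Fin 4) :
    pd i (pd j (testFn a t c)) a.1 =
      !![0, 0, 0, 0; 0, 1, 0, 0; 0, 0, 0, 0; 0, 0, 0, t] i j := by
  obtain ⟨h0, h1, h2, h3⟩ := testFn_pd a t c
  revert i j
  simp only [forall_fin_four, h0, h1, h2, h3]
  refine ⟨⟨?_, ?_, ?_, ?_⟩, ⟨?_, ?_, ?_, ?_⟩, ⟨?_, ?_, ?_, ?_⟩, ?_, ?_, ?_, ?_⟩ <;>
    simp (disch := fun_prop) only [pd_add, pd_mul, pd_sub, pd_pow, pd_const, pd_coord] <;> simp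

/-- The cubic terms make all u₄₄ⱼ free parameters while leaving the two-jet at the base point
unchanged. In the term with c₂ (`c 1` in the code), x₂x₄²/2 contributes x₄ to u₂₄, which -x₁x₃x₄
compensates in u₁₃. -/
theorem testFn_third (a : J1) (t : ℝ) (c : Pt) (j : Fin 4) :
    pd 3 (pd 3 (pd j (testFn a t c))) a.1 = c j := by
  obtain ⟨h0, h1, h2, h3⟩ := testFn_pd a t c
  have e0 : pd 3 (pd 0 (testFn a t c)) = fun x => c 0 * (x 3 - a.1 3) -
      c 1 * (x 2 - a.1 2) := by
    ext x
    rw [h0]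
    simp (disch := fun_prop) only [pd_add, pd_mul, pd_sub, pd_pow, pd_const, pd_coord]
    simp
    ring
  have e1 : pd 3 (pd 1 (testFn a t c)) = fun x => c 1 * (x 3 - a.1 3) := by
    ext x
    rw [h1]
    simp (disch := fun_prop) only [pd_add, pd_mul, pd_sub, pd_pow, pd_const, pd_coord]
    simp
    ring
  have e2 : pd 3 (pd 2 (testFn a t c)) = fun x => -c 1 * (x 0 - a.1 0) +
      c 2 * (x 3 - a.1 3) := by
    ext x
    rw [h2]
    simp (disch := fun_prop) only [pd_add, pd_mul, pd_sub, pd_pow, pd_const, pd_coord]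
    simp
    ring
  have e3 : pd 3 (pd 3 (testFn a t c)) = fun x => t +
      c 0 * (x 0 - a.1 0) + c 1 * (x 1 - a.1 1) + c 2 * (x 2 - a.1 2) +
      c 3 * (x 3 - a.1 3) := by
    ext x
    rw [h3]
    simp (disch := fun_prop) only [pd_add, pd_mul, pd_sub, pd_pow, pd_const, pd_coord]
    simp
    ring
  revert j
  simp only [forall_fin_four, e0, e1, e2, e3]
  refine ⟨?_, ?_, ?_, ?_⟩ <;>
    simp (disch := fun_prop) only [pd_add, pd_mul, pd_sub, pd_const, pd_coord] <;> simp

theorem testFn_isSolutionOn (hD : IsOpen D) (f : J1 → ℝ) (a : J1) (t : ℝ) (c : Pt) :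
    IsSolutionOn D f (jet1 (testFn a t c) ⁻¹' D) (testFn a t c) := by
  obtain ⟨h0, h1, h2, h3⟩ := testFn_pd a t c
  refine isSolutionOn_of_degenerate hD (testFn_contDiff a t c) ?_ ?_ <;> intro y <;>
    simp only [h0, h1, h2, h3] <;>
    simp (disch := fun_prop) only [pd_add, pd_mul, pd_sub, pd_pow, pd_const, pd_coord] <;> simp

/-- A quadratic polynomial with first jet `a` at `a.1` and degenerate Hessian. -/
noncomputable def quadFn (a : J1) (s t : ℝ) (x : Pt) : ℝ :=
  a.2.1 + a.2.2 0 * (x 0 - a.1 0) + a.2.2 1 * (x 1 - a.1 1) + a.2.2 2 * (x 2 - a.1 2) +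
    a.2.2 3 * (x 3 - a.1 3) + 1 / 2 * (s * (x 0 - a.1 0) + t * (x 1 - a.1 1)) ^ 2

theorem quadFn_contDiff (a : J1) (s t : ℝ) : ContDiff ℝ ∞ (quadFn a s t) := by
  unfold quadFn
  fun_prop

theorem quadFn_pd (a : J1) (s t : ℝ) :
    pd 0 (quadFn a s t) =
      (fun x => a.2.2 0 + s * (s * (x 0 - a.1 0) + t * (x 1 - a.1 1))) ∧
    pd 1 (quadFn a s t) =
      (fun x => a.2.2 1 + t * (s * (x 0 - a.1 0) + t * (x 1 - a.1 1))) ∧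
    pd 2 (quadFn a s t) = (fun _ => a.2.2 2) ∧ pd 3 (quadFn a s t) = (fun _ => a.2.2 3) := by
  refine ⟨?_, ?_, ?_, ?_⟩ <;> ext x <;> unfold quadFn <;>
    simp (disch := fun_prop) only [pd_add, pd_mul, pd_sub, pd_pow, pd_const, pd_coord] <;>
    simp <;> ring

theorem quadFn_jet1 (a : J1) (s t : ℝ) : jet1 (quadFn a s t) a.1 = a := by
  obtain ⟨h0, h1, h2, h3⟩ := quadFn_pd a s t
  refine Prod.ext rfl (Prod.ext ?_ ?_)
  · simp [jet1, quadFn]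
  · funext i
    revert i
    simp [forall_fin_four, jet1, h0, h1, h2, h3]

theorem quadFn_hess (a : J1) (s t : ℝ) (x : Pt) :
    pd 0 (pd 0 (quadFn a s t)) x = s ^ 2 ∧ pd 0 (pd 1 (quadFn a s t)) x = s * t ∧
      pd 1 (pd 1 (quadFn a s t)) x = t ^ 2 ∧ pd 0 (pd 2 (quadFn a s t)) x = 0 ∧
      pd 1 (pd 3 (quadFn a s t)) x = 0 := by
  obtain ⟨h0, h1, h2, h3⟩ := quadFn_pd a s t
  rw [h0, h1, h2, h3]
  refine ⟨?_, ?_, ?_, ?_, ?_⟩ <;>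
    simp (disch := fun_prop) only [pd_add, pd_mul, pd_sub, pd_const, pd_coord] <;>
    simp <;> ring

theorem quadFn_isSolutionOn (hD : IsOpen D) (f : J1 → ℝ) (a : J1) (s t : ℝ) :
    IsSolutionOn D f (jet1 (quadFn a s t) ⁻¹' D) (quadFn a s t) := by
  refine isSolutionOn_of_degenerate hD (quadFn_contDiff a s t) (fun y => ?_) (fun y => ?_) <;>
    obtain ⟨e1, e2, e3, e4, e5⟩ := quadFn_hess a s t y
  · rw [e4, e5, add_zero]
  · rw [e1, e2, e3]
    ring

end Degenerate

/-! ### Half-flatness determines the coefficient -/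

section OnlyIf
variable {D : Set J1} {f : J1 → ℝ}

/-- For `testFn` with t = 0 the only nonzero second derivative at the base point is u₂₂ = 1, so the
third condition says that the total derivative D₄D₄f vanishes. Two choices of the cubic parameters
differ by f_{p_j}. -/
theorem dd_ep_eq_zero (hD : IsOpen D) (hf : ContDiffOn ℝ ∞ f D) (hW : WeylMinusVanishes D f)
    {a : J1} (ha : a ∈ D) (j : Fin 4) : dd (ep j) f a = 0 := by
  have key : ∀ c : Pt, pd 3 (pd 3 fun y => f (jet1 (testFn a 0 c) y)) a.1 = 0 := by
    intro c
    have hx : a.1 ∈ jet1 (testFn a 0 c) ⁻¹' D := by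
      rw [Set.mem_preimage, testFn_jet1]
      exact ha
    have hs := testFn_isSolutionOn hD f a 0 c
    have := ((weylMinus_metric_iff hf hs hx).1 (hW _ _ hs _ hx)).2.2
    simpa [condChi, testFn_hess] using this
  have hx : ∀ c, a.1 ∈ jet1 (testFn a 0 c) ⁻¹' D := fun c => by
    rw [Set.mem_preimage, testFn_jet1]
    exact ha
  have hs := fun c => testFn_isSolutionOn hD f a 0 c
  have := pd_pd_comp_jet1_sub hD hf (hs (Pi.single j 1)).isOpen (hs (Pi.single j 1)).smooth
    (hs (Pi.single j 1)).mem (hx _) (hs 0).isOpen (hs 0).smooth (hs 0).mem (hx _) 3 3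
    (by rw [testFn_jet1, testFn_jet1]) (fun j => by rw [testFn_hess, testFn_hess])
    (fun j => by rw [testFn_hess, testFn_hess])
  rw [key, key, testFn_jet1] at this
  simpa [testFn_third, Pi.single_apply] using this.symm

/-- Once f is independent of p, D₄D₄f depends on u₄₄ = t affinely with slope f_u, and it vanishes
for t = 0 and t = 1. -/
theorem dd_eu_eq_zero (hD : IsOpen D) (hf : ContDiffOn ℝ ∞ f D) (hW : WeylMinusVanishes D f)
    {a : J1} (ha : a ∈ D) : dd eu f a = 0 := by
  have hp : ∀ j, ∀ b ∈ D, dd (ep j) f b = 0 := fun j b hb => dd_ep_eq_zero hD hf hW hb j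
  have hpw : ∀ (w : J1) (j : Fin 4), dd (ep j) (dd w f) a = 0 := by
    intro w j
    rw [dd_comm hD hf ha]
    exact dd_eq_zero_on hD ha (hp j) w
  have key : ∀ t : ℝ, dd (ex 3) (dd (ex 3) f) a + dd eu (dd (ex 3) f) a * a.2.2 3 +
      (dd (ex 3) (dd eu f) a + dd eu (dd eu f) a * a.2.2 3) * a.2.2 3 + dd eu f a * t = 0 := by
    intro t
    have hx : a.1 ∈ jet1 (testFn a t 0) ⁻¹' D := by
      rw [Set.mem_preimage, testFn_jet1]
      exact ha
    have hs := testFn_isSolutionOn hD f a t 0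
    have h3 := ((weylMinus_metric_iff hf hs hx).1 (hW _ _ hs _ hx)).2.2
    have h3' : pd 3 (pd 3 fun y => f (jet1 (testFn a t 0) y)) a.1 = 0 := by
      simpa [condChi, testFn_hess] using h3
    have hJ := testFn_jet1 a t 0
    have hp3 : pd 3 (testFn a t 0) a.1 = a.2.2 3 :=
      congrFun (congrArg (fun a : J1 => a.2.2) hJ) 3
    have hz : ∀ j, pd 3 (fun y => dd (ep j) f (jet1 (testFn a t 0) y)) a.1 = 0 := fun j =>
      pd_eq_zero_on hs.isOpen (fun y hy => hp j _ (hs.mem y hy)) hx 3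
    have dg : ∀ w, DifferentiableAt ℝ (dd w f) (jet1 (testFn a t 0) a.1) := fun w => by
      rw [hJ]
      exact diffAt_of_smooth hD (smooth_dd hD hf w) ha
    rw [pd_pd_comp_jet1 hD hf hs.isOpen hs.smooth hs.mem hx,
      pd_comp_jet1 hs.isOpen hs.smooth hx (dg _), pd_comp_jet1 hs.isOpen hs.smooth hx (dg _),
      hJ, hp3] at h3'
    simpa [hz, hpw, hp _ a ha, testFn_hess] using h3'
  have h0 := key 0
  have h1 := key 1
  linarith

/-- Total derivatives of f are now partial derivatives in x. On quadratic polynomials with block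
(s², st, t²) each condition is a quadratic form in (s, t), and three values of (s, t) determine its
coefficients. -/
theorem dd_dd_ex (hD : IsOpen D) (hf : ContDiffOn ℝ ∞ f D) (hW : WeylMinusVanishes D f)
    {a : J1} (ha : a ∈ D) :
    dd (ex 0) (dd (ex 0) f) a = 0 ∧ dd (ex 0) (dd (ex 1) f) a = 0 ∧
    dd (ex 1) (dd (ex 1) f) a = 0 ∧ dd (ex 0) (dd (ex 3) f) a = 0 ∧
    dd (ex 1) (dd (ex 2) f) a = 0 ∧ dd (ex 1) (dd (ex 3) f) a = dd (ex 0) (dd (ex 2) f) a ∧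
    dd (ex 2) (dd (ex 2) f) a = 0 ∧ dd (ex 2) (dd (ex 3) f) a = 0 ∧
    dd (ex 3) (dd (ex 3) f) a = 0 := by
  have hp : ∀ j, ∀ b ∈ D, dd (ep j) f b = 0 := fun j b hb => dd_ep_eq_zero hD hf hW hb j
  have hu : ∀ b ∈ D, dd eu f b = 0 := fun b hb => dd_eu_eq_zero hD hf hW hb
  have key : ∀ s t : ℝ,
      dd (ex 0) (dd (ex 0) f) a * t ^ 2 - 2 * dd (ex 0) (dd (ex 1) f) a * (s * t) +
        dd (ex 1) (dd (ex 1) f) a * s ^ 2 = 0 ∧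
      (dd (ex 0) (dd (ex 2) f) a - dd (ex 1) (dd (ex 3) f) a) * (s * t) +
        dd (ex 0) (dd (ex 3) f) a * t ^ 2 - dd (ex 1) (dd (ex 2) f) a * s ^ 2 = 0 ∧
      dd (ex 2) (dd (ex 2) f) a * s ^ 2 + 2 * dd (ex 2) (dd (ex 3) f) a * (s * t) +
        dd (ex 3) (dd (ex 3) f) a * t ^ 2 = 0 := by
    intro s t
    have hx : a.1 ∈ jet1 (quadFn a s t) ⁻¹' D := by
      rw [Set.mem_preimage, quadFn_jet1]
      exact ha
    have hs := quadFn_isSolutionOn hD f a s t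
    have h3 := (weylMinus_metric_iff hf hs hx).1 (hW _ _ hs _ hx)
    have e1 : ∀ i, ∀ y ∈ jet1 (quadFn a s t) ⁻¹' D,
        pd i (fun y => f (jet1 (quadFn a s t) y)) y = dd (ex i) f (jet1 (quadFn a s t) y) :=
      fun i y hy => pd_comp_jet1_of_base hs.isOpen hs.smooth hy (diffAt_of_smooth hD hf hy)
        (hu _ hy) (fun j => hp j _ hy) i
    have e2 : ∀ k i, pd k (pd i (fun y => f (jet1 (quadFn a s t) y))) a.1 =
        dd (ex k) (dd (ex i) f) a := by
      intro k i
      rw [pd_congr_on hs.isOpen hx (e1 i), pd_comp_jet1_of_base hs.isOpen hs.smooth hx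
        (diffAt_of_smooth hD (smooth_dd hD hf _) hx), quadFn_jet1]
      · rw [quadFn_jet1, dd_comm hD hf ha]
        exact dd_eq_zero_on hD ha hu _
      · intro j
        rw [quadFn_jet1, dd_comm hD hf ha]
        exact dd_eq_zero_on hD ha (hp j) _
    obtain ⟨q1, q2, q3, -, -⟩ := quadFn_hess a s t a.1
    simp only [condS, condPsi, condChi, e2, q1, q2, q3] at h3
    obtain ⟨k1, k2, k3⟩ := h3
    refine ⟨k1, k2, ?_⟩
    linear_combination k3
  have k10 := key 1 0
  have k01 := key 0 1
  have k11 := key 1 1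
  norm_num at k10 k01 k11
  obtain ⟨p1, p2, p3⟩ := k10
  obtain ⟨q1, q2, q3⟩ := k01
  obtain ⟨r1, r2, r3⟩ := k11
  refine ⟨q1, ?_, p1, q2, ?_, ?_, p3, ?_, q3⟩ <;> linarith

theorem dd_add {v : J1} {h k : J1 → ℝ} {a : J1} (hh : DifferentiableAt ℝ h a)
    (hk : DifferentiableAt ℝ k a) : dd v (fun b => h b + k b) a = dd v h a + dd v k a := by
  simp only [dd, fderiv_fun_add hh hk, _root_.add_apply]

theorem dd_mul {v : J1} {h k : J1 → ℝ} {a : J1} (hh : DifferentiableAt ℝ h a)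
    (hk : DifferentiableAt ℝ k a) :
    dd v (fun b => h b * k b) a = dd v h a * k a + h a * dd v k a := by
  simp only [dd, fderiv_fun_mul hh hk, _root_.add_apply, _root_.smul_apply, smul_eq_mul]
  ring

theorem dd_quadCoeff (c : Fin 6 → ℝ) (v a : J1) : dd v (quadCoeff c) a =
    (c 0 * a.1 2 + c 1) * v.1 0 + (c 0 * a.1 3 + c 2) * v.1 1 +
      (c 0 * a.1 0 + c 3) * v.1 2 + (c 0 * a.1 1 + c 4) * v.1 3 := by
  unfold quadCoeff
  simp (disch := fun_prop) only [dd_add, dd_mul, dd_fst, dd_const]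
  ring

/-- Integration in three stages: f₁₃ = f₂₄ has zero gradient, hence is a constant κ; each fᵢ then
has constant gradient; finally f is compared with the polynomial. Each stage uses that functions
with equal derivatives on a connected open set agree once they agree at `a₀`. -/
theorem eqOn_quadCoeff (hD : IsOpen D) (hD' : IsPreconnected D) (hf : ContDiffOn ℝ ∞ f D)
    {a₀ : J1} (ha₀ : a₀ ∈ D) (hp : ∀ j, ∀ b ∈ D, dd (ep j) f b = 0)
    (hu : ∀ b ∈ D, dd eu f b = 0)
    (h : ∀ a ∈ D, dd (ex 0) (dd (ex 0) f) a = 0 ∧ dd (ex 0) (dd (ex 1) f) a = 0 ∧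
      dd (ex 1) (dd (ex 1) f) a = 0 ∧ dd (ex 0) (dd (ex 3) f) a = 0 ∧
      dd (ex 1) (dd (ex 2) f) a = 0 ∧ dd (ex 1) (dd (ex 3) f) a = dd (ex 0) (dd (ex 2) f) a ∧
      dd (ex 2) (dd (ex 2) f) a = 0 ∧ dd (ex 2) (dd (ex 3) f) a = 0 ∧
      dd (ex 3) (dd (ex 3) f) a = 0) :
    ∃ c : Fin 6 → ℝ, ∀ a ∈ D, f a = quadCoeff c a := by
  have sm := fun w => smooth_dd hD hf w
  have hpw : ∀ w j, ∀ a ∈ D, dd (ep j) (dd w f) a = 0 := by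
    intro w j a ha
    rw [dd_comm hD hf ha]
    exact dd_eq_zero_on hD ha (hp j) w
  have huw : ∀ w, ∀ a ∈ D, dd eu (dd w f) a = 0 := by
    intro w a ha
    rw [dd_comm hD hf ha]
    exact dd_eq_zero_on hD ha hu w
  have swap : ∀ i j, ∀ a ∈ D, dd (ex i) (dd (ex j) f) a = dd (ex j) (dd (ex i) f) a :=
    fun i j a ha => dd_comm hD hf ha _ _
  have eqOn : ∀ (g k : J1 → ℝ), ContDiffOn ℝ ∞ g D → ContDiffOn ℝ ∞ k D → g a₀ = k a₀ →
      (∀ a ∈ D, (∀ i, dd (ex i) g a = dd (ex i) k a) ∧ dd eu g a = dd eu k a ∧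
        ∀ j, dd (ep j) g a = dd (ep j) k a) → ∀ a ∈ D, g a = k a := by
    intro g k hg hk h0 hd
    exact hD.eqOn_of_fderiv_eq hD' (hg.differentiableOn (by simp))
      (hk.differentiableOn (by simp))
      (fun a ha => fderiv_eq_of_dd (hd a ha).1 (hd a ha).2.1 (hd a ha).2.2) ha₀ h0
  set κ := dd (ex 0) (dd (ex 2) f) a₀ with hκ
  have hz : ∀ v w, (∀ a ∈ D, dd (ex v) (dd (ex w) f) a = 0) → ∀ r, ∀ a ∈ D,
      dd r (dd (ex v) (dd (ex w) f)) a = 0 := fun v w hvw r a ha => dd_eq_zero_on hD ha hvw r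
  have h02 : ∀ a ∈ D, dd (ex 0) (dd (ex 2) f) a = κ := by
    refine eqOn _ _ (smooth_dd hD (sm _) _) contDiffOn_const rfl fun a ha => ?_
    simp only [dd_const]
    refine ⟨?_, ?_, ?_⟩
    · rw [forall_fin_four]
      refine ⟨?_, ?_, ?_, ?_⟩
      · rw [dd_congr_on hD ha (swap 0 2), dd_comm hD (sm _) ha]
        exact hz 0 0 (fun b hb => (h b hb).1) _ a ha
      · rw [dd_comm hD (sm _) ha]
        exact hz 1 2 (fun b hb => (h b hb).2.2.2.2.1) _ a ha
      · rw [dd_comm hD (sm _) ha]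
        exact hz 2 2 (fun b hb => (h b hb).2.2.2.2.2.2.1) _ a ha
      · rw [dd_comm hD (sm _) ha, dd_congr_on hD ha (swap 3 2)]
        exact hz 2 3 (fun b hb => (h b hb).2.2.2.2.2.2.2.1) _ a ha
    · rw [dd_comm hD (sm _) ha]
      exact dd_eq_zero_on hD ha (huw _) _
    · intro j
      rw [dd_comm hD (sm _) ha]
      exact dd_eq_zero_on hD ha (hpw _ j) _
  -- The vector `c` has constant term 0; `c'` corrects it so that the polynomial takes the value
  -- f(a₀) at `a₀`.
  let c : Fin 6 → ℝ := ![κ, dd (ex 0) f a₀ - κ * a₀.1 2, dd (ex 1) f a₀ - κ * a₀.1 3,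
    dd (ex 2) f a₀ - κ * a₀.1 0, dd (ex 3) f a₀ - κ * a₀.1 1, 0]
  let c' : Fin 6 → ℝ := ![κ, dd (ex 0) f a₀ - κ * a₀.1 2, dd (ex 1) f a₀ - κ * a₀.1 3,
    dd (ex 2) f a₀ - κ * a₀.1 0, dd (ex 3) f a₀ - κ * a₀.1 1, f a₀ - quadCoeff c a₀]
  have lin : ∀ i : Fin 4, ContDiff ℝ ∞ fun b : J1 => b.1 i := fun i => by fun_prop
  have first : ∀ i m : Fin 4, (∀ k, ∀ a ∈ D, dd (ex k) (dd (ex i) f) a = if m = k then κ else 0) →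
      ∀ a ∈ D, dd (ex i) f a = κ * a.1 m + (dd (ex i) f a₀ - κ * a₀.1 m) := by
    intro i m hk
    refine eqOn _ _ (sm _) ((contDiff_const.mul (lin m)).add contDiff_const).contDiffOn
      (by ring) fun a ha => ?_
    have e : ∀ v, dd v (fun b : J1 => κ * b.1 m + (dd (ex i) f a₀ - κ * a₀.1 m)) a =
        κ * v.1 m := by
      intro v
      simp (disch := fun_prop) only [dd_add, dd_mul, dd_fst, dd_const]
      ring
    simp only [e, hk _ a ha, huw _ a ha, hpw _ _ a ha]
    simp [ex_fst, eu_fst, ep_fst, Pi.single_apply]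
  have f0 := first 0 2 (by
    rw [forall_fin_four]
    refine ⟨fun a ha => ?_, fun a ha => ?_, fun a ha => ?_, fun a ha => ?_⟩ <;> simp
    exacts [(h a ha).1, (swap 1 0 a ha).trans (h a ha).2.1, (swap 2 0 a ha).trans (h02 a ha),
      (swap 3 0 a ha).trans (h a ha).2.2.2.1])
  have f1 := first 1 3 (by
    rw [forall_fin_four]
    refine ⟨fun a ha => ?_, fun a ha => ?_, fun a ha => ?_, fun a ha => ?_⟩ <;> simp
    exacts [(h a ha).2.1, (h a ha).2.2.1, (swap 2 1 a ha).trans (h a ha).2.2.2.2.1,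
      (swap 3 1 a ha).trans ((h a ha).2.2.2.2.2.1.trans (h02 a ha))])
  have f2 := first 2 0 (by
    rw [forall_fin_four]
    refine ⟨fun a ha => ?_, fun a ha => ?_, fun a ha => ?_, fun a ha => ?_⟩ <;> simp
    exacts [h02 a ha, (h a ha).2.2.2.2.1, (h a ha).2.2.2.2.2.2.1,
      (swap 3 2 a ha).trans (h a ha).2.2.2.2.2.2.2.1])
  have f3 := first 3 1 (by
    rw [forall_fin_four]
    refine ⟨fun a ha => ?_, fun a ha => ?_, fun a ha => ?_, fun a ha => ?_⟩ <;> simp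
    exacts [(h a ha).2.2.2.1, (h a ha).2.2.2.2.2.1.trans (h02 a ha),
      (h a ha).2.2.2.2.2.2.2.1, (h a ha).2.2.2.2.2.2.2.2])
  refine ⟨c', eqOn _ _ hf ?_ ?_ fun a ha => ?_⟩
  · unfold quadCoeff
    fun_prop
  · simp [c', c, quadCoeff]
  · simp only [dd_quadCoeff]
    refine ⟨?_, ?_, ?_⟩
    · rw [forall_fin_four]
      simp [f0 a ha, f1 a ha, f2 a ha, f3 a ha, ex_fst, c']
    · simp [hu a ha, eu_fst]
    · intro j
      simp [hp j a ha, ep_fst]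

end OnlyIf

/-! ### A solution with nondegenerate Hessian -/

/-- The three equations express that `ratFn` solves the equation. If d₀ = 0, the hypothesis gives
(d₁, d₂) ≠ 0, and a rotation-type system is inverted. If d₀ ≠ 0, take η = 0 and eliminate A and B;
what is left is μ(2md₀ - d₁² - d₂²) = d₁d₃ + d₂d₄ - d₀d₅, and m = 1 or m = 2 makes the factor of μ
nonzero. -/
theorem exists_rational_parameters (d : Fin 6 → ℝ) (hd : d 1 * d 3 + d 2 * d 4 - d 0 * d 5 ≠ 0) :
    ∃ m μ η A B : ℝ, m ≠ 0 ∧ 2 * m * μ - A * d 1 - B * d 2 = -d 5 ∧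
      μ * d 1 + η * d 2 - A * d 0 = -d 3 ∧ μ * d 2 - η * d 1 - B * d 0 = -d 4 := by
  by_cases h0 : d 0 = 0
  · have hr : d 1 ^ 2 + d 2 ^ 2 ≠ 0 := by
      intro h
      have h1 : d 1 = 0 := by nlinarith [sq_nonneg (d 1), sq_nonneg (d 2)]
      have h2 : d 2 = 0 := by nlinarith [sq_nonneg (d 1), sq_nonneg (d 2)]
      simp [h0, h1, h2] at hd
    refine ⟨1, -(d 3 * d 1 + d 4 * d 2) / (d 1 ^ 2 + d 2 ^ 2),
      (d 4 * d 1 - d 3 * d 2) / (d 1 ^ 2 + d 2 ^ 2),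
      (2 * (-(d 3 * d 1 + d 4 * d 2) / (d 1 ^ 2 + d 2 ^ 2)) + d 5) * d 1 / (d 1 ^ 2 + d 2 ^ 2),
      (2 * (-(d 3 * d 1 + d 4 * d 2) / (d 1 ^ 2 + d 2 ^ 2)) + d 5) * d 2 / (d 1 ^ 2 + d 2 ^ 2),
      one_ne_zero, ?_, ?_, ?_⟩ <;> (try simp only [h0]) <;> field_simp <;> ring
  · have key : ∀ m, 2 * m * d 0 - (d 1 ^ 2 + d 2 ^ 2) ≠ 0 → 
        ∃ μ η A B : ℝ, 2 * m * μ - A * d 1 - B * d 2 = -d 5 ∧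
          μ * d 1 + η * d 2 - A * d 0 = -d 3 ∧ μ * d 2 - η * d 1 - B * d 0 = -d 4 := by
      intro m hm
      refine ⟨(d 1 * d 3 + d 2 * d 4 - d 0 * d 5) / (2 * m * d 0 - (d 1 ^ 2 + d 2 ^ 2)), 0, 
        ((d 1 * d 3 + d 2 * d 4 - d 0 * d 5) / (2 * m * d 0 - (d 1 ^ 2 + d 2 ^ 2)) * d 1 + d 3) / d 0,
        ((d 1 * d 3 + d 2 * d 4 - d 0 * d 5) / (2 * m * d 0 - (d 1 ^ 2 + d 2 ^ 2)) * d 2 + d 4) / d 0,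
        ?_, ?_, ?_⟩ <;> field_simp <;> ring
    by_cases h1 : 2 * d 0 = d 1 ^ 2 + d 2 ^ 2
    · obtain ⟨μ, η, A, B, h⟩ := key 2 (by
        rw [← h1]
        intro h
        apply h0
        linarith)
      exact ⟨2, μ, η, A, B, two_ne_zero, h⟩
    · obtain ⟨μ, η, A, B, h⟩ := key 1 (by
        intro h
        apply h1
        linarith)
      exact ⟨1, μ, η, A, B, one_ne_zero, h⟩

section Rational
variable (x₀ : Pt) (d : Fin 6 → ℝ) (m μ η A B : ℝ) (α : ℝ) (q : Pt)

/-- The denominator of `ratFn`. -/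
noncomputable def ratDenom (x : Pt) : ℝ :=
  m + d 0 * (1 / 2) * ((x 2 - x₀ 2) ^ 2 + (x 3 - x₀ 3) ^ 2) + d 1 * (x 2 - x₀ 2) +
    d 2 * (x 3 - x₀ 3)

/-- A rational solution. -/
noncomputable def ratFn (x : Pt) : ℝ :=
  (1 / 2 * ((x 0 - x₀ 0) ^ 2 + (x 1 - x₀ 1) ^ 2) +
    (x 0 - x₀ 0) * (A + μ * (x 2 - x₀ 2) + η * (x 3 - x₀ 3)) +
    (x 1 - x₀ 1) * (B - η * (x 2 - x₀ 2) + μ * (x 3 - x₀ 3))) * (ratDenom x₀ d m x)⁻¹ +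
    (α + q 0 * (x 0 - x₀ 0) + q 1 * (x 1 - x₀ 1) + q 2 * (x 2 - x₀ 2) + q 3 * (x 3 - x₀ 3))

variable {x₀ d m μ η A B α q}

theorem ratDenom_contDiff : ContDiff ℝ ∞ (ratDenom x₀ d m) := by
  unfold ratDenom
  fun_prop

theorem ratDenom_pd (x : Pt) : pd 0 (ratDenom x₀ d m) x = 0 ∧ pd 1 (ratDenom x₀ d m) x = 0 ∧
    pd 2 (ratDenom x₀ d m) x = d 0 * (x 2 - x₀ 2) + d 1 ∧
    pd 3 (ratDenom x₀ d m) x = d 0 * (x 3 - x₀ 3) + d 2 := by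
  refine ⟨?_, ?_, ?_, ?_⟩ <;> unfold ratDenom <;>
    simp (disch := fun_prop) only [pd_add, pd_mul, pd_sub, pd_pow, pd_const, pd_coord] <;>
    simp <;> ring

theorem isOpen_ratDenom : IsOpen {x | ratDenom x₀ d m x ≠ 0} :=
  isOpen_ne_fun ratDenom_contDiff.continuous continuous_const

theorem ratFn_contDiffOn :
    ContDiffOn ℝ ∞ (ratFn x₀ d m μ η A B α q) {x | ratDenom x₀ d m x ≠ 0} := by
  refine ContDiffOn.add (ContDiffOn.mul ?_ (ratDenom_contDiff.contDiffOn.inv fun x hx => hx)) ?_ <;>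
    exact ContDiff.contDiffOn (by fun_prop)

theorem ratFn_pd_aux (i : Fin 4) (x : Pt) (hx : ratDenom x₀ d m x ≠ 0) :
    pd i (ratFn x₀ d m μ η A B α q) x =
      pd i (fun x => 1 / 2 * ((x 0 - x₀ 0) ^ 2 + (x 1 - x₀ 1) ^ 2) +
        (x 0 - x₀ 0) * (A + μ * (x 2 - x₀ 2) + η * (x 3 - x₀ 3)) +
        (x 1 - x₀ 1) * (B - η * (x 2 - x₀ 2) + μ * (x 3 - x₀ 3))) x * (ratDenom x₀ d m x)⁻¹ +
      (1 / 2 * ((x 0 - x₀ 0) ^ 2 + (x 1 - x₀ 1) ^ 2) +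
        (x 0 - x₀ 0) * (A + μ * (x 2 - x₀ 2) + η * (x 3 - x₀ 3)) +
        (x 1 - x₀ 1) * (B - η * (x 2 - x₀ 2) + μ * (x 3 - x₀ 3))) *
        (-pd i (ratDenom x₀ d m) x / ratDenom x₀ d m x ^ 2) + q i := by
  have dd : DifferentiableAt ℝ (ratDenom x₀ d m) x :=
    ratDenom_contDiff.differentiable (by simp) x
  have di : DifferentiableAt ℝ (fun x => (ratDenom x₀ d m x)⁻¹) x := dd.fun_inv hx
  have e : pd i (fun x => α + q 0 * (x 0 - x₀ 0) + q 1 * (x 1 - x₀ 1) + q 2 * (x 2 - x₀ 2) +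
      q 3 * (x 3 - x₀ 3)) x = q i := by
    revert i
    rw [forall_fin_four]
    refine ⟨?_, ?_, ?_, ?_⟩ <;>
      simp (disch := fun_prop) only [pd_add, pd_mul, pd_sub, pd_const, pd_coord] <;> simp
  unfold ratFn
  rw [pd_add (DifferentiableAt.fun_mul (by fun_prop) di) (by fun_prop), pd_mul (by fun_prop) di,
    pd_inv dd hx, e]

theorem ratFn_pd (x : Pt) (hx : ratDenom x₀ d m x ≠ 0) :
    pd 0 (ratFn x₀ d m μ η A B α q) x =
      ((x 0 - x₀ 0) + (A + μ * (x 2 - x₀ 2) + η * (x 3 - x₀ 3))) * (ratDenom x₀ d m x)⁻¹ + q 0 ∧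
    pd 1 (ratFn x₀ d m μ η A B α q) x =
      ((x 1 - x₀ 1) + (B - η * (x 2 - x₀ 2) + μ * (x 3 - x₀ 3))) * (ratDenom x₀ d m x)⁻¹ +
        q 1 := by
  refine ⟨?_, ?_⟩ <;> rw [ratFn_pd_aux _ _ hx] <;> simp only [ratDenom_pd] <;>
    simp (disch := fun_prop) only [pd_add, pd_mul, pd_sub, pd_pow, pd_const, pd_coord] <;>
    simp

theorem ratFn_pd_base (hm : m ≠ 0) :
    pd 2 (ratFn x₀ d m μ η A B α q) x₀ = q 2 ∧ pd 3 (ratFn x₀ d m μ η A B α q) x₀ = q 3 := by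
  have hx : ratDenom x₀ d m x₀ ≠ 0 := by simpa [ratDenom] using hm
  refine ⟨?_, ?_⟩ <;> rw [ratFn_pd_aux _ _ hx] <;>
    simp (disch := fun_prop) only [pd_add, pd_mul, pd_sub, pd_pow, pd_const, pd_coord] <;> simp

/-- The block of u in x₁, x₂ is N⁻¹ times the identity, N being the denominator, so it is
nondegenerate. Multiplied by N², the equation becomes polynomial, and all terms beyond those of
degree at most one in x₃, x₄ cancel. -/
theorem ratFn_second (x : Pt) (hx : ratDenom x₀ d m x ≠ 0) :
    pd 0 (pd 0 (ratFn x₀ d m μ η A B α q)) x = (ratDenom x₀ d m x)⁻¹ ∧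
    pd 0 (pd 1 (ratFn x₀ d m μ η A B α q)) x = 0 ∧
    pd 1 (pd 1 (ratFn x₀ d m μ η A B α q)) x = (ratDenom x₀ d m x)⁻¹ ∧
    pd 0 (pd 2 (ratFn x₀ d m μ η A B α q)) x = μ * (ratDenom x₀ d m x)⁻¹ +
      ((x 0 - x₀ 0) + (A + μ * (x 2 - x₀ 2) + η * (x 3 - x₀ 3))) *
        (-(d 0 * (x 2 - x₀ 2) + d 1) / ratDenom x₀ d m x ^ 2) ∧
    pd 1 (pd 3 (ratFn x₀ d m μ η A B α q)) x = μ * (ratDenom x₀ d m x)⁻¹ +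
      ((x 1 - x₀ 1) + (B - η * (x 2 - x₀ 2) + μ * (x 3 - x₀ 3))) *
        (-(d 0 * (x 3 - x₀ 3) + d 2) / ratDenom x₀ d m x ^ 2) := by
  have dd : DifferentiableAt ℝ (ratDenom x₀ d m) x :=
    ratDenom_contDiff.differentiable (by simp) x
  have di : DifferentiableAt ℝ (fun x => (ratDenom x₀ d m x)⁻¹) x := dd.fun_inv hx
  have e0 : ∀ i, pd i (pd 0 (ratFn x₀ d m μ η A B α q)) x =
      pd i (fun x => (x 0 - x₀ 0) + (A + μ * (x 2 - x₀ 2) + η * (x 3 - x₀ 3))) x *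
        (ratDenom x₀ d m x)⁻¹ +
      ((x 0 - x₀ 0) + (A + μ * (x 2 - x₀ 2) + η * (x 3 - x₀ 3))) *
        (-pd i (ratDenom x₀ d m) x / ratDenom x₀ d m x ^ 2) := by
    intro i
    rw [pd_congr_on isOpen_ratDenom hx fun y hy => (ratFn_pd y hy).1,
      pd_add (DifferentiableAt.fun_mul (by fun_prop) di) (differentiableAt_const _),
      pd_mul (by fun_prop) di, pd_inv dd hx, pd_const, add_zero]
  have e1 : ∀ i, pd i (pd 1 (ratFn x₀ d m μ η A B α q)) x =
      pd i (fun x => (x 1 - x₀ 1) + (B - η * (x 2 - x₀ 2) + μ * (x 3 - x₀ 3))) x *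
        (ratDenom x₀ d m x)⁻¹ +
      ((x 1 - x₀ 1) + (B - η * (x 2 - x₀ 2) + μ * (x 3 - x₀ 3))) *
        (-pd i (ratDenom x₀ d m) x / ratDenom x₀ d m x ^ 2) := by
    intro i
    rw [pd_congr_on isOpen_ratDenom hx fun y hy => (ratFn_pd y hy).2,
      pd_add (DifferentiableAt.fun_mul (by fun_prop) di) (differentiableAt_const _),
      pd_mul (by fun_prop) di, pd_inv dd hx, pd_const, add_zero]
  have sm := ratFn_contDiffOn (x₀ := x₀) (d := d) (m := m) (μ := μ) (η := η) (A := A) (B := B)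
    (α := α) (q := q)
  rw [pd_comm (j := 2) isOpen_ratDenom sm hx, pd_comm (j := 3) isOpen_ratDenom sm hx]
  simp only [e0, e1, ratDenom_pd]
  refine ⟨?_, ?_, ?_, ?_, ?_⟩ <;>
    simp (disch := fun_prop) only [pd_add, pd_mul, pd_sub, pd_const, pd_coord] <;> simp

end Rational

/-- The coefficient `quadCoeff` as a function of `x`. -/
def quadPt (c : Fin 6 → ℝ) (x : Pt) : ℝ :=
  c 0 * (x 0 * x 2 + x 1 * x 3) + c 1 * x 0 + c 2 * x 1 + c 3 * x 2 + c 4 * x 3 + c 5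

theorem quadPt_pd (c : Fin 6 → ℝ) : pd 0 (quadPt c) = (fun x => c 0 * x 2 + c 1) ∧
    pd 1 (quadPt c) = (fun x => c 0 * x 3 + c 2) ∧ pd 2 (quadPt c) = (fun x => c 0 * x 0 + c 3) ∧
    pd 3 (quadPt c) = (fun x => c 0 * x 1 + c 4) := by
  refine ⟨?_, ?_, ?_, ?_⟩ <;> ext x <;> unfold quadPt <;>
    simp (disch := fun_prop) only [pd_add, pd_mul, pd_const, pd_coord] <;> simp

theorem cond_quadPt (c : Fin 6 → ℝ) (u : Pt → ℝ) (x : Pt) :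
    condS (quadPt c) u x = 0 ∧ condPsi (quadPt c) u x = 0 ∧ condChi (quadPt c) u x =
      -2 * (c 1 * c 3 + c 2 * c 4 - c 0 * c 5) *
        (pd 0 (pd 0 u) x * pd 1 (pd 1 u) x - pd 0 (pd 1 u) x ^ 2) := by
  obtain ⟨h0, h1, h2, h3⟩ := quadPt_pd c
  simp only [condS, condPsi, condChi, h0, h1, h2, h3]
  simp (disch := fun_prop) only [pd_add, pd_mul, pd_const, pd_coord]
  refine ⟨?_, ?_, ?_⟩
  · simp
  · simp
  · simp [quadPt]
    ring

theorem cond_congr {Ω : Set Pt} {F G u : Pt → ℝ} {x : Pt} (hΩ : IsOpen Ω)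
    (h : ∀ y ∈ Ω, F y = G y) (hx : x ∈ Ω) : condS F u x = condS G u x ∧
      condPsi F u x = condPsi G u x ∧ condChi F u x = condChi G u x := by
  have e1 : ∀ i, ∀ y ∈ Ω, pd i F y = pd i G y := fun i y hy => pd_congr_on hΩ hy h
  have e2 : ∀ k i, pd k (pd i F) x = pd k (pd i G) x := fun k i => pd_congr_on hΩ hx (e1 i)
  simp only [condS, condPsi, condChi, e2, fun i => e1 i x hx, h x hx, and_self]

theorem weylMinus_iff_of_quadCoeff {D : Set J1} {f : J1 → ℝ} {Ω : Set Pt} {u : Pt → ℝ}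
    (hf : ContDiffOn ℝ ∞ f D) {c : Fin 6 → ℝ} (hc : ∀ b ∈ D, f b = quadCoeff c b)
    (hu : IsSolutionOn D f Ω u) {x : Pt} (hx : x ∈ Ω) :
    (∀ i j k l, weylMinus (metric f u) i j k l x = 0) ↔
      (c 1 * c 3 + c 2 * c 4 - c 0 * c 5) *
        (pd 0 (pd 0 u) x * pd 1 (pd 1 u) x - pd 0 (pd 1 u) x ^ 2) = 0 := by
  have e := cond_congr (u := u) (F := fun y => f (jet1 u y)) (G := quadPt c) hu.isOpen
    (fun y hy => hc _ (hu.mem y hy)) hx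
  obtain ⟨k1, k2, k3⟩ := cond_quadPt c u x
  rw [weylMinus_metric_iff hf hu hx, e.1, e.2.1, e.2.2, k1, k2, k3]
  simp

/-- If the constraint failed, the rational solution through a given jet would have u₁₁u₂₂ - u₁₂² ≠
0, against the single remaining condition. -/
theorem constraint_of_weylMinusVanishes {D : Set J1} {f : J1 → ℝ} (hD : IsOpen D)
    (hf : ContDiffOn ℝ ∞ f D) (hW : WeylMinusVanishes D f) {c : Fin 6 → ℝ} {a : J1} (ha : a ∈ D)
    (hc : ∀ b ∈ D, f b = quadCoeff c b) : Constraint c := by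
  by_contra hN
  -- Coefficients of the polynomial re-expanded at the base point; the constraint expression is
  -- invariant under translation.
  let d : Fin 6 → ℝ := ![c 0, c 1 + c 0 * a.1 2, c 2 + c 0 * a.1 3, c 3 + c 0 * a.1 0,
    c 4 + c 0 * a.1 1, quadCoeff c a]
  have hd : d 1 * d 3 + d 2 * d 4 - d 0 * d 5 ≠ 0 := by
    intro h
    apply hN
    rw [Constraint, ← h]
    simp [d, quadCoeff]
    ring
  obtain ⟨m, μ, η, A, B, hm, h1, h2, h3⟩ := exists_rational_parameters d hd
  -- The rational part has x₁- and x₂-derivatives A/m and B/m at the base point; subtracting them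
  -- from the linear part gives the prescribed first jet.
  set u := ratFn a.1 d m μ η A B a.2.1 ![a.2.2 0 - A / m, a.2.2 1 - B / m, a.2.2 2, a.2.2 3]
    with hu
  have hbase : ratDenom a.1 d m a.1 = m := by simp [ratDenom]
  have hm' : ratDenom a.1 d m a.1 ≠ 0 := by rwa [hbase]
  have sm : ContDiffOn ℝ ∞ u {x | ratDenom a.1 d m x ≠ 0} := ratFn_contDiffOn
  have hJ : jet1 u a.1 = a := by
    refine Prod.ext rfl (Prod.ext ?_ ?_)
    · simp [jet1, hu, ratFn]
    · funext i
      revert i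
      simp only [forall_fin_four, jet1, hu, ratFn_pd _ hm', ratFn_pd_base hm, hbase]
      simp [div_eq_mul_inv]
  have hΩ : IsOpen ({x | ratDenom a.1 d m x ≠ 0} ∩ jet1 u ⁻¹' D) :=
    (smooth_jet1 isOpen_ratDenom sm).continuousOn.isOpen_inter_preimage isOpen_ratDenom hD
  have hs : IsSolutionOn D f ({x | ratDenom a.1 d m x ≠ 0} ∩ jet1 u ⁻¹' D) u := by
    refine ⟨hΩ, sm.mono Set.inter_subset_left, fun x hx => hx.2, fun x hx => ?_⟩
    obtain ⟨r1, r2, r3, r4, r5⟩ := ratFn_second (μ := μ) (η := η) (A := A) (B := B) (α := a.2.1)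
      (q := ![a.2.2 0 - A / m, a.2.2 1 - B / m, a.2.2 2, a.2.2 3]) x hx.1
    simp only [SolvesAt, heavenlyOp, hess, Matrix.of_apply, hc _ hx.2]
    rw [← hu] at r1 r2 r3 r4 r5
    rw [r1, r2, r3, r4, r5]
    have hx0 : ratDenom a.1 d m x ≠ 0 := hx.1
    field_simp
    simp only [quadCoeff, jet1]
    rw [ratDenom]
    simp [d, quadCoeff] at h1 h2 h3 ⊢
    linear_combination h1 + (x 2 - a.1 2) * h2 + (x 3 - a.1 3) * h3
  have hx : a.1 ∈ {x | ratDenom a.1 d m x ≠ 0} ∩ jet1 u ⁻¹' D :=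
    ⟨hm', by rw [Set.mem_preimage, hJ]; exact ha⟩
  have key := (weylMinus_iff_of_quadCoeff hf hc hs hx).1 (hW _ _ hs _ hx)
  obtain ⟨r1, r2, r3, -, -⟩ := ratFn_second (μ := μ) (η := η) (A := A) (B := B) (α := a.2.1)
    (q := ![a.2.2 0 - A / m, a.2.2 1 - B / m, a.2.2 2, a.2.2 3]) a.1 hm'
  rw [← hu] at r1 r2 r3
  rw [r1, r2, r3, hbase] at key
  rcases mul_eq_zero.1 key with h | h
  · exact hN h
  · field_simp at h
    norm_num at h

theorem weylMinusVanishes_iff {D : Set J1} {f : J1 → ℝ} (hD : IsOpen D) (hD' : IsConnected D)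
    (hf : ContDiffOn ℝ ∞ f D) : WeylMinusVanishes D f ↔
      ∃ c : Fin 6 → ℝ, Constraint c ∧ ∀ a ∈ D, f a = quadCoeff c a := by
  constructor
  · intro hW
    obtain ⟨a, ha⟩ := hD'.nonempty
    obtain ⟨c, hc⟩ := eqOn_quadCoeff hD hD'.isPreconnected hf ha
      (fun j b hb => dd_ep_eq_zero hD hf hW hb j) (fun b hb => dd_eu_eq_zero hD hf hW hb)
      (fun b hb => dd_dd_ex hD hf hW hb)
    exact ⟨c, constraint_of_weylMinusVanishes hD hf hW ha hc, hc⟩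
  · rintro ⟨c, hC, hc⟩ Ω u hu x hx
    rw [weylMinus_iff_of_quadCoeff hf hc hu hx, show c 1 * c 3 + c 2 * c 4 - c 0 * c 5 = 0 from hC,
      zero_mul]

/-! ### The other half of the Weyl tensor -/

/-- A quartic polynomial with first jet `a` at `a.1`. -/
noncomputable def quarticFn (a : J1) (x : Pt) : ℝ :=
  a.2.1 + a.2.2 0 * (x 0 - a.1 0) + a.2.2 1 * (x 1 - a.1 1) + a.2.2 2 * (x 2 - a.1 2) +
    a.2.2 3 * (x 3 - a.1 3) + 1 / 24 * (x 1 - a.1 1) ^ 4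

theorem quarticFn_contDiff (a : J1) : ContDiff ℝ ∞ (quarticFn a) := by
  unfold quarticFn
  fun_prop

theorem quarticFn_pd (a : J1) : pd 0 (quarticFn a) = (fun _ => a.2.2 0) ∧
    pd 1 (quarticFn a) = (fun x => a.2.2 1 + 1 / 6 * (x 1 - a.1 1) ^ 3) ∧
    pd 2 (quarticFn a) = (fun _ => a.2.2 2) ∧ pd 3 (quarticFn a) = (fun _ => a.2.2 3) := by
  refine ⟨?_, ?_, ?_, ?_⟩ <;> ext x <;> unfold quarticFn <;>
    simp (disch := fun_prop) only [pd_add, pd_mul, pd_sub, pd_pow, pd_const, pd_coord] <;>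
    simp <;> ring

theorem quarticFn_jet1 (a : J1) : jet1 (quarticFn a) a.1 = a := by
  obtain ⟨h0, h1, h2, h3⟩ := quarticFn_pd a
  refine Prod.ext rfl (Prod.ext ?_ ?_)
  · simp [jet1, quarticFn]
  · funext i
    revert i
    simp [forall_fin_four, jet1, h0, h1, h2, h3]

theorem quarticFn_isSolutionOn {D : Set J1} (hD : IsOpen D) (f : J1 → ℝ) (a : J1) :
    IsSolutionOn D f (jet1 (quarticFn a) ⁻¹' D) (quarticFn a) := by
  obtain ⟨h0, h1, h2, h3⟩ := quarticFn_pd a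
  refine isSolutionOn_of_degenerate hD (quarticFn_contDiff a) ?_ ?_ <;> intro y <;>
    simp only [h0, h1, h2, h3] <;>
    simp (disch := fun_prop) only [pd_add, pd_mul, pd_sub, pd_pow, pd_const, pd_coord] <;> simp

theorem walkerJet_metric {D : Set J1} {f : J1 → ℝ} {Ω : Set Pt} {u : Pt → ℝ} {x : Pt}
    (hf : ContDiffOn ℝ ∞ f D) (hu : IsSolutionOn D f Ω u) (hx : x ∈ Ω) :
    WalkerJet (metric f u) x (f (jet1 u x) * pd 1 (pd 1 u) x) (f (jet1 u x) * pd 0 (pd 1 u) x)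
      (f (jet1 u x) * pd 0 (pd 0 u) x)
      (fun m => pd m (fun y => f (jet1 u y) * pd 1 (pd 1 u) y) x)
      (fun m => pd m (fun y => f (jet1 u y) * pd 0 (pd 1 u) y) x)
      (fun m => pd m (fun y => f (jet1 u y) * pd 0 (pd 0 u) y) x)
      (fun m n => pd m (pd n (fun y => f (jet1 u y) * pd 1 (pd 1 u) y)) x)
      (fun m n => pd m (pd n (fun y => f (jet1 u y) * pd 0 (pd 1 u) y)) x)
      (fun m n => pd m (pd n (fun y => f (jet1 u y) * pd 0 (pd 0 u) y)) x) :=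
  walkerJet (x := x) hu.isOpen hx
    ((hf.comp (smooth_jet1 hu.isOpen hu.smooth) hu.mem).mul
      (smooth_pd hu.isOpen (smooth_pd hu.isOpen hu.smooth 1) 1))
    ((hf.comp (smooth_jet1 hu.isOpen hu.smooth) hu.mem).mul
      (smooth_pd hu.isOpen (smooth_pd hu.isOpen hu.smooth 1) 0))
    ((hf.comp (smooth_jet1 hu.isOpen hu.smooth) hu.mem).mul
      (smooth_pd hu.isOpen (smooth_pd hu.isOpen hu.smooth 0) 0))

theorem weylPlus_eq_zero_of_flat {g : Pt → Mat4} {x : Pt}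
    (W : WalkerJet g x 0 0 0 (fun _ => 0) (fun _ => 0) (fun _ => 0) (fun _ _ => 0) (fun _ _ => 0)
      (fun _ _ => 0)) (i j k l : Fin 4) : weylPlus g i j k l x = 0 := by
  have h0 : walkerDir 0 0 0 = 0 := by
    ext i j
    revert i j
    simp [forall_fin_four, walkerDir]
  have hR : ∀ i j k l, riemann g i j k l x = 0 := fun i j k l => by
    rw [W.riemann]
    simp [h0, riemN, dchrN, chrN]
  have hRic : ∀ i j, ricci g i j x = 0 := fun i j => by simp [ricci, hR]
  have hL : ∀ i j k l, weylLow g i j k l x = 0 := fun i j k l => by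
    simp [weylLow, hR, schouten, hRic, scalarCurv]
  simp [weylPlus, hodgeWeyl, weyl, hL]

/-- At the base point of the quartic, u₂₂ and u₂₂₂ vanish and u₂₂₂₂ = 1, so the component -∂₂²(f
u₂₂) equals -f there. Conversely, f = 0 makes the metric constant along solutions. -/
theorem weylPlusVanishes_iff {D : Set J1} {f : J1 → ℝ} (hD : IsOpen D)
    (hf : ContDiffOn ℝ ∞ f D) : WeylPlusVanishes D f ↔ ∀ a ∈ D, f a = 0 := by
  constructor
  · intro hW a ha
    have hs := quarticFn_isSolutionOn hD f a
    have hx : a.1 ∈ jet1 (quarticFn a) ⁻¹' D := by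
      rw [Set.mem_preimage, quarticFn_jet1]
      exact ha
    have key := (walkerJet_metric hf hs hx).weylPlus_component.symm.trans
      (hW _ _ hs _ hx 0 1 1 2)
    rw [pd_pd_mul_on hs.isOpen (show ContDiffOn ℝ ∞ (fun y => f (jet1 (quarticFn a) y)) _ from
        hf.comp (smooth_jet1 hs.isOpen hs.smooth) hs.mem)
      (smooth_pd hs.isOpen (smooth_pd hs.isOpen hs.smooth 1) 1) hx] at key
    have e2 : pd 1 (pd 1 (quarticFn a)) = fun x => 1 / 2 * (x 1 - a.1 1) ^ 2 := by
      rw [(quarticFn_pd a).2.1]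
      ext x
      simp (disch := fun_prop) only [pd_add, pd_mul, pd_sub, pd_pow, pd_const, pd_coord]
      simp
      ring
    have e3 : pd 1 (pd 1 (pd 1 (quarticFn a))) = fun x => x 1 - a.1 1 := by
      rw [e2]
      ext x
      simp (disch := fun_prop) only [pd_mul, pd_sub, pd_pow, pd_const, pd_coord]
      simp
    have e4 : pd 1 (pd 1 (pd 1 (pd 1 (quarticFn a)))) a.1 = 1 := by
      rw [e3]
      simp (disch := fun_prop) only [pd_sub, pd_const, pd_coord]
      simp
    rw [e4, e3, e2] at key
    simpa [quarticFn_jet1] using key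
  · intro h Ω u hu x hx i j k l
    have W := walkerJet_metric hf hu hx
    have hF : ∀ y ∈ Ω, f (jet1 u y) = 0 := fun y hy => h _ (hu.mem y hy)
    have z0 : ∀ v : Pt → ℝ, ∀ y ∈ Ω, f (jet1 u y) * v y = 0 := fun v y hy => by
      rw [hF y hy, zero_mul]
    have z1 : ∀ (v : Pt → ℝ) m, ∀ y ∈ Ω, pd m (fun y => f (jet1 u y) * v y) y = 0 :=
      fun v m y hy => pd_eq_zero_on hu.isOpen (z0 v) hy m
    have z2 : ∀ (v : Pt → ℝ) m n, pd m (pd n (fun y => f (jet1 u y) * v y)) x = 0 :=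
      fun v m n => pd_eq_zero_on hu.isOpen (z1 v n) hx m
    have W' : WalkerJet (metric f u) x 0 0 0 (fun _ => 0) (fun _ => 0) (fun _ => 0)
        (fun _ _ => 0) (fun _ _ => 0) (fun _ _ => 0) := by
      convert W using 1
      · exact (z0 _ x hx).symm
      · exact (z0 _ x hx).symm
      · exact (z0 _ x hx).symm
      · exact funext fun m => (z1 _ m x hx).symm
      · exact funext fun m => (z1 _ m x hx).symm
      · exact funext fun m => (z1 _ m x hx).symm
      · exact funext fun m => funext fun n => (z2 _ m n).symm
      · exact funext fun m => funext fun n => (z2 _ m n).symm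
      · exact funext fun m => funext fun n => (z2 _ m n).symm
    exact weylPlus_eq_zero_of_flat W' i j k l

/-! ### Affine changes of the independent variables -/

section Affine

variable {A : Pt ≃ᵃ[ℝ] Pt} {M : Mat4} {b : Pt} {v : Pt → ℝ}

theorem hasFDerivAt_affine (hA : ∀ x, A x = M.mulVec x + b) (x : Pt) :
    HasFDerivAt A (LinearMap.toContinuousLinearMap (Matrix.toLin' M)) x := by
  have e : (A : Pt → Pt) = fun x => LinearMap.toContinuousLinearMap (Matrix.toLin' M) x + b := by
    funext x
    rw [hA]
    rfl
  rw [e]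
  exact (ContinuousLinearMap.hasFDerivAt _).add_const b

theorem pd_comp_affine (hA : ∀ x, A x = M.mulVec x + b) (i : Fin 4) (x : Pt)
    (hv : DifferentiableAt ℝ v (A x)) :
    pd i (fun y => v (A y)) x = ∑ j, M j i * pd j v (A x) := by
  have h := (hv.hasFDerivAt.comp x (hasFDerivAt_affine hA x)).fderiv
  have e : (fun y => v (A y)) = v ∘ A := rfl
  rw [pd, e, h]
  simp only [ContinuousLinearMap.comp_apply, LinearMap.coe_toContinuousLinearMap',
    Matrix.toLin'_apply, Matrix.mulVec_single_one]
  rw [← ContinuousLinearMap.coe_coe, LinearMap.pi_apply_eq_sum_univ]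
  refine Finset.sum_congr rfl fun j _ => ?_
  rw [smul_eq_mul, pd, ContinuousLinearMap.coe_coe]
  congr 3
  funext k
  simp [Pi.single_apply, eq_comm]

theorem contDiff_pd (hv : ContDiff ℝ ∞ v) (i : Fin 4) : ContDiff ℝ ∞ (pd i v) := by
  rw [← contDiffOn_univ] at hv ⊢
  exact smooth_pd isOpen_univ hv i

theorem hess_comp_affine (hA : ∀ x, A x = M.mulVec x + b) (hv : ContDiff ℝ ∞ v) (ε : ℝ) (x : Pt) :
    hess (fun y => ε * v (A y)) x = ε • (M.transpose * hess v (A x) * M) := by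
  have dv : ∀ y, DifferentiableAt ℝ v y := hv.differentiable (by simp)
  have dA : ∀ y, DifferentiableAt ℝ A y := fun y => (hasFDerivAt_affine hA y).differentiableAt
  have dp : ∀ j y, DifferentiableAt ℝ (pd j v) y := fun j =>
    (contDiff_pd hv j).differentiable (by simp)
  have e1 : ∀ j, pd j (fun y => ε * v (A y)) = fun y => ε * ∑ k, M k j * pd k v (A y) := by
    intro j
    funext y
    rw [pd_const_mul ε ((dv _).fun_comp' y (dA y)), pd_comp_affine hA j y (dv _)]
  have d1 : ∀ k, DifferentiableAt ℝ (fun y => pd k v (A y)) x := fun k =>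
    (dp k _).fun_comp' x (dA x)
  ext i j
  simp only [hess, Matrix.of_apply, e1]
  rw [pd_const_mul _ (DifferentiableAt.fun_sum fun k _ => (d1 k).const_mul _),
    pd_sum fun k _ => (d1 k).const_mul _]
  simp only [pd_const_mul _ (d1 _), pd_comp_affine hA i x (dp _ _), Matrix.smul_apply, smul_eq_mul,
    Matrix.mul_apply, Matrix.transpose_apply, Matrix.of_apply]
  congr 1
  refine Finset.sum_congr rfl fun k _ => ?_
  rw [mul_comm]

theorem contDiff_affineEquiv (A : Pt ≃ᵃ[ℝ] Pt) : ContDiff ℝ ∞ A :=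
  ContinuousAffineMap.contDiff ⟨A.toAffineMap, AffineMap.continuous_of_finiteDimensional _⟩

theorem hess_isSymm (hv : ContDiff ℝ ∞ v) (x : Pt) : (hess v x).IsSymm := by
  ext i j
  simp only [hess, Matrix.transpose_apply, Matrix.of_apply]
  exact pd_comm isOpen_univ hv.contDiffOn (Set.mem_univ x)

/-- As ε² = 1, u is recovered from its transform v as ε v ∘ A, so D²u = ε Mᵀ(D²v)M. It then suffices
that the two operators are proportional as functions of a symmetric matrix. -/
theorem affineCarries_of {f h : J1 → ℝ} {ε κ : ℝ} (hε : ε * ε = 1) (hκ : κ ≠ 0)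
    (hA : ∀ x, A x = M.mulVec x + b)
    (key : ∀ (a a' : J1) (H : Mat4), H.IsSymm → a'.1 = M.mulVec a.1 + b →
      heavenlyOp f a (ε • (M.transpose * H * M)) = κ * heavenlyOp h a' H) :
    AffineCarries A ε f h := by
  intro u hu x
  have hs : ContDiff ℝ ∞ (fun y => ε * u (A.symm y)) :=
    contDiff_const.mul (hu.comp (contDiff_affineEquiv A.symm))
  have e : u = fun y => ε * (fun y => ε * u (A.symm y)) (A y) := by
    funext y
    simp [← mul_assoc, hε]
  have hh : hess u x =
      ε • (M.transpose * hess (fun y => ε * u (A.symm y)) (A x) * M) := by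
    conv_lhs => rw [e]
    exact hess_comp_affine hA hs ε x
  unfold SolvesAt
  rw [hh, key (jet1 u x) (jet1 (fun y => ε * u (A.symm y)) (A x)) _ (hess_isSymm hs _) (hA x)]
  simp [hκ]

end Affine

theorem exists_affineEquiv (M : Mat4) (hM : M.det ≠ 0) (b : Pt) :
    ∃ A : Pt ≃ᵃ[ℝ] Pt, ∀ x, A x = M.mulVec x + b := by
  have hu : IsUnit M.det := isUnit_iff_ne_zero.2 hM
  refine ⟨(Matrix.toLin'OfInv (Matrix.nonsing_inv_mul M hu)
    (Matrix.mul_nonsing_inv M hu)).toAffineEquiv.trans (AffineEquiv.constVAdd ℝ Pt b), fun x => ?_⟩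
  have e : Matrix.toLin'OfInv (Matrix.nonsing_inv_mul M hu) (Matrix.mul_nonsing_inv M hu) x =
      M.mulVec x := by simp [Matrix.toLin'OfInv]
  simp [add_comm, e]

/-- The constraint is exactly what lets f factor as c₀((x₁ + c₃/c₀)(x₃ + c₁/c₀) + (x₂ + c₄/c₀)(x₄ +
c₂/c₀)). Scaling x₃, x₄ by s absorbs |c₀|, and ε absorbs its sign. -/
theorem exists_affineCarries_of_c0 {c : Fin 6 → ℝ} (hC : Constraint c) (h0 : c 0 ≠ 0) {ε s : ℝ}
    (hε : ε * ε = 1) (hs : c 0 = ε * s ^ 2) :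
    ∃ A : Pt ≃ᵃ[ℝ] Pt, AffineCarries A ε (quadCoeff c) (normalForm 0) := by
  have s0 : s ≠ 0 := by
    rintro rfl
    simp [h0] at hs
  have e0 : ε ≠ 0 := by
    rintro rfl
    simp at hε
  have hC' : c 5 = (c 1 * c 3 + c 2 * c 4) / c 0 := by
    rw [Constraint] at hC
    field_simp
    linarith
  obtain ⟨A, hA⟩ := exists_affineEquiv !![1, 0, 0, 0; 0, 1, 0, 0; 0, 0, s, 0; 0, 0, 0, s]
    (by simp [Matrix.det_succ_row_zero, Fin.sum_univ_succ, s0])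
    ![c 3 / c 0, c 4 / c 0, s * (c 1 / c 0), s * (c 2 / c 0)]
  refine ⟨A, affineCarries_of hε (mul_ne_zero e0 s0) hA fun a a' H hH ha => ?_⟩
  have hh : quadCoeff c a = ε * s * normalForm 0 a' := by
    simp [normalForm, ha, dotProduct, Fin.sum_univ_four, quadCoeff, hC']
    rw [show ∀ t : ℝ, ε * s * t = (ε * s ^ 2) * (t / s) from fun t => by field_simp, ← hs]
    field_simp
    ring
  simp [heavenlyOp, hh, Matrix.mul_apply, Fin.sum_univ_four]
  linear_combination (ε * s * normalForm 0 a' * (H 0 0 * H 1 1 - H 0 1 ^ 2)) * hε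

/-- The function f itself becomes X₁. With c₀ = 0 the constraint says that (c₁, c₂) and (c₃, c₄) are
orthogonal; this removes the extra multiple of H₁₁ + H₂₂ produced by the upper right block. -/
theorem exists_affineCarries_of_c12 {c : Fin 6 → ℝ} (hC : Constraint c) (h0 : c 0 = 0)
    (h1 : c 1 ^ 2 + c 2 ^ 2 ≠ 0) :
    ∃ A : Pt ≃ᵃ[ℝ] Pt, AffineCarries A 1 (quadCoeff c) (normalForm 1) := by
  have hC' : c 1 * c 3 + c 2 * c 4 = 0 := by simpa [Constraint, h0] using hC
  obtain ⟨A, hA⟩ := exists_affineEquiv !![c 1, c 2, c 3, c 4; -c 2, c 1, -c 4, c 3;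
      0, 0, (c 1 ^ 2 + c 2 ^ 2) * c 1, (c 1 ^ 2 + c 2 ^ 2) * c 2;
      0, 0, -(c 1 ^ 2 + c 2 ^ 2) * c 2, (c 1 ^ 2 + c 2 ^ 2) * c 1]
    (by
      have := pow_ne_zero 4 h1
      convert this using 1
      simp [Matrix.det_succ_row_zero, Fin.sum_univ_succ, Fin.succAbove]
      ring)
    ![c 5, 0, 0, 0]
  refine ⟨A, affineCarries_of (one_mul 1) (pow_ne_zero 2 h1) hA fun a a' H hH ha => ?_⟩
  have hh : quadCoeff c a = normalForm 1 a' := by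
    simp [normalForm, ha, dotProduct, Fin.sum_univ_four, quadCoeff, h0]
  simp [heavenlyOp, hh, Matrix.mul_apply, Fin.sum_univ_four, hH.apply 0 1]
  linear_combination (H 0 0 + H 1 1) * hC'

/-- Both diagonal blocks are multiples of the matrix with rows (c₃, c₄), (-c₄, c₃), whose
determinant is r. The weights r and r² make both terms of the equation scale by r⁴ with X₃ = r²f, so
no roots are needed. -/
theorem exists_affineCarries_of_c34 {c : Fin 6 → ℝ} (h0 : c 0 = 0) (h1 : c 1 = 0) (h2 : c 2 = 0)
    (h3 : c 3 ^ 2 + c 4 ^ 2 ≠ 0) :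
    ∃ A : Pt ≃ᵃ[ℝ] Pt, AffineCarries A 1 (quadCoeff c) (normalForm 2) := by
  obtain ⟨r, hr⟩ : ∃ r, r = c 3 ^ 2 + c 4 ^ 2 := ⟨_, rfl⟩
  rw [← hr] at h3
  obtain ⟨A, hA⟩ := exists_affineEquiv !![r * c 3, r * c 4, 0, 0; -r * c 4, r * c 3, 0, 0;
      0, 0, r ^ 2 * c 3, r ^ 2 * c 4; 0, 0, -r ^ 2 * c 4, r ^ 2 * c 3]
    (by
      have := pow_ne_zero 8 h3
      convert this using 1
      simp [Matrix.det_succ_row_zero, Fin.sum_univ_succ, Fin.succAbove]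
      rw [hr]
      ring)
    ![0, 0, r ^ 2 * c 5, 0]
  refine ⟨A, affineCarries_of (one_mul 1) (pow_ne_zero 4 h3) hA fun a a' H hH ha => ?_⟩
  have hh : r ^ 2 * quadCoeff c a = normalForm 2 a' := by
    simp [normalForm, ha, dotProduct, Fin.sum_univ_four, quadCoeff, h0, h1, h2]
    ring
  rw [heavenlyOp, heavenlyOp, ← hh]
  simp [Matrix.mul_apply, Fin.sum_univ_four, hH.apply 0 1]
  rw [hr]
  ring

theorem exists_affineCarries_of_c5 {c : Fin 6 → ℝ} (h0 : c 0 = 0) (h1 : c 1 = 0) (h2 : c 2 = 0)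
    (h3 : c 3 = 0) (h4 : c 4 = 0) (h5 : c 5 ≠ 0) :
    ∃ A : Pt ≃ᵃ[ℝ] Pt, AffineCarries A 1 (quadCoeff c) (normalForm 3) := by
  obtain ⟨A, hA⟩ := exists_affineEquiv !![1, 0, 0, 0; 0, 1, 0, 0; 0, 0, c 5, 0; 0, 0, 0, c 5]
    (by simp [Matrix.det_succ_row_zero, Fin.sum_univ_succ, h5]) 0
  refine ⟨A, affineCarries_of (one_mul 1) h5 hA fun a a' H hH ha => ?_⟩
  simp [heavenlyOp, normalForm, quadCoeff, h0, h1, h2, h3, h4, Matrix.mul_apply, Fin.sum_univ_four]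
  ring

theorem exists_affineCarries {c : Fin 6 → ℝ} (hC : Constraint c) (hc : c ≠ 0) :
    ∃ (k : Fin 4) (A : Pt ≃ᵃ[ℝ] Pt) (ε : ℝ), (ε = 1 ∨ ε = -1) ∧ (0 ≤ c 0 → ε = 1) ∧
      AffineCarries A ε (quadCoeff c) (normalForm k) := by
  rcases lt_trichotomy (c 0) 0 with h0 | h0 | h0
  · obtain ⟨A, hA⟩ := exists_affineCarries_of_c0 hC h0.ne (ε := -1) (s := √(-c 0)) (by norm_num)
      (by rw [Real.sq_sqrt (by linarith)]; ring)
    exact ⟨0, A, -1, Or.inr rfl, fun h => absurd h (not_le.2 h0), hA⟩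
  · by_cases h12 : c 1 ^ 2 + c 2 ^ 2 = 0
    · have h1 : c 1 = 0 := by nlinarith [sq_nonneg (c 1), sq_nonneg (c 2)]
      have h2 : c 2 = 0 := by nlinarith [sq_nonneg (c 1), sq_nonneg (c 2)]
      by_cases h34 : c 3 ^ 2 + c 4 ^ 2 = 0
      · have h3 : c 3 = 0 := by nlinarith [sq_nonneg (c 3), sq_nonneg (c 4)]
        have h4 : c 4 = 0 := by nlinarith [sq_nonneg (c 3), sq_nonneg (c 4)]
        have h5 : c 5 ≠ 0 := by
          intro h5
          apply hc
          funext i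
          fin_cases i <;> simp [*]
        obtain ⟨A, hA⟩ := exists_affineCarries_of_c5 h0 h1 h2 h3 h4 h5
        exact ⟨3, A, 1, Or.inl rfl, fun _ => rfl, hA⟩
      · obtain ⟨A, hA⟩ := exists_affineCarries_of_c34 h0 h1 h2 h34
        exact ⟨2, A, 1, Or.inl rfl, fun _ => rfl, hA⟩
    · obtain ⟨A, hA⟩ := exists_affineCarries_of_c12 hC h0 h12
      exact ⟨1, A, 1, Or.inl rfl, fun _ => rfl, hA⟩
  · obtain ⟨A, hA⟩ := exists_affineCarries_of_c0 hC h0.ne' (ε := 1) (s := √(c 0)) (by norm_num)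
      (by rw [Real.sq_sqrt h0.le]; ring)
    exact ⟨0, A, 1, Or.inl rfl, fun _ => rfl, hA⟩

/-! ### Uniqueness of the normal form -/

/-- A homogeneous quadratic polynomial with Hessian `H`. -/
noncomputable def hessFn (H : Mat4) (y : Pt) : ℝ := ∑ i, ∑ j, 1 / 2 * H i j * (y i * y j)

theorem hessFn_contDiff (H : Mat4) : ContDiff ℝ ∞ (hessFn H) := by
  unfold hessFn
  fun_prop

theorem hess_hessFn {H : Mat4} (hH : H.IsSymm) (y : Pt) : hess (hessFn H) y = H := by
  have e1 : ∀ k, pd k (hessFn H) = fun y => ∑ j, H k j * y j := by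
    intro k
    funext y
    unfold hessFn
    rw [pd_sum fun i _ => by fun_prop]
    simp (disch := fun_prop) only [pd_sum, pd_mul, pd_const, pd_coord]
    simp [Finset.sum_add_distrib, mul_add]
    rw [← Finset.sum_add_distrib]
    refine Finset.sum_congr rfl fun i _ => ?_
    rw [hH.apply k i]
    ring
  ext i j
  simp only [hess, Matrix.of_apply, e1]
  rw [pd_sum fun i _ => by fun_prop]
  simp (disch := fun_prop) only [pd_mul, pd_const, pd_coord]
  simp [hH.apply i j]

/-- Quadratic polynomials realise every symmetric Hessian. The coefficients depend only on x, so the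
rest of the first jet may be set to zero. -/
theorem AffineCarries.heavenlyOp_iff {A : Pt ≃ᵃ[ℝ] Pt} {ε : ℝ} {f h : J1 → ℝ} {M : Mat4} {b : Pt}
    (hA : ∀ x, A x = M.mulVec x + b) (hε : ε * ε = 1) (hf : ∀ a a' : J1, a.1 = a'.1 → f a = f a')
    (hh : ∀ a a' : J1, a.1 = a'.1 → h a = h a') (hc : AffineCarries A ε f h) (x : Pt) {H : Mat4}
    (hH : H.IsSymm) : heavenlyOp f (x, 0, 0) (ε • (M.transpose * H * M)) = 0 ↔
      heavenlyOp h (A x, 0, 0) H = 0 := by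
  have hs : ContDiff ℝ ∞ (fun y => ε * hessFn H (A y)) :=
    contDiff_const.mul ((hessFn_contDiff H).comp (contDiff_affineEquiv A))
  have key := hc _ hs x
  have e : (fun y => ε * (ε * hessFn H (A (A.symm y)))) = hessFn H := by
    funext y
    simp [← mul_assoc, hε]
  rw [e, SolvesAt, SolvesAt, hess_comp_affine hA (hessFn_contDiff H), hess_hessFn hH] at key
  simpa only [heavenlyOp, hf (jet1 _ x) (x, 0, 0) rfl, hh (jet1 _ (A x)) (A x, 0, 0) rfl] using key

theorem det_eq_zero_of_col {M : Mat4} {a b : ℝ} (hab : a ≠ 0 ∨ b ≠ 0)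
    (h : ∀ i, b * M i 0 = a * M i 1) : M.det = 0 := by
  refine Matrix.exists_mulVec_eq_zero_iff.1 ⟨![b, -a, 0, 0], fun e => ?_, ?_⟩
  · have e0 := congrFun e 0
    have e1 := congrFun e 1
    simp at e0 e1
    simp [e0, e1] at hab
  · funext i
    simp [Matrix.mulVec, dotProduct, Fin.sum_univ_four]
    linarith [h i]

theorem det_of_block {M : Mat4} (h20 : M 2 0 = 0) (h21 : M 2 1 = 0) (h30 : M 3 0 = 0)
    (h31 : M 3 1 = 0) : M.det =
      (M 0 0 * M 1 1 - M 0 1 * M 1 0) * (M 2 2 * M 3 3 - M 2 3 * M 3 2) := by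
  simp [Matrix.det_succ_row_zero, Fin.sum_univ_succ, Fin.succAbove, h20, h21, h30, h31]
  ring

/-- For H a symmetrised product of two coordinate covectors, the pulled-back minor is minus the
square of a 2 × 2 minor of the first two columns of M. If a lower row of these columns were nonzero,
all rows would be proportional to it and M would be singular. -/
theorem block_of_minor {M : Mat4} (hM : M.det ≠ 0)
    (key : ∀ H : Mat4, H.IsSymm → H 0 2 + H 1 3 = 0 → H 0 0 * H 1 1 - H 0 1 ^ 2 = 0 →
      (M.transpose * H * M) 0 0 * (M.transpose * H * M) 1 1 -
        (M.transpose * H * M) 0 1 ^ 2 = 0) :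
    M 2 0 = 0 ∧ M 2 1 = 0 ∧ M 3 0 = 0 ∧ M 3 1 = 0 := by
  have sq : ∀ s t : ℝ, s = -(t ^ 2) → s = 0 → t = 0 := fun s t h1 h2 => by
    rw [h2] at h1
    exact pow_eq_zero_iff (two_ne_zero) |>.1 (by linarith)
  have k21 : M 2 0 * M 1 1 - M 2 1 * M 1 0 = 0 := by
    refine sq _ _ ?_ (key !![0, 0, 0, 0; 0, 0, 1, 0; 0, 1, 0, 0; 0, 0, 0, 0]
      (by ext i j; revert i j; simp [forall_fin_four]) (by simp) (by simp))
    simp [Matrix.mul_apply, Fin.sum_univ_four]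
    ring
  have k23 : M 2 0 * M 3 1 - M 2 1 * M 3 0 = 0 := by
    refine sq _ _ ?_ (key !![0, 0, 0, 0; 0, 0, 0, 0; 0, 0, 0, 1; 0, 0, 1, 0]
      (by ext i j; revert i j; simp [forall_fin_four]) (by simp) (by simp))
    simp [Matrix.mul_apply, Fin.sum_univ_four]
    ring
  have k30 : M 3 0 * M 0 1 - M 3 1 * M 0 0 = 0 := by
    refine sq _ _ ?_ (key !![0, 0, 0, 1; 0, 0, 0, 0; 0, 0, 0, 0; 1, 0, 0, 0]
      (by ext i j; revert i j; simp [forall_fin_four]) (by simp) (by simp))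
    simp [Matrix.mul_apply, Fin.sum_univ_four]
    ring
  -- The products for (1,3) and (2,4) violate H₁₃ + H₂₄ = 0 separately, so only their difference is
  -- available.
  have km := key !![0, 0, 1, 0; 0, 0, 0, -1; 1, 0, 0, 0; 0, -1, 0, 0]
      (by ext i j; revert i j; simp [forall_fin_four]) (by simp) (by simp)
  simp [Matrix.mul_apply, Fin.sum_univ_four] at km
  have h2 : M 2 0 = 0 ∧ M 2 1 = 0 := by
    by_contra hne
    refine hM (det_eq_zero_of_col (a := M 2 0) (b := M 2 1) (by tauto) ?_)
    rw [forall_fin_four]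
    refine ⟨?_, by linarith, by ring, by linarith⟩
    by_cases h3 : M 3 0 = 0 ∧ M 3 1 = 0
    · rw [h3.1, h3.2] at km
      have := sq _ (M 2 0 * M 0 1 - M 2 1 * M 0 0) (by ring) km
      linarith
    · by_contra h0
      refine h3 ⟨?_, ?_⟩
      · have : M 3 0 * (M 2 1 * M 0 0 - M 2 0 * M 0 1) = 0 := by
          linear_combination (-M 0 0) * k23 - M 2 0 * k30
        exact (mul_eq_zero.1 this).resolve_right (sub_ne_zero.2 h0)
      · have : M 3 1 * (M 2 1 * M 0 0 - M 2 0 * M 0 1) = 0 := by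
          linear_combination (-M 0 1) * k23 - M 2 1 * k30
        exact (mul_eq_zero.1 this).resolve_right (sub_ne_zero.2 h0)
  refine ⟨h2.1, h2.2, ?_⟩
  by_contra hne
  refine hM (det_eq_zero_of_col (a := M 3 0) (b := M 3 1) (by tauto) ?_)
  rw [forall_fin_four]
  refine ⟨by linarith, ?_, by simp [h2], by ring⟩
  rw [h2.1, h2.2] at km
  have := sq _ (M 3 0 * M 1 1 - M 3 1 * M 1 0) (by ring) km
  linarith

/-- Apply the equivalence to H and -H: the linear part is odd and the determinant part even, so the
sum isolates f times the pulled-back minor. -/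
theorem AffineCarries.block {A : Pt ≃ᵃ[ℝ] Pt} {ε : ℝ} {f h : J1 → ℝ} {M : Mat4} {b : Pt}
    (hA : ∀ x, A x = M.mulVec x + b) (hM : M.det ≠ 0) (hε : ε * ε = 1)
    (hf : ∀ a a' : J1, a.1 = a'.1 → f a = f a')
    (hh : ∀ a a' : J1, a.1 = a'.1 → h a = h a') (hc : AffineCarries A ε f h) {x : Pt}
    (hx : f (x, 0, 0) ≠ 0) : M 2 0 = 0 ∧ M 2 1 = 0 ∧ M 3 0 = 0 ∧ M 3 1 = 0 := by
  refine block_of_minor hM fun H hH h1 h2 => ?_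
  have k1 := (hc.heavenlyOp_iff hA hε hf hh x hH).2 (by simp [heavenlyOp, h1, h2])
  have k2 := (hc.heavenlyOp_iff hA hε hf hh x (H := -H) hH.neg).2 (by
    simp only [heavenlyOp, Matrix.neg_apply]
    linear_combination -h1 + h (A x, 0, 0) * h2)
  simp only [heavenlyOp, Matrix.neg_apply, Matrix.smul_apply, smul_eq_mul, Matrix.mul_neg,
    Matrix.neg_mul] at k1 k2
  have k3 : f (x, 0, 0) * ((M.transpose * H * M) 0 0 * (M.transpose * H * M) 1 1 -
      (M.transpose * H * M) 0 1 ^ 2) = 0 := by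
    linear_combination (k1 + k2) / 2 - (f (x, 0, 0) *
      ((M.transpose * H * M) 0 0 * (M.transpose * H * M) 1 1 -
      (M.transpose * H * M) 0 1 ^ 2)) * hε
  exact (mul_eq_zero.1 k3).resolve_left hx

/-- Both equations must have the same Hessians as zeros. The factor comes out in terms of ε and M
alone, hence is independent of x. -/
theorem AffineCarries.exists_factor {A : Pt ≃ᵃ[ℝ] Pt} {ε : ℝ} {f h : J1 → ℝ} {M : Mat4} {b : Pt}
    (hA : ∀ x, A x = M.mulVec x + b) (hM : M.det ≠ 0) (hε : ε * ε = 1)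
    (hf : ∀ a a' : J1, a.1 = a'.1 → f a = f a')
    (hh : ∀ a a' : J1, a.1 = a'.1 → h a = h a') (hc : AffineCarries A ε f h) {x₀ : Pt}
    (hx₀ : f (x₀, 0, 0) ≠ 0) :
    ∃ μ : ℝ, μ ≠ 0 ∧ ∀ x, f (x, 0, 0) = μ * h (A x, 0, 0) := by
  obtain ⟨h20, h21, h30, h31⟩ := hc.block hA hM hε hf hh hx₀
  rw [det_of_block h20 h21 h30 h31] at hM
  have hd : M 0 0 * M 1 1 - M 0 1 * M 1 0 ≠ 0 := left_ne_zero_of_mul hM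
  have key : ∀ x, f (x, 0, 0) = ε * (M 0 0 * M 2 2 + M 0 1 * M 2 3) /
      (M 0 0 * M 1 1 - M 0 1 * M 1 0) ^ 2 * h (A x, 0, 0) := by
    intro x
    -- With H₁₂ = t = ±1 and H₁₃ = h, the transformed operator is h - ht² = 0. Averaging over the
    -- two signs removes the terms odd in t.
    have k : ∀ t : ℝ, t * t = 1 → _ := fun t ht => (hc.heavenlyOp_iff hA hε hf hh x
      (H := !![0, t, h (A x, 0, 0), 0; t, 0, 0, 0; h (A x, 0, 0), 0, 0, 0; 0, 0, 0, 0])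
      (by ext i j; revert i j; simp [forall_fin_four])).2 (by
        simp [heavenlyOp]
        linear_combination -h (A x, 0, 0) * ht)
    have k1 := k 1 (by ring)
    have k2 := k (-1) (by ring)
    simp [heavenlyOp, Matrix.mul_apply, Fin.sum_univ_four, h20, h21, h30, h31] at k1 k2
    field_simp
    linear_combination -(k1 + k2) / 2 -
      (f (x, 0, 0) * (M 0 0 * M 1 1 - M 0 1 * M 1 0) ^ 2) * hε
  refine ⟨_, fun h0 => hx₀ ?_, key⟩
  rw [key, h0, zero_mul]

theorem exists_quadCoeff_ne_zero {c : Fin 6 → ℝ} (hc : c ≠ 0) :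
    ∃ x : Pt, quadCoeff c (x, 0, 0) ≠ 0 := by
  by_contra! h
  have h0 := h 0
  have h1 := h (Pi.single 0 1)
  have h2 := h (Pi.single 1 1)
  have h3 := h (Pi.single 2 1)
  have h4 := h (Pi.single 3 1)
  have h5 := h (Pi.single 0 1 + Pi.single 2 1)
  simp [quadCoeff] at h0 h1 h2 h3 h4 h5
  simp [h0] at h1 h2 h3 h4 h5
  simp [h1, h3] at h5
  apply hc
  funext i
  fin_cases i <;> simp [*]

/-- Evaluating f = μ h ∘ A at the origin, the basis vectors and sums of two of them compares
coefficients. As X₃, X₄ involve only x₃, x₄ and both diagonal blocks are invertible, the vanishing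
of c₀, of (c₁, c₂) and of (c₃, c₄) distinguishes the four cases. -/
theorem coeffs_of_affineCarries {c : Fin 6 → ℝ} (hc : c ≠ 0) {k : Fin 4} {A : Pt ≃ᵃ[ℝ] Pt} {ε : ℝ}
    (hε : ε * ε = 1) (h : AffineCarries A ε (quadCoeff c) (normalForm k)) :
    (k = 0 ∧ c 0 ≠ 0) ∨ (k = 1 ∧ c 0 = 0 ∧ (c 1 ≠ 0 ∨ c 2 ≠ 0)) ∨
      (k = 2 ∧ c 0 = 0 ∧ c 1 = 0 ∧ c 2 = 0 ∧ (c 3 ≠ 0 ∨ c 4 ≠ 0)) ∨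
      (k = 3 ∧ c 0 = 0 ∧ c 1 = 0 ∧ c 2 = 0 ∧ c 3 = 0 ∧ c 4 = 0) := by
  obtain ⟨x₀, hx₀⟩ := exists_quadCoeff_ne_zero hc
  obtain ⟨M, hM⟩ : ∃ M : Mat4, M = LinearMap.toMatrix' (A.linear : Pt →ₗ[ℝ] Pt) := ⟨_, rfl⟩
  have hA : ∀ x, A x = M.mulVec x + A 0 := fun x => by
    rw [hM, LinearMap.toMatrix'_mulVec]
    simpa using A.map_vadd 0 x
  have hdet : M.det ≠ 0 := by
    rw [hM, LinearMap.det_toMatrix']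
    exact (LinearEquiv.isUnit_det' A.linear).ne_zero
  have hf : ∀ a a' : J1, a.1 = a'.1 → quadCoeff c a = quadCoeff c a' := fun a a' e => by
    simp [quadCoeff, e]
  have hh : ∀ a a' : J1, a.1 = a'.1 → normalForm k a = normalForm k a' := fun a a' e => by
    revert k
    simp [normalForm, e]
  obtain ⟨h20, h21, h30, h31⟩ := h.block hA hdet hε hf hh hx₀
  obtain ⟨μ, hμ, key⟩ := h.exists_factor hA hdet hε hf hh hx₀
  rw [det_of_block h20 h21 h30 h31] at hdet
  have hd : M 0 0 * M 1 1 - M 0 1 * M 1 0 ≠ 0 := left_ne_zero_of_mul hdet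
  have hd' : M 2 2 * M 3 3 - M 2 3 * M 3 2 ≠ 0 := right_ne_zero_of_mul hdet
  obtain ⟨b, hb⟩ : ∃ b, b = A 0 := ⟨_, rfl⟩
  have e : ∀ x i, A x i = M i 0 * x 0 + M i 1 * x 1 + M i 2 * x 2 + M i 3 * x 3 + b i :=
    fun x i => by
      rw [hA x, ← hb]
      simp [Matrix.mulVec, dotProduct, Fin.sum_univ_four]
  have k0 := key 0
  have k1 := key (Pi.single 0 1)
  have k2 := key (Pi.single 1 1)
  have k3 := key (Pi.single 2 1)
  have k4 := key (Pi.single 3 1)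
  have k5 := key (Pi.single 0 1 + Pi.single 2 1)
  have k6 := key (Pi.single 1 1 + Pi.single 3 1)
  have k7 := key (Pi.single 0 1 + Pi.single 3 1)
  have k8 := key (Pi.single 1 1 + Pi.single 2 1)
  revert k
  rw [forall_fin_four]
  refine ⟨?_, ?_, ?_, ?_⟩ <;> intro h hh key k0 k1 k2 k3 k4 k5 k6 k7 k8 <;>
    simp [quadCoeff, normalForm, e, h20, h21, h30, h31] at k0 k1 k2 k3 k4 k5 k6 k7 k8 <;>
    clear h hh key e
  · left
    refine ⟨rfl, fun h0 => hd' ?_⟩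
    have r1 : μ * (M 0 0 * M 2 2 + M 1 0 * M 3 2) = 0 := by
      linear_combination h0 - k5 + k1 + k3 - k0
    have r2 : μ * (M 0 1 * M 2 3 + M 1 1 * M 3 3) = 0 := by
      linear_combination h0 - k6 + k2 + k4 - k0
    have r3 : μ * (M 0 0 * M 2 3 + M 1 0 * M 3 3) = 0 := by
      linear_combination - k7 + k1 + k4 - k0
    have r4 : μ * (M 0 1 * M 2 2 + M 1 1 * M 3 2) = 0 := by
      linear_combination - k8 + k2 + k3 - k0
    have r5 : μ * (M 0 0 * M 1 1 - M 0 1 * M 1 0) * M 2 2 = 0 := by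
      linear_combination M 1 1 * r1 - M 1 0 * r4
    have r6 : μ * (M 0 0 * M 1 1 - M 0 1 * M 1 0) * M 2 3 = 0 := by
      linear_combination M 1 1 * r3 - M 1 0 * r2
    have r7 := (mul_eq_zero.1 r5).resolve_left (mul_ne_zero hμ hd)
    have r8 := (mul_eq_zero.1 r6).resolve_left (mul_ne_zero hμ hd)
    rw [r7, r8]
    ring
  · right; left
    have c0 : c 0 = 0 := by linear_combination k5 - k1 - k3 + k0
    refine ⟨rfl, c0, ?_⟩
    by_contra! h0
    have r1 : μ * M 0 0 = 0 := by linear_combination h0.1 - k1 + k0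
    have r2 : μ * M 0 1 = 0 := by linear_combination h0.2 - k2 + k0
    rw [(mul_eq_zero.1 r1).resolve_left hμ, (mul_eq_zero.1 r2).resolve_left hμ] at hd
    simp at hd
  · right; right; left
    have c0 : c 0 = 0 := by linear_combination k5 - k1 - k3 + k0
    have c1 : c 1 = 0 := by linear_combination k1 - k0
    have c2 : c 2 = 0 := by linear_combination k2 - k0
    refine ⟨rfl, c0, c1, c2, ?_⟩
    by_contra! h0
    have r1 : μ * M 2 2 = 0 := by linear_combination h0.1 - k3 + k0
    have r2 : μ * M 2 3 = 0 := by linear_combination h0.2 - k4 + k0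
    rw [(mul_eq_zero.1 r1).resolve_left hμ, (mul_eq_zero.1 r2).resolve_left hμ] at hd'
    simp at hd'
  · right; right; right
    exact ⟨rfl, by linear_combination k5 - k1 - k3 + k0, by linear_combination k1 - k0,
      by linear_combination k2 - k0, by linear_combination k3 - k0, by linear_combination k4 - k0⟩

theorem existsUnique_normalForm {c : Fin 6 → ℝ} (hC : Constraint c) (hc : c ≠ 0) :
    (∃! k : Fin 4, ∃ (A : Pt ≃ᵃ[ℝ] Pt) (ε : ℝ), (ε = 1 ∨ ε = -1) ∧
      AffineCarries A ε (quadCoeff c) (normalForm k)) ∧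
    (0 ≤ c 0 → ∃ (k : Fin 4) (A : Pt ≃ᵃ[ℝ] Pt),
      AffineCarries A 1 (quadCoeff c) (normalForm k)) := by
  obtain ⟨k, A, ε, hε, hε', hA⟩ := exists_affineCarries hC hc
  have sq : ∀ ε : ℝ, (ε = 1 ∨ ε = -1) → ε * ε = 1 := by
    rintro ε (rfl | rfl) <;> norm_num
  refine ⟨⟨k, ⟨A, ε, hε, hA⟩, ?_⟩, fun h0 => ⟨k, A, by rw [hε' h0] at hA; exact hA⟩⟩
  rintro k' ⟨A', ε', hε'', hA'⟩
  have h1 := coeffs_of_affineCarries hc (sq _ hε) hA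
  have h2 := coeffs_of_affineCarries hc (sq _ hε'') hA'
  rcases h1 with h1 | h1 | h1 | h1 <;> rcases h2 with h2 | h2 | h2 | h2 <;> simp_all

/-! ### Explicit contact transformations -/

section Directional
variable {h : J1 → ℝ} {v a : J1}

theorem dd_snd : dd v (fun b => b.2.1) a = v.2.1 := by
  have h : HasFDerivAt (fun b : J1 => b.2.1) ((ContinuousLinearMap.fst ℝ ℝ Pt).comp
      (ContinuousLinearMap.snd ℝ Pt (ℝ × Pt))) a :=
    ((ContinuousLinearMap.fst ℝ ℝ Pt).comp (ContinuousLinearMap.snd ℝ Pt (ℝ × Pt))).hasFDerivAt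
  rw [dd, h.fderiv]
  rfl

theorem dd_thd (i : Fin 4) : dd v (fun b => b.2.2 i) a = v.2.2 i := by
  have h : HasFDerivAt (fun b : J1 => b.2.2 i)
      ((ContinuousLinearMap.proj (R := ℝ) (φ := fun _ : Fin 4 => ℝ) i).comp
        ((ContinuousLinearMap.snd ℝ ℝ Pt).comp (ContinuousLinearMap.snd ℝ Pt (ℝ × Pt)))) a :=
    ((ContinuousLinearMap.proj (R := ℝ) (φ := fun _ : Fin 4 => ℝ) i).comp
      ((ContinuousLinearMap.snd ℝ ℝ Pt).comp
        (ContinuousLinearMap.snd ℝ Pt (ℝ × Pt)))).hasFDerivAt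
  rw [dd, h.fderiv]
  rfl

theorem dd_inv (hh : DifferentiableAt ℝ h a) (h0 : h a ≠ 0) :
    dd v (fun b => (h b)⁻¹) a = -dd v h a * (h a)⁻¹ ^ 2 := by
  have : HasFDerivAt (fun y => (h y)⁻¹) _ a := (hasDerivAt_inv h0).comp_hasFDerivAt a hh.hasFDerivAt
  rw [dd, this.fderiv]
  simp [dd]
  ring

theorem dd_pow (hh : DifferentiableAt ℝ h a) (n : ℕ) :
    dd v (fun b => (h b) ^ n) a = n * h a ^ (n - 1) * dd v h a := by
  rw [dd, fderiv_fun_pow n hh]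
  simp [dd]

theorem dd_sub {k : J1 → ℝ} (hh : DifferentiableAt ℝ h a) (hk : DifferentiableAt ℝ k a) :
    dd v (fun b => h b - k b) a = dd v h a - dd v k a := by
  simp only [dd, fderiv_fun_sub hh hk, _root_.sub_apply]

theorem dd_neg : dd v (fun b => -h b) a = -dd v h a := by
  simp [dd]

variable {F : J1 → J1}

theorem hasFDerivAt_components (hF : DifferentiableAt ℝ F a) :
    (∀ i, dd v (fun b => (F b).1 i) a = (fderiv ℝ F a v).1 i) ∧
      dd v (fun b => (F b).2.1) a = (fderiv ℝ F a v).2.1 ∧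
      ∀ i, dd v (fun b => (F b).2.2 i) a = (fderiv ℝ F a v).2.2 i := by
  have h1 : ∀ i, HasFDerivAt (fun b => (F b).1 i) _ a := fun i =>
    (hasFDerivAt_fst_apply i (F a)).comp a hF.hasFDerivAt
  have h2 : HasFDerivAt (fun b => (F b).2) _ a :=
    (ContinuousLinearMap.snd ℝ Pt (ℝ × Pt)).hasFDerivAt.comp a hF.hasFDerivAt
  have h3 : HasFDerivAt (fun b => (F b).2.1) _ a :=
    (ContinuousLinearMap.fst ℝ ℝ Pt).hasFDerivAt.comp a h2
  have h4 : HasFDerivAt (fun b => (F b).2.2) _ a :=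
    (ContinuousLinearMap.snd ℝ ℝ Pt).hasFDerivAt.comp a h2
  have h5 : ∀ i, HasFDerivAt (fun b => (F b).2.2 i) _ a := fun i =>
    (ContinuousLinearMap.proj (R := ℝ) (φ := fun _ : Fin 4 => ℝ) i).hasFDerivAt.comp a h4
  refine ⟨fun i => ?_, ?_, fun i => ?_⟩
  · rw [dd, (h1 i).fderiv]
    rfl
  · rw [dd, h3.fderiv]
    rfl
  · rw [dd, (h5 i).fderiv]
    rfl

end Directional

/-- The vector of `jetPlane a H` over `ξ`. -/
def liftVec (a : J1) (H : Mat4) (ξ : Pt) : J1 := (ξ, ∑ i, a.2.2 i * ξ i, H.mulVec ξ)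

theorem liftVec_mem (a : J1) (H : Mat4) (ξ : Pt) : liftVec a H ξ ∈ jetPlane a H := ⟨rfl, rfl⟩

theorem fderiv_liftVec {F : J1 → J1} {a : J1} {H H' : Mat4}
    (h : (jetPlane a H).map (fderiv ℝ F a : J1 →ₗ[ℝ] J1) = jetPlane (F a) H') (ξ : Pt) :
    (fderiv ℝ F a (liftVec a H ξ)).2.2 = H'.mulVec (fderiv ℝ F a (liftVec a H ξ)).1 := by
  have : fderiv ℝ F a (liftVec a H ξ) ∈ jetPlane (F a) H' := by
    rw [← h]
    exact Submodule.mem_map_of_mem (liftVec_mem a H ξ)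
  exact this.2

/-- If the lift of `ξ` is mapped to a vector over `e_k`, then the `p`-components of the image are
the entries of the `k`-th column of the transformed Hessian. -/
theorem entry_of_liftVec {F : J1 → J1} {a : J1} {H H' : Mat4} (hF : DifferentiableAt ℝ F a)
    (h : (jetPlane a H).map (fderiv ℝ F a : J1 →ₗ[ℝ] J1) = jetPlane (F a) H') {ξ : Pt} {k : Fin 4}
    (hξ : ∀ i, dd (liftVec a H ξ) (fun b => (F b).1 i) a = if i = k then 1 else 0) (i : Fin 4) :
    H' i k = dd (liftVec a H ξ) (fun b => (F b).2.2 i) a := by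
  obtain ⟨h1, -, h3⟩ := hasFDerivAt_components (v := liftVec a H ξ) hF
  have e : (fderiv ℝ F a (liftVec a H ξ)).1 = Pi.single k 1 := by
    funext i
    rw [← h1, hξ, Pi.single_apply]
  rw [h3, fderiv_liftVec h, e, Matrix.mulVec_single_one]
  rfl

theorem contDiffOn_J1 {s : Set J1} {F : J1 → J1} (h1 : ∀ i, ContDiffOn ℝ ∞ (fun a => (F a).1 i) s)
    (h2 : ContDiffOn ℝ ∞ (fun a => (F a).2.1) s)
    (h3 : ∀ i, ContDiffOn ℝ ∞ (fun a => (F a).2.2 i) s) : ContDiffOn ℝ ∞ F s :=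
  (contDiffOn_pi.2 h1).prodMk (h2.prodMk (contDiffOn_pi.2 h3))

/-! #### From `x₁x₃ + x₂x₄` to `x₁` -/

/-- The prolongation of a point transformation. -/
noncomputable def toLinearFirst (a : J1) : J1 :=
  (![a.1 0 + a.1 1 * a.1 3 * (a.1 2)⁻¹, a.1 1 * (a.1 2)⁻¹, -(a.1 2)⁻¹, a.1 3 * (a.1 2)⁻¹],
    a.1 2 * a.2.1,
    ![a.1 2 * a.2.2 0, a.1 2 * (a.1 2 * a.2.2 1 - a.1 3 * a.2.2 0),
      a.1 2 ^ 2 * (a.2.1 + a.1 2 * a.2.2 2 + a.1 1 * a.2.2 1 + a.1 3 * a.2.2 3) -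
        a.1 1 * a.1 2 * a.1 3 * a.2.2 0,
      a.1 2 * (a.1 2 * a.2.2 3 - a.1 1 * a.2.2 0)])

/-- The inverse of `toLinearFirst`. -/
noncomputable def ofLinearFirst (a : J1) : J1 :=
  (![a.1 0 + a.1 1 * a.1 3 * (a.1 2)⁻¹, -(a.1 1 * (a.1 2)⁻¹), -(a.1 2)⁻¹, -(a.1 3 * (a.1 2)⁻¹)],
    -(a.1 2 * a.2.1),
    ![-(a.1 2 * a.2.2 0), a.1 2 * (a.1 2 * a.2.2 1 - a.1 3 * a.2.2 0),
      a.1 1 * a.1 2 * a.1 3 * a.2.2 0 -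
        a.1 2 ^ 2 * (a.2.1 + a.1 2 * a.2.2 2 + a.1 1 * a.2.2 1 + a.1 3 * a.2.2 3),
      a.1 2 * (a.1 2 * a.2.2 3 - a.1 1 * a.2.2 0)])

theorem isOpen_ne : IsOpen {a : J1 | a.1 2 ≠ 0} :=
  isOpen_compl_singleton.preimage (by fun_prop : Continuous fun a : J1 => a.1 2)

theorem contDiffOn_inv_third : ContDiffOn ℝ ∞ (fun a : J1 => (a.1 2)⁻¹) {a | a.1 2 ≠ 0} :=
  ContDiffOn.inv (by fun_prop) fun _ ha => ha

theorem toLinearFirst_contDiffOn : ContDiffOn ℝ ∞ toLinearFirst {a | a.1 2 ≠ 0} := by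
  have hr := contDiffOn_inv_third
  refine contDiffOn_J1 (forall_fin_four.2 ⟨?_, ?_, ?_, ?_⟩) ?_ (forall_fin_four.2 ⟨?_, ?_, ?_, ?_⟩) <;>
    simp only [toLinearFirst, Matrix.cons_val] <;> fun_prop

theorem ofLinearFirst_contDiffOn : ContDiffOn ℝ ∞ ofLinearFirst {a | a.1 2 ≠ 0} := by
  have hr := contDiffOn_inv_third
  refine contDiffOn_J1 (forall_fin_four.2 ⟨?_, ?_, ?_, ?_⟩) ?_ (forall_fin_four.2 ⟨?_, ?_, ?_, ?_⟩) <;>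
    simp only [ofLinearFirst, Matrix.cons_val] <;> fun_prop

/-- The contact transformation `toLinearFirst`, as a diffeomorphism. -/
noncomputable def linearFirstHomeomorph : OpenPartialHomeomorph J1 J1 where
  toFun := toLinearFirst
  invFun := ofLinearFirst
  source := {a | a.1 2 ≠ 0}
  target := {a | a.1 2 ≠ 0}
  map_source' a ha := by simpa [toLinearFirst] using ha
  map_target' a ha := by simpa [ofLinearFirst] using ha
  left_inv' a (ha : a.1 2 ≠ 0) := by
    refine Prod.ext (funext (forall_fin_four.2 ⟨?_, ?_, ?_, ?_⟩))
      (Prod.ext ?_ (funext (forall_fin_four.2 ⟨?_, ?_, ?_, ?_⟩))) <;>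
    simp only [toLinearFirst, ofLinearFirst, Matrix.cons_val] <;> field_simp <;> ring
  right_inv' a (ha : a.1 2 ≠ 0) := by
    refine Prod.ext (funext (forall_fin_four.2 ⟨?_, ?_, ?_, ?_⟩))
      (Prod.ext ?_ (funext (forall_fin_four.2 ⟨?_, ?_, ?_, ?_⟩))) <;>
    simp only [toLinearFirst, ofLinearFirst, Matrix.cons_val] <;> field_simp <;> ring
  open_source := isOpen_ne
  open_target := isOpen_ne
  continuousOn_toFun := toLinearFirst_contDiffOn.continuousOn
  continuousOn_invFun := ofLinearFirst_contDiffOn.continuousOn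

/-- The contact form is multiplied by x₃. The entries of the new Hessian are obtained by
differentiating the new momenta along lifts of a frame dual to dX₁, ..., dX₄. -/
theorem linearFirst_isContactEquivalence :
    IsContactEquivalence linearFirstHomeomorph (normalForm 0) (normalForm 1) where
  smooth := toLinearFirst_contDiffOn
  smooth_symm := ofLinearFirst_contDiffOn
  contact a (ha : a.1 2 ≠ 0) := by
    refine ⟨a.1 2, ha, fun v => ?_⟩
    obtain ⟨h1, h2, -⟩ := hasFDerivAt_components (v := v) (F := toLinearFirst) (a := a)
      ((toLinearFirst_contDiffOn.differentiableOn (by simp)).differentiableAt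
        (isOpen_ne.mem_nhds ha))
    change contactForm (toLinearFirst a) (fderiv ℝ toLinearFirst a v) = _
    simp only [contactForm, Fin.sum_univ_four, ← h1, ← h2]
    simp only [toLinearFirst, Matrix.cons_val]
    simp (disch := first | assumption | fun_prop (disch := assumption)) only [dd_add, dd_sub,
      dd_neg, dd_mul, dd_inv, dd_fst, dd_snd, dd_thd]
    field_simp
    ring
  equation a (ha : a.1 2 ≠ 0) H H' hH hH' h := by
    have hF : DifferentiableAt ℝ toLinearFirst a :=
      (toLinearFirst_contDiffOn.differentiableOn (by simp)).differentiableAt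
        (isOpen_ne.mem_nhds ha)
    change (jetPlane a H).map (fderiv ℝ toLinearFirst a : J1 →ₗ[ℝ] J1) =
      jetPlane (toLinearFirst a) H' at h
    change _ ↔ heavenlyOp _ (toLinearFirst a) H' = 0
    -- Each `ξ` here is a column of the inverse Jacobian of x ↦ X.
    have e0 := entry_of_liftVec (ξ := ![1, 0, 0, 0]) (k := 0) hF h (by
      refine forall_fin_four.2 ⟨?_, ?_, ?_, ?_⟩ <;> simp only [toLinearFirst, Matrix.cons_val] <;>
      simp (disch := first | assumption | fun_prop (disch := assumption)) only [dd_add, dd_sub,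
        dd_neg, dd_mul, dd_inv, dd_fst, dd_snd, dd_thd] <;> simp [liftVec])
    have e1 := entry_of_liftVec (ξ := ![-a.1 3, a.1 2, 0, 0]) (k := 1) hF h (by
      refine forall_fin_four.2 ⟨?_, ?_, ?_, ?_⟩ <;> simp only [toLinearFirst, Matrix.cons_val] <;>
      simp (disch := first | assumption | fun_prop (disch := assumption)) only [dd_add, dd_sub,
        dd_neg, dd_mul, dd_inv, dd_fst, dd_snd, dd_thd] <;> simp [liftVec] <;> field_simp <;> ring)
    have e2 := entry_of_liftVec (ξ := ![-(a.1 1 * a.1 3), a.1 1 * a.1 2, a.1 2 ^ 2, a.1 3 * a.1 2])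
      (k := 2) hF h (by
      refine forall_fin_four.2 ⟨?_, ?_, ?_, ?_⟩ <;> simp only [toLinearFirst, Matrix.cons_val] <;>
      simp (disch := first | assumption | fun_prop (disch := assumption)) only [dd_add, dd_sub,
        dd_neg, dd_mul, dd_inv, dd_fst, dd_snd, dd_thd] <;> simp [liftVec] <;> field_simp <;> ring)
    have e3 := entry_of_liftVec (ξ := ![-a.1 1, 0, 0, a.1 2]) (k := 3) hF h (by
      refine forall_fin_four.2 ⟨?_, ?_, ?_, ?_⟩ <;> simp only [toLinearFirst, Matrix.cons_val] <;>
      simp (disch := first | assumption | fun_prop (disch := assumption)) only [dd_add, dd_sub,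
        dd_neg, dd_mul, dd_inv, dd_fst, dd_snd, dd_thd] <;> simp [liftVec] <;> field_simp <;> ring)
    rw [heavenlyOp, heavenlyOp, e2 0, e3 1, e0 0, e1 1, e1 0]
    simp only [toLinearFirst, Matrix.cons_val, normalForm]
    simp (disch := first | assumption | fun_prop (disch := assumption)) only [dd_add, dd_sub,
        dd_neg, dd_mul, dd_inv, dd_fst, dd_snd, dd_thd]
    simp [liftVec, Matrix.mulVec, dotProduct, Fin.sum_univ_four, hH.apply 0 1]
    -- The new left-hand side is x₃³ times the old one.
    have := pow_ne_zero 3 ha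
    rw [← mul_eq_zero_iff_left this]
    refine Eq.congr ?_ rfl
    field_simp
    ring

/-! #### From `x₃` to `1` -/

/-- The prolongation of a point transformation. -/
noncomputable def toConst (a : J1) : J1 :=
  (![a.1 0 * a.1 2, a.1 1 * (a.1 2)⁻¹ ^ 2, -(2⁻¹ * (a.1 2)⁻¹ ^ 2), a.1 3],
    a.1 2 * a.2.1 + 2⁻¹ * a.1 0 * a.1 1 ^ 2 * (a.1 2)⁻¹,
    ![a.2.2 0 + 2⁻¹ * a.1 1 ^ 2 * (a.1 2)⁻¹ ^ 2, a.1 2 ^ 3 * a.2.2 1 + a.1 0 * a.1 1 * a.1 2,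
      a.1 2 ^ 3 * (a.1 2 * a.2.2 2 + a.2.1 - a.1 0 * a.2.2 0 + 2 * a.1 1 * a.2.2 1) +
        a.1 0 * a.1 1 ^ 2 * a.1 2,
      a.1 2 * a.2.2 3])

/-- The inverse of `toConst` in terms of the value `s` of `x₃`. -/
noncomputable def ofConstAux (s : ℝ) (a : J1) : J1 :=
  (![a.1 0 * s⁻¹, a.1 1 * s ^ 2, s, a.1 3],
    a.2.1 * s⁻¹ - 2⁻¹ * a.1 0 * a.1 1 ^ 2 * s,
    ![a.2.2 0 - 2⁻¹ * a.1 1 ^ 2 * s ^ 2, a.2.2 1 * s⁻¹ ^ 3 - a.1 0 * a.1 1 * s⁻¹,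
      a.2.2 2 * s⁻¹ ^ 4 - (a.2.1 - a.1 0 * a.2.2 0 + 2 * a.1 1 * a.2.2 1) * s⁻¹ ^ 2 +
        a.1 0 * a.1 1 ^ 2,
      a.2.2 3 * s⁻¹])

/-- The value of `x₃` at the preimage of a point under `toConst`. -/
noncomputable def constRoot (a : J1) : ℝ := √(-(2 * a.1 2)⁻¹)

theorem constRoot_pos {a : J1} (ha : a.1 2 < 0) : 0 < constRoot a := by
  refine Real.sqrt_pos.2 ?_
  rw [neg_pos, inv_lt_zero]
  linarith

theorem constRoot_toConst {a : J1} (ha : 0 < a.1 2) : constRoot (toConst a) = a.1 2 := by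
  rw [constRoot, toConst]
  simp only [Matrix.cons_val]
  rw [show -(2 * -(2⁻¹ * (a.1 2)⁻¹ ^ 2))⁻¹ = a.1 2 ^ 2 from by field_simp, Real.sqrt_sq ha.le]

theorem constRoot_sq {a : J1} (ha : a.1 2 < 0) : -(2⁻¹ * (constRoot a)⁻¹ ^ 2) = a.1 2 := by
  have : (0 : ℝ) ≤ -(2 * a.1 2)⁻¹ := by
    rw [neg_nonneg, inv_nonpos]
    linarith
  rw [constRoot, inv_pow, Real.sq_sqrt this]
  have := ha.ne
  field_simp

theorem isOpen_pos : IsOpen {a : J1 | 0 < a.1 2} :=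
  isOpen_lt continuous_const (by fun_prop)

theorem toConst_contDiffOn : ContDiffOn ℝ ∞ toConst {a | 0 < a.1 2} := by
  have hr : ContDiffOn ℝ ∞ (fun a : J1 => (a.1 2)⁻¹) {a | 0 < a.1 2} :=
    ContDiffOn.inv (by fun_prop) fun _ ha => ne_of_gt ha
  refine contDiffOn_J1 (forall_fin_four.2 ⟨?_, ?_, ?_, ?_⟩) ?_ (forall_fin_four.2 ⟨?_, ?_, ?_, ?_⟩) <;>
    simp only [toConst, Matrix.cons_val] <;> fun_prop

theorem ofConst_contDiffOn :
    ContDiffOn ℝ ∞ (fun a => ofConstAux (constRoot a) a) {a | a.1 2 < 0} := by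
  have hs : ContDiffOn ℝ ∞ constRoot {a | a.1 2 < 0} := by
    refine ContDiffOn.sqrt (ContDiffOn.neg (ContDiffOn.inv (by fun_prop) fun a ha => ?_))
      fun a ha => ?_
    · exact mul_ne_zero two_ne_zero (ne_of_lt ha)
    · exact neg_ne_zero.2 (inv_ne_zero (mul_ne_zero two_ne_zero (ne_of_lt ha)))
  have hr : ContDiffOn ℝ ∞ (fun a => (constRoot a)⁻¹) {a | a.1 2 < 0} :=
    hs.inv fun a ha => (constRoot_pos ha).ne'
  refine contDiffOn_J1 (forall_fin_four.2 ⟨?_, ?_, ?_, ?_⟩) ?_ (forall_fin_four.2 ⟨?_, ?_, ?_, ?_⟩) <;>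
    simp only [ofConstAux, Matrix.cons_val] <;> fun_prop

/-- The contact transformation `toConst`, as a diffeomorphism. -/
noncomputable def constHomeomorph : OpenPartialHomeomorph J1 J1 where
  toFun := toConst
  invFun a := ofConstAux (constRoot a) a
  source := {a | 0 < a.1 2}
  target := {a | a.1 2 < 0}
  map_source' a (ha : 0 < a.1 2) := by
    change -(2⁻¹ * (a.1 2)⁻¹ ^ 2) < 0
    have := ha.ne'
    rw [neg_lt_zero]
    positivity
  map_target' a ha := constRoot_pos ha
  left_inv' a (ha : 0 < a.1 2) := by
    have := ha.ne'
    rw [constRoot_toConst ha]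
    refine Prod.ext (funext (forall_fin_four.2 ⟨?_, ?_, ?_, ?_⟩))
      (Prod.ext ?_ (funext (forall_fin_four.2 ⟨?_, ?_, ?_, ?_⟩))) <;>
    simp only [toConst, ofConstAux, Matrix.cons_val] <;> field_simp <;> ring
  right_inv' a (ha : a.1 2 < 0) := by
    have := (constRoot_pos ha).ne'
    have h2 := constRoot_sq ha
    refine Prod.ext (funext (forall_fin_four.2 ⟨?_, ?_, h2, ?_⟩))
      (Prod.ext ?_ (funext (forall_fin_four.2 ⟨?_, ?_, ?_, ?_⟩))) <;>
    simp only [toConst, ofConstAux, Matrix.cons_val] <;> field_simp <;> ring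
  open_source := isOpen_pos
  open_target := isOpen_lt (by fun_prop) continuous_const
  continuousOn_toFun := toConst_contDiffOn.continuousOn
  continuousOn_invFun := ofConst_contDiffOn.continuousOn

theorem const_isContactEquivalence :
    IsContactEquivalence constHomeomorph (normalForm 2) (normalForm 3) where
  smooth := toConst_contDiffOn
  smooth_symm := ofConst_contDiffOn
  contact a (ha : 0 < a.1 2) := by
    have ha0 := ha.ne'
    refine ⟨a.1 2, ha0, fun v => ?_⟩
    obtain ⟨h1, h2, -⟩ := hasFDerivAt_components (v := v) (F := toConst) (a := a)
      ((toConst_contDiffOn.differentiableOn (by simp)).differentiableAt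
        (isOpen_pos.mem_nhds ha))
    change contactForm (toConst a) (fderiv ℝ toConst a v) = _
    simp only [contactForm, Fin.sum_univ_four, ← h1, ← h2]
    simp only [toConst, Matrix.cons_val]
    simp (disch := first | assumption | fun_prop (disch := assumption)) only [dd_add,
      dd_neg, dd_mul, dd_inv, dd_pow, dd_fst, dd_snd, dd_const]
    norm_num
    field_simp
    ring
  equation a (ha : 0 < a.1 2) H H' hH hH' h := by
    have ha0 := ha.ne'
    have hF : DifferentiableAt ℝ toConst a :=
      (toConst_contDiffOn.differentiableOn (by simp)).differentiableAt
        (isOpen_pos.mem_nhds ha)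
    change (jetPlane a H).map (fderiv ℝ toConst a : J1 →ₗ[ℝ] J1) =
      jetPlane (toConst a) H' at h
    change _ ↔ heavenlyOp _ (toConst a) H' = 0
    have e0 := entry_of_liftVec (ξ := ![(a.1 2)⁻¹, 0, 0, 0]) (k := 0) hF h (by
      refine forall_fin_four.2 ⟨?_, ?_, ?_, ?_⟩ <;> simp only [toConst, Matrix.cons_val] <;>
      simp (disch := first | assumption | fun_prop (disch := assumption)) only [dd_neg, dd_mul,
        dd_inv, dd_pow, dd_fst, dd_const] <;> simp [liftVec, ha0])
    have e1 := entry_of_liftVec (ξ := ![0, a.1 2 ^ 2, 0, 0]) (k := 1) hF h (by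
      refine forall_fin_four.2 ⟨?_, ?_, ?_, ?_⟩ <;> simp only [toConst, Matrix.cons_val] <;>
      simp (disch := first | assumption | fun_prop (disch := assumption)) only [dd_neg, dd_mul,
        dd_inv, dd_pow, dd_fst, dd_const] <;> simp [liftVec, ha0])
    have e2 := entry_of_liftVec
      (ξ := ![-(a.1 0 * a.1 2 ^ 2), 2 * a.1 1 * a.1 2 ^ 2, a.1 2 ^ 3, 0]) (k := 2) hF h (by
      refine forall_fin_four.2 ⟨?_, ?_, ?_, ?_⟩ <;> simp only [toConst, Matrix.cons_val] <;>
      simp (disch := first | assumption | fun_prop (disch := assumption)) only [dd_neg, dd_mul,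
        dd_inv, dd_pow, dd_fst, dd_const] <;> simp [liftVec] <;> field_simp <;> ring)
    have e3 := entry_of_liftVec (ξ := ![0, 0, 0, 1]) (k := 3) hF h (by
      refine forall_fin_four.2 ⟨?_, ?_, ?_, ?_⟩ <;> simp only [toConst, Matrix.cons_val] <;>
      simp (disch := first | assumption | fun_prop (disch := assumption)) only [dd_neg, dd_mul,
        dd_inv, dd_pow, dd_fst, dd_const] <;> simp [liftVec])
    rw [heavenlyOp, heavenlyOp, e2 0, e3 1, e0 0, e1 1, e1 0]
    simp only [toConst, Matrix.cons_val, normalForm]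
    simp (disch := first | assumption | fun_prop (disch := assumption)) only [dd_add,
      dd_mul, dd_inv, dd_pow, dd_fst, dd_thd, dd_const]
    simp [liftVec, Matrix.mulVec, dotProduct, Fin.sum_univ_four, hH.apply 0 1]
    have := pow_ne_zero 3 ha0
    rw [← mul_eq_zero_iff_left this]
    refine Eq.congr ?_ rfl
    field_simp
    ring

/-! ### The action of contact transformations on Hessians -/

/-- The left-hand side of the equation as a function of the Hessian. -/
noncomputable def hessOp (c : ℝ) (H : Mat4) : ℝ := H 0 2 + H 1 3 + c * (H 0 0 * H 1 1 - H 0 1 ^ 2)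

/-- The polar form of the symbol of the equation. -/
noncomputable def symb (c : ℝ) (H : Mat4) (m l : Pt) : ℝ :=
  1 / 2 * (m 0 * l 2 + m 2 * l 0 + m 1 * l 3 + m 3 * l 1) +
    c * (H 0 0 * (m 1 * l 1) + H 1 1 * (m 0 * l 0) - H 0 1 * (m 0 * l 1 + m 1 * l 0))

/-- The minor of the first two components. -/
noncomputable def wedge (m l : Pt) : ℝ := m 0 * l 1 - m 1 * l 0

/-- The expansion is exact because the operator is quadratic; the determinant of a rank two
increment contributes the square of the minor. -/
theorem hessOp_add (c : ℝ) (H : Mat4) (m l : Pt) (α β γ : ℝ) :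
    hessOp c (H + (α • Matrix.vecMulVec m m + β • Matrix.vecMulVec l l +
      γ • (Matrix.vecMulVec m l + Matrix.vecMulVec l m))) =
      hessOp c H + α * symb c H m m + β * symb c H l l + 2 * γ * symb c H m l +
        c * (α * β - γ ^ 2) * wedge m l ^ 2 := by
  simp [hessOp, symb, wedge, Matrix.vecMulVec_apply]
  ring

/-- A family of null vectors of the symbol. -/
noncomputable def nullVec (c : ℝ) (H : Mat4) (a b t : ℝ) : Pt :=
  ![a, b, -(c * H 1 1 * a) - t * b, 2 * c * H 0 1 * a - c * H 0 0 * b + t * a]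

/-- The parameter t moves along a line of null covectors with fixed first two components. It changes
the polar form by -t/2 times the minor while the minor itself stays fixed, which is how the
vanishing of `Z` is forced later. -/
theorem symb_nullVec (c : ℝ) (H : Mat4) (a b t : ℝ) :
    symb c H (nullVec c H a b t) (nullVec c H a b t) = 0 := by
  simp [symb, nullVec]
  ring

theorem symb_nullVec_right (c : ℝ) (H : Mat4) (m : Pt) (a b t : ℝ) :
    symb c H m (nullVec c H a b t) =
      symb c H m (nullVec c H a b 0) + t * (1 / 2 * (m 1 * a - m 0 * b)) := by
  simp [symb, nullVec]
  ring

/-- A form `Z` that is compatible with the null directions of two symbols vanishes. -/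
theorem eq_zero_of_null_compatible {J Z H : Mat4} {h r : ℝ} (hJ : J.det ≠ 0) (hZ : Z.IsSymm)
    (hh : h ≠ 0) (hr : r ≠ 0)
    (h1 : ∀ m, J.transpose.mulVec m 0 = 0 → J.transpose.mulVec m 1 = 0 → symb h H m m = 0)
    (h2 : ∀ m l, symb h H m m = 0 → symb h H l l = 0 →
      (wedge (J.transpose.mulVec m) (J.transpose.mulVec l) = 0 ↔
        h * r * wedge m l ^ 2 = 2 * (m ⬝ᵥ Z.mulVec l) * symb h H m l)) : Z = 0 := by
  have hu : IsUnit J.transpose.det := by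
    rw [Matrix.det_transpose]
    exact isUnit_iff_ne_zero.2 hJ
  have zdot : ∀ m l : Pt, m ⬝ᵥ Z.mulVec l = Z.mulVec m 0 * l 0 + Z.mulVec m 1 * l 1 +
      Z.mulVec m 2 * l 2 + Z.mulVec m 3 * l 3 := by
    intro m l
    rw [Matrix.dotProduct_mulVec, ← Matrix.mulVec_transpose, hZ.eq, dotProduct, Fin.sum_univ_four]
  -- If the first two components of Jᵀm vanish, then m is null and the left side of the equivalence
  -- holds for every l. Its right side becomes an identity over all null l, strong enough to give m₁
  -- = m₂ = 0 and Zm = 0.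
  have step : ∀ m : Pt, J.transpose.mulVec m 0 = 0 → J.transpose.mulVec m 1 = 0 →
      m 0 = 0 ∧ m 1 = 0 ∧ Z.mulVec m = 0 := by
    intro m n0 n1
    have hm := h1 m n0 n1
    have key : ∀ l, symb h H l l = 0 → h * r * wedge m l ^ 2 =
        2 * (Z.mulVec m 0 * l 0 + Z.mulVec m 1 * l 1 + Z.mulVec m 2 * l 2 + Z.mulVec m 3 * l 3) *
          symb h H m l := by
      intro l hl
      rw [← zdot]
      refine (h2 m l hm hl).1 ?_
      simp [wedge, n0, n1]
    have hz0 : m = 0 → Z.mulVec m = 0 := fun e => by rw [e, Matrix.mulVec_zero]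
    generalize Z.mulVec m = z at key hz0 ⊢
    have m01 : m 0 = 0 ∧ m 1 = 0 := by
      by_contra hne
      have hD : m 0 ^ 2 + m 1 ^ 2 ≠ 0 := by
        intro h
        exact hne ⟨by nlinarith [sq_nonneg (m 0), sq_nonneg (m 1)],
          by nlinarith [sq_nonneg (m 0), sq_nonneg (m 1)]⟩
      have e2 := key ![0, 0, 1, 0] (by simp [symb])
      have e3 := key ![0, 0, 0, 1] (by simp [symb])
      have e4 := key ![0, 0, 1, 1] (by simp [symb])
      simp only [symb, wedge, Matrix.cons_val] at e2 e3 e4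
      have z2 : z 2 * (m 0 ^ 2 + m 1 ^ 2) = 0 := by
        linear_combination -m 0 * e2 - m 1 * (e4 - e2 - e3) + m 0 * e3
      have z3 : z 3 * (m 0 ^ 2 + m 1 ^ 2) = 0 := by
        linear_combination -m 1 * e3 - m 0 * (e4 - e2 - e3) + m 1 * e2
      replace z2 := (mul_eq_zero.1 z2).resolve_right hD
      replace z3 := (mul_eq_zero.1 z3).resolve_right hD
      -- On this null family the minor is the constant m₁² + m₂², while the right side is affine in
      -- t. Its slope must vanish, so the right side is zero, against h r ≠ 0.
      have e5 : ∀ t, h * r * (m 0 ^ 2 + m 1 ^ 2) ^ 2 = 2 * (z 1 * m 0 - z 0 * m 1) *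
          (symb h H m (nullVec h H (-m 1) (m 0) 0) - t / 2 * (m 0 ^ 2 + m 1 ^ 2)) := by
        intro t
        have := key _ (symb_nullVec h H (-m 1) (m 0) t)
        rw [symb_nullVec_right] at this
        generalize symb h H m (nullVec h H (-m 1) (m 0) 0) = σ at this ⊢
        simp [wedge, nullVec, z2, z3] at this
        linear_combination this
      have e6 : (z 1 * m 0 - z 0 * m 1) * (m 0 ^ 2 + m 1 ^ 2) = 0 := by
        linear_combination e5 1 - e5 0
      have e7 := e5 0
      rw [(mul_eq_zero.1 e6).resolve_right hD, mul_zero, zero_mul] at e7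
      exact mul_ne_zero (mul_ne_zero hh hr) (pow_ne_zero 2 hD) e7
    refine ⟨m01.1, m01.2, ?_⟩
    by_cases hD : m 2 ^ 2 + m 3 ^ 2 = 0
    · have hm0 : m = 0 := by
        funext i
        revert i
        exact forall_fin_four.2 ⟨m01.1, m01.2, by
          simp only [Pi.zero_apply]
          nlinarith [sq_nonneg (m 2), sq_nonneg (m 3)], by
          simp only [Pi.zero_apply]
          nlinarith [sq_nonneg (m 2), sq_nonneg (m 3)]⟩
      exact hz0 hm0
    -- Now the minor is zero and the polar form is (m₃a + m₄b)/2, so Zm annihilates the null vectors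
    -- with m₃a + m₄b ≠ 0. Varying t splits this into two relations.
    have e1 : ∀ a b, m 2 * a + m 3 * b ≠ 0 → z 3 * a - z 2 * b = 0 ∧
        z 0 * a + z 1 * b - z 2 * (h * H 1 1 * a) +
          z 3 * (2 * h * H 0 1 * a - h * H 0 0 * b) = 0 := by
      intro a b hab
      have e2 : ∀ t, z 0 * a + z 1 * b + z 2 * (-(h * H 1 1 * a) - t * b) +
          z 3 * (2 * h * H 0 1 * a - h * H 0 0 * b + t * a) = 0 := by
        intro t
        have := key _ (symb_nullVec h H a b t)
        simp only [symb, wedge, nullVec, Matrix.cons_val, m01.1, m01.2] at this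
        refine (mul_eq_zero.1 ?_).resolve_right hab
        linear_combination -this
      exact ⟨by linear_combination e2 1 - e2 0, by linear_combination e2 0⟩
    have e2 := e1 (m 2) (m 3) (by convert hD using 1; ring)
    have e3 := e1 (m 2 - m 3) (m 3 + m 2) (by convert hD using 1; ring)
    have z2 : z 2 * (m 2 ^ 2 + m 3 ^ 2) = 0 := by
      linear_combination -m 3 * e2.1 - m 2 * (e3.1 - e2.1)
    have z3 : z 3 * (m 2 ^ 2 + m 3 ^ 2) = 0 := by
      linear_combination m 2 * e2.1 - m 3 * (e3.1 - e2.1)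
    replace z2 := (mul_eq_zero.1 z2).resolve_right hD
    replace z3 := (mul_eq_zero.1 z3).resolve_right hD
    simp only [z2, z3] at e2 e3
    have z0 : z 0 * (m 2 ^ 2 + m 3 ^ 2) = 0 := by
      linear_combination m 2 * e2.2 - m 3 * (e3.2 - e2.2)
    have z1 : z 1 * (m 2 ^ 2 + m 3 ^ 2) = 0 := by
      linear_combination m 3 * e2.2 + m 2 * (e3.2 - e2.2)
    replace z0 := (mul_eq_zero.1 z0).resolve_right hD
    replace z1 := (mul_eq_zero.1 z1).resolve_right hD
    funext i
    revert i
    exact forall_fin_four.2 ⟨z0, z1, z2, z3⟩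
  -- The preimages under Jᵀ of the last two basis vectors lie in the plane of the last two
  -- coordinates and are independent. Hence Z kills that plane, and Jᵀ preserves it.
  have lift : ∀ n, ∃ m, J.transpose.mulVec m = n := fun n =>
    ⟨(J.transpose)⁻¹.mulVec n, by rw [Matrix.mulVec_mulVec, Matrix.mul_nonsing_inv _ hu,
      Matrix.one_mulVec]⟩
  obtain ⟨m, hm⟩ := lift ![0, 0, 1, 0]
  obtain ⟨l, hl⟩ := lift ![0, 0, 0, 1]
  obtain ⟨m0, m1, mZ⟩ := step m (by simp [hm]) (by simp [hm])
  obtain ⟨l0, l1, lZ⟩ := step l (by simp [hl]) (by simp [hl])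
  have hml : m 2 * l 3 - m 3 * l 2 ≠ 0 := by
    intro hD
    have c1 : l 2 • m - m 2 • l = 0 := by
      funext i
      revert i
      simp [forall_fin_four, m0, m1, l0, l1]
      constructor <;> linarith
    have c2 : l 3 • m - m 3 • l = 0 := by
      funext i
      revert i
      simp [forall_fin_four, m0, m1, l0, l1]
      constructor <;> linarith
    have d1 := congrArg J.transpose.mulVec c1
    have d2 := congrArg J.transpose.mulVec c2
    simp only [Matrix.mulVec_sub, Matrix.mulVec_smul, hm, hl, Matrix.mulVec_zero] at d1 d2
    have d3 := congrFun d1 3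
    have d4 := congrFun d2 3
    simp at d3 d4
    have : m = 0 := by
      funext i
      revert i
      exact forall_fin_four.2 ⟨m0, m1, d3, d4⟩
    rw [this, Matrix.mulVec_zero] at hm
    have := congrFun hm 2
    simp at this
  have hZ' : ∀ i, Z i 2 = 0 ∧ Z i 3 = 0 := by
    intro i
    have z1 := congrFun mZ i
    have z2 := congrFun lZ i
    simp [Matrix.mulVec, dotProduct, Fin.sum_univ_four, m0, m1, l0, l1] at z1 z2
    refine ⟨(mul_eq_zero.1 (?_ : Z i 2 * (m 2 * l 3 - m 3 * l 2) = 0)).resolve_right hml,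
      (mul_eq_zero.1 (?_ : Z i 3 * (m 2 * l 3 - m 3 * l 2) = 0)).resolve_right hml⟩
    · linear_combination l 3 * z1 - m 3 * z2
    · linear_combination m 2 * z2 - l 2 * z1
  have wedge_ne : ∀ m l : Pt, wedge m l ≠ 0 →
      wedge (J.transpose.mulVec m) (J.transpose.mulVec l) ≠ 0 := by
    intro m l hw hw'
    have key : ∀ α β : ℝ, J.transpose.mulVec (α • m + β • l) 0 = 0 →
        J.transpose.mulVec (α • m + β • l) 1 = 0 → α = 0 ∧ β = 0 := by
      intro α β k0 k1
      obtain ⟨s0, s1, -⟩ := step _ k0 k1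
      simp at s0 s1
      rw [wedge] at hw
      exact ⟨(mul_eq_zero.1 (by linear_combination l 1 * s0 - l 0 * s1 :
          α * (m 0 * l 1 - m 1 * l 0) = 0)).resolve_right hw,
        (mul_eq_zero.1 (by linear_combination m 0 * s1 - m 1 * s0 :
          β * (m 0 * l 1 - m 1 * l 0) = 0)).resolve_right hw⟩
    simp only [Matrix.mulVec_add, Matrix.mulVec_smul, Pi.add_apply, Pi.smul_apply,
      smul_eq_mul] at key
    generalize J.transpose.mulVec m = n at key hw'
    generalize J.transpose.mulVec l = k at key hw'
    rw [wedge] at hw'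
    obtain ⟨k0, n0⟩ := key (k 0) (-n 0) (by ring) (by linear_combination -hw')
    obtain ⟨k1, n1⟩ := key (k 1) (-n 1) (by linear_combination hw') (by ring)
    have := (key 1 0 (by linarith) (by linarith)).1
    exact one_ne_zero this
  -- Otherwise Z(m, l) is a nonzero constant along the family in t while the polar form is affine
  -- and nonconstant. Some t makes the right side of the equivalence true, so the image minor would
  -- vanish, against `wedge_ne`.
  have zero : ∀ a b a' b' : ℝ, a * b' - b * a' ≠ 0 →
      (Z 0 0 * a + Z 0 1 * b) * a' + (Z 0 1 * a + Z 1 1 * b) * b' = 0 := by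
    intro a b a' b' hw
    by_contra hne
    have e1 : ∀ t, nullVec h H a b 0 ⬝ᵥ Z.mulVec (nullVec h H a' b' t) =
        (Z 0 0 * a + Z 0 1 * b) * a' + (Z 0 1 * a + Z 1 1 * b) * b' := by
      intro t
      rw [zdot]
      simp [Matrix.mulVec, dotProduct, Fin.sum_univ_four, nullVec, hZ', hZ.apply 0 1,
        hZ.apply 0 2, hZ.apply 0 3, hZ.apply 1 2, hZ.apply 1 3, hZ.apply 2 3]
    generalize (Z 0 0 * a + Z 0 1 * b) * a' + (Z 0 1 * a + Z 1 1 * b) * b' = ζ at e1 hne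
    have w0 : ∀ t, wedge (nullVec h H a b 0) (nullVec h H a' b' t) = a * b' - b * a' := by
      simp [wedge, nullVec]
    have hne' : b * a' - a * b' ≠ 0 := fun h => hw (by linarith)
    have e2 : ∀ t, symb h H (nullVec h H a b 0) (nullVec h H a' b' t) =
        symb h H (nullVec h H a b 0) (nullVec h H a' b' 0) +
          t * (1 / 2 * (b * a' - a * b')) := fun t => by
      rw [symb_nullVec_right]
      simp [nullVec]
    generalize symb h H (nullVec h H a b 0) (nullVec h H a' b' 0) = σ at e2
    refine wedge_ne _ (nullVec h H a' b' ((h * r * (a * b' - b * a') ^ 2 / (2 * ζ) - σ) /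
      (1 / 2 * (b * a' - a * b')))) (by rw [w0]; exact hw)
      ((h2 _ _ (symb_nullVec h H a b 0) (symb_nullVec h H a' b' _)).2 ?_)
    rw [w0, e1, e2]
    field_simp
    ring
  have z01 := zero 1 0 0 1 (by norm_num)
  have z00 := zero 1 0 1 1 (by norm_num)
  have z11 := zero 0 1 1 1 (by norm_num)
  simp only [mul_one, mul_zero, add_zero, zero_add] at z01 z00 z11
  rw [z01, add_zero] at z00
  rw [z01, zero_add] at z11
  ext i j
  revert i j
  simp [forall_fin_four, (hZ' _).1, (hZ' _).2, hZ.apply 0 1, hZ.apply 0 2, hZ.apply 0 3,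
    hZ.apply 1 2, hZ.apply 1 3, z00, z01, z11]

/-- The matrices of a linear conformally symplectic map `(ξ, π) ↦ (P ξ + Q π, R ξ + S π)`. -/
structure IsSymplecticData (P Q R S : Mat4) (r : ℝ) : Prop where
  ne : r ≠ 0
  cross : P.transpose * S - R.transpose * Q = r • (1 : Mat4)
  left : P.transpose * R = R.transpose * P
  right : Q.transpose * S = S.transpose * Q

/-- The induced map on Hessians carries the equation with coefficient `f` to the equation with
coefficient `h`. -/
def TransfersOp (P Q R S : Mat4) (f h : ℝ) : Prop :=
  ∀ H H' : Mat4, H.IsSymm → H'.IsSymm → (P + Q * H).det ≠ 0 → H' * (P + Q * H) = R + S * H →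
    (hessOp f H = 0 ↔ hessOp h H' = 0)

/-! ### Conformally symplectic maps and their action on Hessians -/

section Symplectic

variable {P Q R S : Mat4} {r f h : ℝ}

/-- The defining relations give a left inverse of the 8 × 8 block matrix. It is also a right
inverse, and the blocks of that product are the dual relations. -/
theorem IsSymplecticData.dual (D : IsSymplecticData P Q R S r) :
    P * S.transpose - Q * R.transpose = r • (1 : Mat4) ∧ P * Q.transpose = Q * P.transpose := by
  have e1 : Matrix.fromBlocks S.transpose (-Q.transpose) (-R.transpose) P.transpose *
      Matrix.fromBlocks P Q R S = r • (1 : Matrix (Fin 4 ⊕ Fin 4) (Fin 4 ⊕ Fin 4) ℝ) := by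
    have h1 : S.transpose * P - Q.transpose * R = r • (1 : Mat4) := by
      have := congrArg Matrix.transpose D.cross
      simpa using this
    rw [Matrix.fromBlocks_multiply, ← Matrix.fromBlocks_one, Matrix.fromBlocks_smul]
    congr 1
    · rw [← h1]
      simp [sub_eq_add_neg]
    · simp [D.right]
    · simp [D.left]
    · rw [← D.cross]
      simp [sub_eq_add_neg, add_comm]
  have e2 : (r⁻¹ • Matrix.fromBlocks S.transpose (-Q.transpose) (-R.transpose) P.transpose) *
      Matrix.fromBlocks P Q R S = 1 := by
    rw [Matrix.smul_mul, e1, smul_smul, inv_mul_cancel₀ D.ne, one_smul]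
  have e3 : Matrix.fromBlocks P Q R S *
      Matrix.fromBlocks S.transpose (-Q.transpose) (-R.transpose) P.transpose =
      r • (1 : Matrix (Fin 4 ⊕ Fin 4) (Fin 4 ⊕ Fin 4) ℝ) := by
    have := mul_eq_one_comm.1 e2
    rw [Matrix.mul_smul] at this
    rw [← this, smul_smul, mul_inv_cancel₀ D.ne, one_smul]
  rw [Matrix.fromBlocks_multiply, ← Matrix.fromBlocks_one, Matrix.fromBlocks_smul,
    Matrix.fromBlocks_inj] at e3
  obtain ⟨h1, h2, -, -⟩ := e3
  refine ⟨by rw [← h1]; simp [sub_eq_add_neg], ?_⟩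
  simp at h2
  exact (neg_add_eq_zero.1 h2)

/-- Composition with the shear (ξ, π) ↦ (ξ, π + Hξ), symplectic as H is symmetric. It moves the base
Hessian to zero. -/
theorem IsSymplecticData.shift (D : IsSymplecticData P Q R S r) {H : Mat4} (hH : H.IsSymm) :
    IsSymplecticData (P + Q * H) Q (R + S * H) S r where
  ne := D.ne
  cross := by
    rw [← D.cross]
    simp only [Matrix.transpose_add, Matrix.transpose_mul, hH.eq, Matrix.add_mul, Matrix.mul_assoc,
      D.right]
    abel
  left := by
    have h1 : S.transpose * P - Q.transpose * R = r • (1 : Mat4) := by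
      have := congrArg Matrix.transpose D.cross
      simpa using this
    have h2 : P.transpose * S = r • (1 : Mat4) + R.transpose * Q := by rw [← D.cross]; abel
    have h3 : S.transpose * P = r • (1 : Mat4) + Q.transpose * R := by rw [← h1]; abel
    have h4 : P.transpose * (S * H) = r • H + R.transpose * Q * H := by
      rw [← Matrix.mul_assoc, h2, Matrix.add_mul, Matrix.smul_mul, Matrix.one_mul]
    have h5 : H * S.transpose * P = r • H + H * (Q.transpose * R) := by
      rw [Matrix.mul_assoc, h3, Matrix.mul_add, Matrix.mul_smul, Matrix.mul_one]
    simp only [Matrix.transpose_add, Matrix.transpose_mul, hH.eq, Matrix.add_mul, Matrix.mul_add]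
    rw [h4, h5, D.left]
    have h6 : H * Q.transpose * (S * H) = H * S.transpose * (Q * H) := by
      rw [Matrix.mul_assoc, ← Matrix.mul_assoc Q.transpose, D.right]
      simp only [Matrix.mul_assoc]
    rw [h6]
    simp only [Matrix.mul_assoc]
    abel
  right := D.right

/-- The image of a Lagrangian plane is Lagrangian. -/
theorem IsSymplecticData.image_isSymm (D : IsSymplecticData P Q R S r) (hP : P.det ≠ 0) {G : Mat4}
    (hG : G * P = R) : G.IsSymm := by
  have hu : IsUnit P.det := isUnit_iff_ne_zero.2 hP
  have hu' : IsUnit P.transpose.det := by rwa [Matrix.det_transpose]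
  have e : P.transpose * (G.transpose * P) = P.transpose * (G * P) := by
    rw [hG, D.left, ← hG, Matrix.transpose_mul, Matrix.mul_assoc]
  have e2 : P.transpose⁻¹ * (P.transpose * (G.transpose * P)) * P⁻¹ =
      P.transpose⁻¹ * (P.transpose * (G * P)) * P⁻¹ := by rw [e]
  rwa [Matrix.nonsing_inv_mul_cancel_left _ _ hu', Matrix.nonsing_inv_mul_cancel_left _ _ hu',
    Matrix.mul_nonsing_inv_cancel_right _ _ hu, Matrix.mul_nonsing_inv_cancel_right _ _ hu] at e2

/-- Thus S - GQ = r P⁻ᵀ when P is invertible, and the induced map on Hessians has derivative N ↦ r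
P⁻ᵀ N P⁻¹ at zero. -/
theorem IsSymplecticData.mul_transpose (D : IsSymplecticData P Q R S r) {G : Mat4}
    (hG : G * P = R) : (S - G * Q) * P.transpose = r • (1 : Mat4) := by
  obtain ⟨h1, h2⟩ := D.dual
  have h3 := congrArg Matrix.transpose h1
  rw [Matrix.sub_mul, Matrix.mul_assoc G, ← h2, ← Matrix.mul_assoc, hG]
  simpa using h3

/-- The transformation law for the sum of two symmetric matrices of rank one. -/
theorem TransfersOp.pencil (T : TransfersOp P Q R S f h) (D : IsSymplecticData P Q R S r)
    {H G J Z : Mat4} {a b c d t s : ℝ} {m l n k : Pt} (hH : H.IsSymm) (hJe : P + Q * H = J)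
    (hJ : J.det ≠ 0) (hG : G * J = R + S * H) (hZ : Q * J.transpose = Z)
    (hn : J.transpose.mulVec m = n) (hk : J.transpose.mulVec l = k) (ha : m ⬝ᵥ Z.mulVec m = a)
    (hb : m ⬝ᵥ Z.mulVec l = b) (hc : l ⬝ᵥ Z.mulVec l = c)
    (hd : (1 + t * a) * (1 + s * c) - t * s * b ^ 2 = d) (d0 : d ≠ 0) :
    hessOp f (H + (t • Matrix.vecMulVec n n + s • Matrix.vecMulVec k k +
        (0 : ℝ) • (Matrix.vecMulVec n k + Matrix.vecMulVec k n))) = 0 ↔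
      hessOp h (G + ((r * t * (1 + s * c) / d) • Matrix.vecMulVec m m +
        (r * s * (1 + t * a) / d) • Matrix.vecMulVec l l +
          (-(r * t * s * b) / d) • (Matrix.vecMulVec m l + Matrix.vecMulVec l m))) = 0 := by
  have D' := D.shift hH
  rw [hJe] at D'
  have hT := D'.mul_transpose hG
  have hGs := D'.image_isSymm hJ hG
  have hZs : Z.IsSymm := by
    rw [Matrix.IsSymm, ← hZ, ← D'.dual.2]
    simp [D'.dual.2]
  have hb' : l ⬝ᵥ Z.mulVec m = b := by
    rw [← hb, Matrix.dotProduct_mulVec, ← Matrix.mulVec_transpose, hZs.eq, dotProduct_comm]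
  obtain ⟨N, hN⟩ : ∃ N, N = t • Matrix.vecMulVec n n + s • Matrix.vecMulVec k k +
        (0 : ℝ) • (Matrix.vecMulVec n k + Matrix.vecMulVec k n) := ⟨_, rfl⟩
  -- Multiplication from the left by m and l reduces J + QN on the span of n and k to a 2 × 2 system
  -- with determinant d.
  have row : ∀ x : Pt, Matrix.vecMul x (J + Q * N) = J.transpose.mulVec x +
      ((t * (x ⬝ᵥ Z.mulVec m)) • n + (s * (x ⬝ᵥ Z.mulVec l)) • k) := by
    intro x
    rw [Matrix.vecMul_add, Matrix.mulVec_transpose, ← Matrix.vecMul_vecMul, hN, zero_smul, add_zero,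
      Matrix.vecMul_add, Matrix.vecMul_smul, Matrix.vecMul_smul, Matrix.vecMul_vecMulVec,
      Matrix.vecMul_vecMulVec, ← hZ, ← Matrix.mulVec_mulVec, ← Matrix.mulVec_mulVec, hn, hk,
      Matrix.dotProduct_mulVec, Matrix.dotProduct_mulVec, smul_smul, smul_smul]
  have rm := row m
  have rl := row l
  rw [hn, ha, hb] at rm
  rw [hk, hb', hc] at rl
  have tm : (S - G * Q).mulVec n = r • m := by
    rw [← hn, Matrix.mulVec_mulVec, hT, Matrix.smul_mulVec, Matrix.one_mulVec]
  have tl : (S - G * Q).mulVec k = r • l := by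
    rw [← hk, Matrix.mulVec_mulVec, hT, Matrix.smul_mulVec, Matrix.one_mulVec]
  have esymm : ∀ (x y : Pt) (α β γ : ℝ), (α • Matrix.vecMulVec x x + β • Matrix.vecMulVec y y +
      γ • (Matrix.vecMulVec x y + Matrix.vecMulVec y x)).IsSymm := by
    intro x y α β γ
    ext i j
    simp [Matrix.vecMulVec_apply]
    ring
  have eJ : P + Q * (H + N) = J + Q * N := by rw [← hJe, Matrix.mul_add, add_assoc]
  rw [← hN]
  refine T _ _ (hH.add (hN ▸ esymm _ _ _ _ _)) (hGs.add (esymm _ _ _ _ _)) ?_ ?_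
  · rw [eJ]
    intro h0
    obtain ⟨v, hv, h0⟩ := Matrix.exists_mulVec_eq_zero_iff.2 h0
    have em := congrArg (fun w => m ⬝ᵥ w) h0
    have el := congrArg (fun w => l ⬝ᵥ w) h0
    simp only [Matrix.dotProduct_mulVec, rm, rl, add_dotProduct, smul_dotProduct, dotProduct_zero,
      smul_eq_mul] at em el
    have n0 : n ⬝ᵥ v = 0 := by
      refine (mul_eq_zero.1 (?_ : d * (n ⬝ᵥ v) = 0)).resolve_left d0
      rw [← hd]
      linear_combination (1 + s * c) * em - s * b * el
    have k0 : k ⬝ᵥ v = 0 := by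
      refine (mul_eq_zero.1 (?_ : d * (k ⬝ᵥ v) = 0)).resolve_left d0
      rw [← hd]
      linear_combination (1 + t * a) * el - t * b * em
    have Nv : N.mulVec v = 0 := by
      rw [hN, zero_smul, add_zero, Matrix.add_mulVec, Matrix.smul_mulVec, Matrix.smul_mulVec,
        Matrix.vecMulVec_mulVec, Matrix.vecMulVec_mulVec, n0, k0]
      simp
    rw [Matrix.add_mulVec, ← Matrix.mulVec_mulVec, Nv, Matrix.mulVec_zero, add_zero] at h0
    exact hJ (Matrix.exists_mulVec_eq_zero_iff.1 ⟨v, hv, h0⟩)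
  -- The increment of the image Hessian is (S - GQ)N(J + QN)⁻¹; the stated coefficients come from
  -- inverting the 2 × 2 system.
  · have key : ((r * t * (1 + s * c) / d) • Matrix.vecMulVec m m +
        (r * s * (1 + t * a) / d) • Matrix.vecMulVec l l +
          (-(r * t * s * b) / d) • (Matrix.vecMulVec m l + Matrix.vecMulVec l m)) * (J + Q * N) =
        (S - G * Q) * N := by
      conv_rhs => rw [hN, zero_smul, add_zero, Matrix.mul_add, Matrix.mul_smul, Matrix.mul_smul,
        Matrix.mul_vecMulVec, Matrix.mul_vecMulVec, tm, tl]
      simp only [Matrix.add_mul, Matrix.smul_mul, Matrix.vecMulVec_mul, rm, rl]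
      ext i j
      simp [Matrix.vecMulVec_apply]
      field_simp
      rw [← hd]
      ring
    rw [eJ, Matrix.add_mul, key, Matrix.mul_add, hG, Matrix.mul_add, Matrix.sub_mul]
    simp only [Matrix.mul_assoc]
    abel

end Symplectic

/-! ### Vanishing of the block Q -/

section Symplectic

variable {P Q R S : Mat4} {r f h : ℝ}

/-- A polynomial in t of degree at most two with value 1 at t = 0 cannot vanish at 1, -1 and 2. -/
theorem exists_smul_ne (a b c : ℝ) :
    ∃ t : ℝ, t ≠ 0 ∧ (1 + t * a) * (1 + t * c) - t * t * b ^ 2 ≠ 0 := by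
  by_contra! hne
  have h1 := hne 1 (by norm_num)
  have h2 := hne (-1) (by norm_num)
  have h3 := hne 2 (by norm_num)
  linarith

/-- Along a rank one pencil through a point of the equation, each operator is a nonzero multiple of
its symbol. -/
theorem TransfersOp.null_iff (T : TransfersOp P Q R S f h) (D : IsSymplecticData P Q R S r)
    {H G J : Mat4} {m : Pt} (hH : H.IsSymm) (hf : hessOp f H = 0)
    (hJe : P + Q * H = J) (hJ : J.det ≠ 0) (hG : G * J = R + S * H) :
    symb f H (J.transpose.mulVec m) (J.transpose.mulVec m) = 0 ↔ symb h G m m = 0 := by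
  have D' := D.shift hH
  rw [hJe] at D'
  have hg : hessOp h G = 0 :=
    (T H G hH (D'.image_isSymm hJ hG) (hJe ▸ hJ) (hJe.symm ▸ hG)).1 hf
  obtain ⟨t, ht, hd⟩ := exists_smul_ne (m ⬝ᵥ (Q * J.transpose).mulVec m) 0 0
  have key := T.pencil D (t := t) (s := 0) (m := m) (l := 0) hH hJe hJ hG rfl rfl rfl rfl rfl rfl rfl
    (by simpa using hd)
  rw [hessOp_add, hessOp_add, hf, hg] at key
  have hd' : 1 + t * (m ⬝ᵥ (Q * J.transpose).mulVec m) ≠ 0 := by simpa using hd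
  simpa [ht, hd', D.ne] using key

/-- For two null covectors and t = s the linear terms disappear: the source operator is f t² times
the squared minor, and the target operator is r t²/d times the difference of the two sides. -/
theorem TransfersOp.wedge_iff (T : TransfersOp P Q R S f h) (D : IsSymplecticData P Q R S r)
    {H G J : Mat4} {m l : Pt} (hH : H.IsSymm) (hf : hessOp f H = 0) (hf0 : f ≠ 0)
    (hJe : P + Q * H = J) (hJ : J.det ≠ 0) (hG : G * J = R + S * H) (hm : symb h G m m = 0)
    (hl : symb h G l l = 0) :
    wedge (J.transpose.mulVec m) (J.transpose.mulVec l) = 0 ↔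
      h * r * wedge m l ^ 2 = 2 * (m ⬝ᵥ (Q * J.transpose).mulVec l) * symb h G m l := by
  have D' := D.shift hH
  rw [hJe] at D'
  have hg : hessOp h G = 0 :=
    (T H G hH (D'.image_isSymm hJ hG) (hJe ▸ hJ) (hJe.symm ▸ hG)).1 hf
  obtain ⟨t, ht, hd⟩ := exists_smul_ne (m ⬝ᵥ (Q * J.transpose).mulVec m)
    (m ⬝ᵥ (Q * J.transpose).mulVec l) (l ⬝ᵥ (Q * J.transpose).mulVec l)
  have key := T.pencil D (t := t) (s := t) (m := m) (l := l) hH hJe hJ hG rfl rfl rfl rfl rfl rfl rfl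
    hd
  rw [hessOp_add, hessOp_add, hf, hg, (T.null_iff D hH hf hJe hJ hG).2 hm,
    (T.null_iff D hH hf hJe hJ hG).2 hl, hm, hl] at key
  generalize m ⬝ᵥ (Q * J.transpose).mulVec m = a at *
  generalize m ⬝ᵥ (Q * J.transpose).mulVec l = b at *
  generalize l ⬝ᵥ (Q * J.transpose).mulVec l = c at *
  have e1 : ∀ u v : ℝ, 0 + t * 0 + t * 0 + 2 * 0 * u + f * (t * t - 0 ^ 2) * v ^ 2 = 0 ↔ v = 0 := by
    intro u v
    simp [ht, hf0]
  rw [e1] at key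
  rw [key]
  generalize hD : (1 + t * a) * (1 + t * c) - t * t * b ^ 2 = d at *
  have e2 : ∀ u v : ℝ, 0 + r * t * (1 + t * c) / d * 0 + r * t * (1 + t * a) / d * 0 +
      2 * (-(r * t * t * b) / d) * u + h * (r * t * (1 + t * c) / d * (r * t * (1 + t * a) / d) -
      (-(r * t * t * b) / d) ^ 2) * v ^ 2 = r * t ^ 2 / d * (h * r * v ^ 2 - 2 * b * u) := by
    intro u v
    field_simp
    rw [← hD]
    ring
  rw [e2, mul_eq_zero, sub_eq_zero]
  have : r * t ^ 2 / d ≠ 0 := div_ne_zero (mul_ne_zero D.ne (pow_ne_zero 2 ht)) hd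
  simp [this]

theorem exists_two_forms {p q : Fin 2 → ℝ} (hp : p ≠ 0) (hq : q ≠ 0) :
    ∃ v : Fin 2 → ℝ, p 0 * v 0 + p 1 * v 1 ≠ 0 ∧ q 0 * v 0 + q 1 * v 1 ≠ 0 := by
  by_contra! hne
  have zero : ∀ p : Fin 2 → ℝ, p 0 = 0 → p 1 = 0 → p = 0 := fun p h0 h1 => by
    funext i
    fin_cases i
    · exact h0
    · exact h1
  have h1 := hne ![1, 0]
  have h2 := hne ![0, 1]
  have h3 := hne ![1, 1]
  simp at h1 h2 h3
  by_cases p0 : p 0 = 0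
  · have p1 : p 1 ≠ 0 := fun h => hp (zero p p0 h)
    have q1 := h2 p1
    have q0 := h3 (by simpa [p0] using p1)
    exact hq (zero q (by linarith) q1)
  · have q0 := h1 p0
    have q1 : q 1 ≠ 0 := fun h => hq (zero q q0 h)
    have p1 : p 1 = 0 := by
      by_contra h
      exact q1 (h2 h)
    exact q1 (by linarith [h3 (by simpa [p1] using p0)])

/-- The null cone, a split quadric, is parametrised bilinearly by two vectors u, v of the plane, so
each pairing is a nonzero bilinear form. First v is chosen so that both forms stay nonzero in u,
then u. -/
theorem exists_null_dotProduct_ne (c : ℝ) (H : Mat4) {ξ η : Pt} (hξ : ξ ≠ 0) (hη : η ≠ 0) :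
    ∃ n, symb c H n n = 0 ∧ n ⬝ᵥ ξ ≠ 0 ∧ n ⬝ᵥ η ≠ 0 := by
  have row : ∀ ξ : Pt, ξ ≠ 0 → ∃ i j : ℝ,
      (![i * (ξ 0 - c * H 1 1 * ξ 2 + 2 * c * H 0 1 * ξ 3) + j * (-ξ 3),
        i * (ξ 1 - c * H 0 0 * ξ 3) + j * ξ 2] : Fin 2 → ℝ) ≠ 0 := by
    intro ξ hξ
    by_contra! hne
    have h1 := hne 1 0
    have h2 := hne 0 1
    simp at h1 h2
    obtain ⟨h3, h4⟩ := h2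
    simp [h3, h4] at h1
    exact hξ (funext (forall_fin_four.2 ⟨h1.1, h1.2, h4, h3⟩))
  obtain ⟨i, j, hij⟩ := row ξ hξ
  obtain ⟨i', j', hij'⟩ := row η hη
  obtain ⟨v, hv, hv'⟩ := exists_two_forms hij hij'
  simp only [Matrix.cons_val] at hv hv'
  have col : ∀ (ξ : Pt) (i j : ℝ), (i * (ξ 0 - c * H 1 1 * ξ 2 + 2 * c * H 0 1 * ξ 3) + j * (-ξ 3)) *
      v 0 + (i * (ξ 1 - c * H 0 0 * ξ 3) + j * ξ 2) * v 1 ≠ 0 →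
      (![(ξ 0 - c * H 1 1 * ξ 2 + 2 * c * H 0 1 * ξ 3) * v 0 + (ξ 1 - c * H 0 0 * ξ 3) * v 1,
        -ξ 3 * v 0 + ξ 2 * v 1] : Fin 2 → ℝ) ≠ 0 := by
    intro ξ i j h1 h2
    have h3 := congrFun h2 0
    have h4 := congrFun h2 1
    simp at h3 h4
    apply h1
    linear_combination i * h3 + j * h4
  obtain ⟨u, hu, hu'⟩ := exists_two_forms (col ξ i j hv) (col η i' j' hv')
  simp only [Matrix.cons_val] at hu hu'
  refine ⟨![u 0 * v 0, u 0 * v 1, -(c * H 1 1 * (u 0 * v 0)) + u 1 * v 1,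
    2 * c * H 0 1 * (u 0 * v 0) - c * H 0 0 * (u 0 * v 1) - u 1 * v 0], ?_, ?_, ?_⟩
  · simp [symb]
    ring
  · convert hu using 1
    simp [dotProduct, Fin.sum_univ_four]
    ring
  · convert hu' using 1
    simp [dotProduct, Fin.sum_univ_four]
    ring

/-- Induction on the dimension of the kernel of P + QH. Adding n ⊗ n with n null stays on the
equation; if n is not orthogonal to a kernel vector ξ nor to wQ, with w a left kernel vector, the
kernel becomes strictly smaller. -/
theorem IsSymplecticData.exists_transversal (D : IsSymplecticData P Q R S r) (c : ℝ) :
    ∃ H : Mat4, H.IsSymm ∧ hessOp c H = 0 ∧ (P + Q * H).det ≠ 0 := by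
  have key : ∀ (k : ℕ) (H : Mat4), H.IsSymm → hessOp c H = 0 →
      Module.finrank ℝ (LinearMap.ker (P + Q * H).mulVecLin) ≤ k →
      ∃ H : Mat4, H.IsSymm ∧ hessOp c H = 0 ∧ (P + Q * H).det ≠ 0 := by
    intro k
    induction k with
    | zero =>
      intro H hH hc hk
      refine ⟨H, hH, hc, fun h0 => ?_⟩
      obtain ⟨ξ, hξ, h0⟩ := Matrix.exists_mulVec_eq_zero_iff.2 h0
      have hb := Submodule.finrank_eq_zero.1 (Nat.le_zero.1 hk)
      have : ξ ∈ LinearMap.ker (P + Q * H).mulVecLin := h0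
      rw [hb] at this
      exact hξ this
    | succ k ih =>
      intro H hH hc hk
      by_cases h0 : (P + Q * H).det = 0
      · obtain ⟨ξ, hξ, hJξ⟩ := Matrix.exists_mulVec_eq_zero_iff.2 h0
        obtain ⟨w, hw, hwJ⟩ := Matrix.exists_vecMul_eq_zero_iff.2 h0
        -- If wQ = 0, then wP = 0 too, and PSᵀ - QRᵀ = r would give w = 0.
        have hη : Matrix.vecMul w Q ≠ 0 := by
          intro hη
          rw [Matrix.vecMul_add, ← Matrix.vecMul_vecMul, hη, Matrix.zero_vecMul, add_zero] at hwJ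
          have e := congrArg (fun M => Matrix.vecMul w M) D.dual.1
          simp only [Matrix.vecMul_sub, ← Matrix.vecMul_vecMul, hη, hwJ, Matrix.zero_vecMul,
            Matrix.vecMul_smul, Matrix.vecMul_one, sub_zero] at e
          exact hw ((smul_eq_zero.1 e.symm).resolve_left D.ne)
        obtain ⟨n, hn, hnξ, hnη⟩ := exists_null_dotProduct_ne c H hξ hη
        have hz : ∀ ζ, (P + Q * (H + Matrix.vecMulVec n n)).mulVec ζ =
            (P + Q * H).mulVec ζ + (n ⬝ᵥ ζ) • Q.mulVec n := by
          intro ζ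
          rw [Matrix.mul_add, ← add_assoc, Matrix.add_mulVec, ← Matrix.mulVec_mulVec,
            Matrix.vecMulVec_mulVec]
          simp [Matrix.mulVec_smul]
        have hker : ∀ ζ, (P + Q * (H + Matrix.vecMulVec n n)).mulVec ζ = 0 → n ⬝ᵥ ζ = 0 := by
          intro ζ h
          rw [hz] at h
          have e := congrArg (fun v => w ⬝ᵥ v) h
          simp only [dotProduct_add, Matrix.dotProduct_mulVec, hwJ, zero_dotProduct, zero_add,
            dotProduct_smul, dotProduct_zero, smul_eq_mul] at e
          rw [dotProduct_comm] at hnη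
          exact (mul_eq_zero.1 e).resolve_right hnη
        refine ih (H + Matrix.vecMulVec n n) (hH.add (Matrix.transpose_vecMulVec n n)) ?_ ?_
        · have := hessOp_add c H n 0 1 0 0
          rw [hc, hn] at this
          simpa using this
        · refine Nat.le_of_lt_succ (lt_of_lt_of_le (Submodule.finrank_lt_finrank_of_lt ?_) hk)
          refine lt_of_le_of_ne (fun ζ hζ => ?_) fun he => ?_
          · have h1 := hker ζ hζ
            have h2 : (P + Q * (H + Matrix.vecMulVec n n)).mulVec ζ = 0 := hζ
            rw [hz, h1, zero_smul, add_zero] at h2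
            exact h2
          · have : ξ ∈ LinearMap.ker (P + Q * H).mulVecLin := hJξ
            rw [← he] at this
            exact hnξ (hker ξ this)
      · exact ⟨H, hH, hc, h0⟩
  exact key _ 0 (Matrix.transpose_zero) (by simp [hessOp]) le_rfl

/-- A contact transformation between two of the equations is a point transformation. -/
theorem TransfersOp.eq_zero (T : TransfersOp P Q R S f h) (D : IsSymplecticData P Q R S r)
    (hf : f ≠ 0) (hh : h ≠ 0) : Q = 0 := by
  obtain ⟨H, hH, hfH, hJ⟩ := D.exists_transversal f
  obtain ⟨J, hJe⟩ : ∃ J, P + Q * H = J := ⟨_, rfl⟩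
  rw [hJe] at hJ
  have hu : IsUnit J.det := isUnit_iff_ne_zero.2 hJ
  obtain ⟨G, hG⟩ : ∃ G, G * J = R + S * H :=
    ⟨(R + S * H) * J⁻¹, Matrix.nonsing_inv_mul_cancel_right _ _ hu⟩
  have D' := D.shift hH
  rw [hJe] at D'
  have hZ : (Q * J.transpose).IsSymm := by
    rw [Matrix.IsSymm, ← D'.dual.2]
    simp [D'.dual.2]
  have h0 := eq_zero_of_null_compatible hJ hZ hh D.ne
    (fun m h0 h1 => (T.null_iff D hH hfH hJe hJ hG).1 (by simp [symb, h0, h1]))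
    (fun m l hm hl => T.wedge_iff D hH hfH hf hJe hJ hG hm hl)
  have hu' : IsUnit J.transpose.det := by rwa [Matrix.det_transpose]
  rw [← Matrix.mul_nonsing_inv_cancel_right J.transpose Q hu', h0, Matrix.zero_mul]

end Symplectic

/-! ### Point transformations acting on Hessians -/

section Point

variable {P R S G : Mat4} {r f h : ℝ}

/-- With Q = 0 the action on Hessians is affine, and the argument on the left is the inverse image
of H. -/
theorem TransfersOp.point_iff (T : TransfersOp P 0 R S f h) (D : IsSymplecticData P 0 R S r)
    (hP : P.det ≠ 0) {H : Mat4} (hH : H.IsSymm) :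
    hessOp f (r⁻¹ • (P.transpose * H * P - P.transpose * R)) = 0 ↔ hessOp h H = 0 := by
  have hu : IsUnit P.transpose.det := by
    rw [Matrix.det_transpose]
    exact isUnit_iff_ne_zero.2 hP
  have hS : P.transpose * S = r • (1 : Mat4) := by simpa using D.cross
  refine T _ _ ?_ hH (by simpa using hP) ?_
  · rw [Matrix.IsSymm, Matrix.transpose_smul, Matrix.transpose_sub, Matrix.transpose_mul,
      Matrix.transpose_mul, Matrix.transpose_mul, Matrix.transpose_transpose, hH.eq, D.left,
      Matrix.mul_assoc]
  · rw [Matrix.zero_mul, add_zero]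
    have e : P.transpose * (H * P) = P.transpose *
        (R + S * (r⁻¹ • (P.transpose * H * P - P.transpose * R))) := by
      rw [Matrix.mul_add, ← Matrix.mul_assoc, ← Matrix.mul_assoc, hS, Matrix.smul_mul,
        Matrix.one_mul, smul_smul, mul_inv_cancel₀ D.ne, one_smul]
      abel
    rw [← Matrix.nonsing_inv_mul_cancel_left P.transpose (H * P) hu, e,
      Matrix.nonsing_inv_mul_cancel_left _ _ hu]

/-- Along the line tH the inhomogeneous term G cancels in the second difference at t = -1, 0, 1,
leaving the hypothesis of `block_of_minor`. -/
theorem block_of_point_iff (hr : r ≠ 0) (hf : f ≠ 0) (hP : P.det ≠ 0)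
    (key : ∀ H : Mat4, H.IsSymm →
      (hessOp f (r⁻¹ • (P.transpose * H * P - G)) = 0 ↔ hessOp h H = 0)) :
    P 2 0 = 0 ∧ P 2 1 = 0 ∧ P 3 0 = 0 ∧ P 3 1 = 0 := by
  refine block_of_minor hP fun H hH h1 h2 => ?_
  have e : ∀ t : ℝ, hessOp f (r⁻¹ • (t • (P.transpose * H * P) - G)) = 0 := by
    intro t
    have := (key (t • H) (hH.smul t)).2 (by
      simp only [hessOp, Matrix.smul_apply, smul_eq_mul]
      linear_combination t * h1 + h * t ^ 2 * h2)
    simpa using this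
  have e0 := e 0
  have e1 := e 1
  have e2 := e (-1)
  generalize P.transpose * H * P = K at *
  simp only [hessOp, Matrix.smul_apply, Matrix.sub_apply, smul_eq_mul] at e0 e1 e2
  refine (mul_eq_zero.1 (?_ : (f * r⁻¹ ^ 2) * (K 0 0 * K 1 1 - K 0 1 ^ 2) = 0)).resolve_left
    (mul_ne_zero hf (pow_ne_zero 2 (inv_ne_zero hr)))
  linear_combination (e1 + e2) / 2 - e0

/-- Single entries of H give `w1`, `w2`, `w3`: the product of the upper left block with the
transposed lower right block is scalar, so the former is σ times the cofactor matrix of the latter.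
The pair with entries ±1 and h compares the two coefficients. -/
theorem coeffs_of_point_iff (hr : r ≠ 0) (hP : P.det ≠ 0) (hG : G.IsSymm)
    (b20 : P 2 0 = 0) (b21 : P 2 1 = 0) (b30 : P 3 0 = 0) (b31 : P 3 1 = 0)
    (key : ∀ H : Mat4, H.IsSymm →
      (hessOp f (r⁻¹ • (P.transpose * H * P - G)) = 0 ↔ hessOp h H = 0)) :
    ∃ σ δ : ℝ, δ ≠ 0 ∧ δ = P 2 2 * P 3 3 - P 2 3 * P 3 2 ∧
      σ * δ = P 0 0 * P 2 2 + P 0 1 * P 2 3 ∧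
      P 0 0 = σ * P 3 3 ∧ P 0 1 = -(σ * P 3 2) ∧ P 1 0 = -(σ * P 2 3) ∧ P 1 1 = σ * P 2 2 ∧
      σ ≠ 0 ∧ r * h = f * (σ ^ 3 * δ) ∧
      f * (σ ^ 2 * δ) * G 0 0 = r * (P 0 0 * P 1 3 - P 1 0 * P 0 3) := by
  rw [det_of_block b20 b21 b30 b31] at hP
  have hA : P 0 0 * P 1 1 - P 0 1 * P 1 0 ≠ 0 := left_ne_zero_of_mul hP
  have hδ : P 2 2 * P 3 3 - P 2 3 * P 3 2 ≠ 0 := right_ne_zero_of_mul hP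
  have r2 : r ^ 2 ≠ 0 := pow_ne_zero 2 hr
  have g10 : G 1 0 = G 0 1 := hG.apply _ _
  have op : ∀ K : Mat4, hessOp f (r⁻¹ • (K - G)) = 0 → r * (K 0 2 - G 0 2 + (K 1 3 - G 1 3)) +
      f * ((K 0 0 - G 0 0) * (K 1 1 - G 1 1) - (K 0 1 - G 0 1) ^ 2) = 0 := by
    intro K h
    simp only [hessOp, Matrix.smul_apply, Matrix.sub_apply, smul_eq_mul] at h
    field_simp at h
    linear_combination h
  have val : ∀ a b c s t u v : ℝ, s + v + h * (a * c - b ^ 2) = 0 → _ := fun a b c s t u v he =>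
    op _ ((key !![a, b, s, t; b, c, u, v; s, u, 0, 0; t, v, 0, 0]
      (by ext i j; revert i j; simp [forall_fin_four])).2 (by simpa [hessOp] using he))
  have v0 := val 0 0 0 0 0 0 0 (by ring)
  have v1 := val 0 0 0 1 0 0 (-1) (by ring)
  have v2 := val 0 0 0 0 1 0 0 (by ring)
  have v3 := val 0 0 0 0 0 1 0 (by ring)
  have v4 := val 0 1 0 h 0 0 0 (by ring)
  have v5 := val 0 (-1) 0 h 0 0 0 (by ring)
  have v6 : ∀ x y, _ := fun x y => val (x ^ 2) (x * y) (y ^ 2) 0 0 0 0 (by ring)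
  simp [Matrix.mul_apply, Fin.sum_univ_four, b20, b21, b30, b31] at v0 v1 v2 v3 v4 v5 v6
  have w1 : P 0 0 * P 2 2 + P 0 1 * P 2 3 = P 1 0 * P 3 2 + P 1 1 * P 3 3 :=
    mul_left_cancel₀ hr (by linear_combination v1 - v0)
  have w2 : P 0 0 * P 3 2 + P 0 1 * P 3 3 = 0 :=
    mul_left_cancel₀ hr (by linear_combination v2 - v0)
  have w3 : P 1 0 * P 2 2 + P 1 1 * P 2 3 = 0 :=
    mul_left_cancel₀ hr (by linear_combination v3 - v0)
  obtain ⟨δ, hd⟩ : ∃ δ, δ = P 2 2 * P 3 3 - P 2 3 * P 3 2 := ⟨_, rfl⟩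
  rw [← hd] at hδ
  obtain ⟨σ, hs⟩ : ∃ σ, σ = (P 0 0 * P 2 2 + P 0 1 * P 2 3) / δ := ⟨_, rfl⟩
  have hs' : σ * δ = P 0 0 * P 2 2 + P 0 1 * P 2 3 := by
    rw [hs]
    field_simp
  have c00 : P 0 0 = σ * P 3 3 := mul_left_cancel₀ hδ (by
    linear_combination P 0 0 * hd - P 3 3 * hs' - P 2 3 * w2)
  have c01 : P 0 1 = -(σ * P 3 2) := mul_left_cancel₀ hδ (by
    linear_combination P 0 1 * hd + P 3 2 * hs' + P 2 2 * w2)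
  have c10 : P 1 0 = -(σ * P 2 3) := mul_left_cancel₀ hδ (by
    linear_combination P 1 0 * hd + P 2 3 * hs' + P 2 3 * w1 + P 3 3 * w3)
  have c11 : P 1 1 = σ * P 2 2 := mul_left_cancel₀ hδ (by
    linear_combination P 1 1 * hd - P 2 2 * hs' - P 2 2 * w1 - P 3 2 * w3)
  have hdet : P 0 0 * P 1 1 - P 0 1 * P 1 0 = σ ^ 2 * δ := by
    rw [c00, c11, c01, c10, hd]
    ring
  rw [hdet] at hA
  have hσ : σ ≠ 0 := by
    rintro rfl
    simp at hA
  refine ⟨σ, δ, hδ, hd, hs', c00, c01, c10, c11, hσ, ?_, ?_⟩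
  · have e : r * h * (P 0 0 * P 2 2 + P 0 1 * P 2 3) =
        f * (P 0 0 * P 1 1 - P 0 1 * P 1 0) ^ 2 := by
      linear_combination (v4 + v5) / 2 - v0
    rw [hdet, ← hs'] at e
    exact mul_right_cancel₀ (mul_ne_zero hσ hδ) (by linear_combination e)
  -- For (x, y) = (-P₂₁, P₁₁) in matrix numbering from 1, the pulled-back block has only its second
  -- diagonal entry nonzero, so the difference from H = 0 isolates the first diagonal entry of G.
  · have e : f * (P 0 0 * P 1 1 - P 0 1 * P 1 0) ^ 2 * G 0 0 =
        r * (P 0 0 * P 1 1 - P 0 1 * P 1 0) * (P 0 0 * P 1 3 - P 1 0 * P 0 3) := by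
      linear_combination v0 - v6 (-P 1 0) (P 0 0)
    rw [hdet] at e
    exact mul_left_cancel₀ hA (by linear_combination e)

end Point

/-! ### Contact transformations in components -/

/-- The vector `∂_j + p_j ∂_u` at `b`. -/
noncomputable def totVec (b : J1) (j : Fin 4) : J1 := ex j + b.2.2 j • eu

theorem dd_add_vec (v w : J1) (φ : J1 → ℝ) (a : J1) : dd (v + w) φ a = dd v φ a + dd w φ a := by
  simp [dd]

theorem dd_smul_vec (c : ℝ) (v : J1) (φ : J1 → ℝ) (a : J1) : dd (c • v) φ a = c * dd v φ a := by
  simp [dd]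

theorem dd_totVec (b : J1) (j : Fin 4) (φ : J1 → ℝ) (a : J1) :
    dd (totVec b j) φ a = dd (ex j) φ a + b.2.2 j * dd eu φ a := by
  rw [totVec, dd_add_vec, dd_smul_vec]

theorem contactForm_totVec (b : J1) (j : Fin 4) : contactForm b (totVec b j) = 0 := by
  simp [contactForm, totVec, ex, eu, Pi.single_apply]

theorem contactForm_ep (b : J1) (j : Fin 4) : contactForm b (ep j) = 0 := by
  simp [contactForm, ep]

theorem contactForm_eu (b : J1) : contactForm b eu = 1 := by
  simp [contactForm, eu]

/-- The derivatives of `X` along `∂_j + p_j ∂_u`. -/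
noncomputable def totJac (X : Fin 4 → J1 → ℝ) (b : J1) : Mat4 :=
  Matrix.of fun k j => dd (totVec b j) (X k) b

/-- The derivatives of `X` along `∂_{p_j}`. -/
noncomputable def vertJac (X : Fin 4 → J1 → ℝ) (b : J1) : Mat4 :=
  Matrix.of fun k j => dd (ep j) (X k) b

/-- The components of a contact transformation that carries the equation with coefficient `f` to an
equation whose coefficient is `h` in the original coordinates. -/
structure ContactSystem (D : Set J1) (X : Fin 4 → J1 → ℝ) (U : J1 → ℝ) (p : Fin 4 → J1 → ℝ)
    (ρ f h : J1 → ℝ) : Prop where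
  isOpen : IsOpen D
  smooth_X : ∀ i, ContDiffOn ℝ ∞ (X i) D
  smooth_U : ContDiffOn ℝ ∞ U D
  smooth_p : ∀ i, ContDiffOn ℝ ∞ (p i) D
  smooth_r : ContDiffOn ℝ ∞ ρ D
  smooth_f : ContDiffOn ℝ ∞ f D
  smooth_h : ContDiffOn ℝ ∞ h D
  r_ne : ∀ b ∈ D, ρ b ≠ 0
  f_ne : ∀ b ∈ D, f b ≠ 0
  h_ne : ∀ b ∈ D, h b ≠ 0
  contact : ∀ b ∈ D, ∀ v, dd v U b = ∑ i, p i b * dd v (X i) b + ρ b * contactForm b v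
  transfers : ∀ b ∈ D, TransfersOp (totJac X b) (vertJac X b) (totJac p b) (vertJac p b) (f b) (h b)

namespace ContactSystem

variable {D : Set J1} {X : Fin 4 → J1 → ℝ} {U : J1 → ℝ} {p : Fin 4 → J1 → ℝ} {ρ f h : J1 → ℝ}
  {a : J1}

/-- Exterior derivative of dU = Σ pᵢ dXᵢ + ρθ, evaluated on two vectors in the kernel of θ, where dρ
∧ θ drops out. -/
theorem symplectic (C : ContactSystem D X U p ρ f h) (ha : a ∈ D) {v w : J1}
    (hv : contactForm a v = 0) (hw : contactForm a w = 0) :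
    ∑ i, (dd w (p i) a * dd v (X i) a - dd v (p i) a * dd w (X i) a) =
      ρ a * ∑ i, (w.2.2 i * v.1 i - v.2.2 i * w.1 i) := by
  have dp : ∀ i, DifferentiableAt ℝ (p i) a := fun i => diffAt_of_smooth C.isOpen (C.smooth_p i) ha
  have dX : ∀ v i, DifferentiableAt ℝ (dd v (X i)) a := fun v i =>
    diffAt_of_smooth C.isOpen (smooth_dd C.isOpen (C.smooth_X i) v) ha
  have dr : DifferentiableAt ℝ ρ a := diffAt_of_smooth C.isOpen C.smooth_r ha
  have dc : ∀ v, DifferentiableAt ℝ (fun b => contactForm b v) a := fun v => by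
    unfold contactForm
    fun_prop
  have ec : ∀ v w, dd w (fun b => contactForm b v) a = -∑ i, w.2.2 i * v.1 i := by
    intro v w
    simp only [contactForm, Fin.sum_univ_four]
    simp (disch := fun_prop) only [dd_sub, dd_add, dd_mul, dd_const, dd_thd]
    ring
  have key : ∀ v w, contactForm a v = 0 → dd w (dd v U) a =
      ∑ i, (dd w (p i) a * dd v (X i) a + p i a * dd w (dd v (X i)) a) -
        ρ a * ∑ i, w.2.2 i * v.1 i := by
    intro v w hv
    rw [dd_congr_on C.isOpen ha (fun b hb => C.contact b hb v) w]
    simp only [Fin.sum_univ_four]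
    simp (disch := fun_prop) only [dd_add, dd_mul, ec, hv]
    simp only [Fin.sum_univ_four]
    ring
  have k1 := key v w hv
  have k2 := key w v hw
  rw [dd_comm C.isOpen C.smooth_U ha w v, k2] at k1
  simp only [dd_comm C.isOpen (C.smooth_X _) ha w v] at k1
  simp only [Fin.sum_univ_four] at k1 ⊢
  linear_combination -k1

theorem isSymplecticData (C : ContactSystem D X U p ρ f h) (ha : a ∈ D) :
    IsSymplecticData (totJac X a) (vertJac X a) (totJac p a) (vertJac p a) (ρ a) := by
  have hT := contactForm_totVec a
  have hE := contactForm_ep a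
  refine ⟨C.r_ne a ha, ?_, ?_, ?_⟩
  · ext i j
    have := C.symplectic ha (hT i) (hE j)
    simp only [Finset.sum_sub_distrib] at this
    simp only [Matrix.sub_apply, Matrix.mul_apply, Matrix.transpose_apply, totJac, vertJac,
      Matrix.of_apply, Matrix.smul_apply, smul_eq_mul]
    simp only [mul_comm (dd (totVec a i) (X _) a)]
    rw [this]
    simp [totVec, ex, eu, ep, Pi.single_apply, Matrix.one_apply, eq_comm]
  · ext i j
    have := C.symplectic ha (hT i) (hT j)
    simp only [Finset.sum_sub_distrib] at this
    simp only [Matrix.mul_apply, Matrix.transpose_apply, totJac, Matrix.of_apply]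
    rw [← sub_eq_zero]
    simp only [mul_comm (dd (totVec a i) (X _) a)]
    rw [this]
    simp [totVec, ex, eu]
  · ext i j
    have := C.symplectic ha (hE i) (hE j)
    simp only [Finset.sum_sub_distrib] at this
    simp only [Matrix.mul_apply, Matrix.transpose_apply, vertJac, Matrix.of_apply]
    rw [← sub_eq_zero]
    simp only [mul_comm (dd (ep i) (X _) a)]
    rw [this]
    simp [ep]

theorem dd_ep (C : ContactSystem D X U p ρ f h) (ha : a ∈ D) (j k : Fin 4) :
    dd (ep j) (X k) a = 0 := by
  have := (C.transfers a ha).eq_zero (C.isSymplecticData ha) (C.f_ne a ha) (C.h_ne a ha)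
  exact congrFun (congrFun this k) j

theorem det_ne (C : ContactSystem D X U p ρ f h) (ha : a ∈ D) : (totJac X a).det ≠ 0 := by
  have D' := C.isSymplecticData ha
  have hQ : vertJac X a = 0 :=
    (C.transfers a ha).eq_zero D' (C.f_ne a ha) (C.h_ne a ha)
  have h1 := D'.cross
  rw [hQ, Matrix.mul_zero, sub_zero] at h1
  have h2 := congrArg Matrix.det h1
  rw [Matrix.det_mul, Matrix.det_transpose, Matrix.det_smul, Matrix.det_one, mul_one] at h2
  intro h0
  rw [h0, zero_mul] at h2
  exact pow_ne_zero _ (C.r_ne a ha) h2.symm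

theorem point_iff (C : ContactSystem D X U p ρ f h) (ha : a ∈ D) {H : Mat4} (hH : H.IsSymm) :
    hessOp (f a) ((ρ a)⁻¹ • ((totJac X a).transpose * H * totJac X a -
      (totJac X a).transpose * totJac p a)) = 0 ↔ hessOp (h a) H = 0 := by
  have D' := C.isSymplecticData ha
  have T' := C.transfers a ha
  have hQ : vertJac X a = 0 := T'.eq_zero D' (C.f_ne a ha) (C.h_ne a ha)
  rw [hQ] at D' T'
  exact T'.point_iff D' (C.det_ne ha) hH

/-- The block condition reads ∂ⱼX + pⱼ∂ᵤX = 0 on an open set where X does not depend on p; its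
derivative in pⱼ separates the two terms. -/
theorem dd_lower (C : ContactSystem D X U p ρ f h) (ha : a ∈ D) {k j : Fin 4}
    (hk : k = 2 ∨ k = 3) (hj : j = 0 ∨ j = 1) : dd eu (X k) a = 0 ∧ dd (ex j) (X k) a = 0 := by
  have h0 : ∀ b ∈ D, dd (ex j) (X k) b + b.2.2 j * dd eu (X k) b = 0 := by
    intro b hb
    obtain ⟨b20, b21, b30, b31⟩ := block_of_point_iff (C.r_ne b hb) (C.f_ne b hb) (C.det_ne hb)
      (fun H hH => C.point_iff hb hH)
    rw [← dd_totVec]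
    rcases hk with rfl | rfl <;> rcases hj with rfl | rfl <;> assumption
  have d1 : ∀ v, DifferentiableAt ℝ (dd v (X k)) a := fun v =>
    diffAt_of_smooth C.isOpen (smooth_dd C.isOpen (C.smooth_X k) v) ha
  have h1 : ∀ v, dd (ep j) (dd v (X k)) a = 0 := fun v => by
    rw [dd_comm C.isOpen (C.smooth_X k) ha]
    exact dd_eq_zero_on C.isOpen ha (fun b hb => C.dd_ep hb j k) v
  have h2 := dd_eq_zero_on C.isOpen ha h0 (ep j)
  simp (disch := fun_prop) only [dd_add, dd_mul, dd_thd, h1] at h2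
  have h3 : dd eu (X k) a = 0 := by simpa [ep] using h2
  refine ⟨h3, ?_⟩
  have := h0 a ha
  rwa [h3, mul_zero, add_zero] at this

end ContactSystem

namespace ContactSystem

variable {D : Set J1} {X : Fin 4 → J1 → ℝ} {U : J1 → ℝ} {p : Fin 4 → J1 → ℝ} {ρ f h : J1 → ℝ}
  {a : J1}

theorem dd_dd_eq_zero (C : ContactSystem D X U p ρ f h) (ha : a ∈ D) {v : J1} {k : Fin 4}
    (e : ∀ b ∈ D, dd v (X k) b = 0) (w : J1) : dd v (dd w (X k)) a = 0 := by
  rw [dd_comm C.isOpen (C.smooth_X k) ha]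
  exact dd_eq_zero_on C.isOpen ha e w

/-- The scalar σ is found pointwise; its explicit quotient formula makes it smooth, so that the
relations can be differentiated. -/
theorem exists_factor (C : ContactSystem D X U p ρ f h) :
    ∃ σ : J1 → ℝ, ContDiffOn ℝ ∞ σ D ∧ ∀ b ∈ D,
      dd (ex 2) (X 2) b * dd (ex 3) (X 3) b - dd (ex 3) (X 2) b * dd (ex 2) (X 3) b ≠ 0 ∧
      σ b ≠ 0 ∧
      dd (ex 0) (X 0) b + b.2.2 0 * dd eu (X 0) b = σ b * dd (ex 3) (X 3) b ∧
      dd (ex 1) (X 0) b + b.2.2 1 * dd eu (X 0) b = -(σ b * dd (ex 2) (X 3) b) ∧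
      dd (ex 0) (X 1) b + b.2.2 0 * dd eu (X 1) b = -(σ b * dd (ex 3) (X 2) b) ∧
      dd (ex 1) (X 1) b + b.2.2 1 * dd eu (X 1) b = σ b * dd (ex 2) (X 2) b ∧
      ρ b * h b = f b * (σ b ^ 3 * (dd (ex 2) (X 2) b * dd (ex 3) (X 3) b -
        dd (ex 3) (X 2) b * dd (ex 2) (X 3) b)) ∧
      f b * (σ b ^ 2 * (dd (ex 2) (X 2) b * dd (ex 3) (X 3) b -
        dd (ex 3) (X 2) b * dd (ex 2) (X 3) b)) *
        (∑ k, dd (totVec b 0) (X k) b * dd (totVec b 0) (p k) b) =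
        ρ b * (dd (totVec b 0) (X 0) b * dd (totVec b 3) (X 1) b -
          dd (totVec b 0) (X 1) b * dd (totVec b 3) (X 0) b) := by
  have hs : ∀ v k, ContDiffOn ℝ ∞ (dd v (X k)) D := fun v k =>
    smooth_dd C.isOpen (C.smooth_X k) v
  have key : ∀ b ∈ D, ∃ σ δ : ℝ, δ ≠ 0 ∧
      δ = dd (ex 2) (X 2) b * dd (ex 3) (X 3) b - dd (ex 3) (X 2) b * dd (ex 2) (X 3) b ∧
      σ * δ = (dd (ex 0) (X 0) b + b.2.2 0 * dd eu (X 0) b) * dd (ex 2) (X 2) b +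
        (dd (ex 1) (X 0) b + b.2.2 1 * dd eu (X 0) b) * dd (ex 3) (X 2) b ∧ σ ≠ 0 ∧
      dd (ex 0) (X 0) b + b.2.2 0 * dd eu (X 0) b = σ * dd (ex 3) (X 3) b ∧
      dd (ex 1) (X 0) b + b.2.2 1 * dd eu (X 0) b = -(σ * dd (ex 2) (X 3) b) ∧
      dd (ex 0) (X 1) b + b.2.2 0 * dd eu (X 1) b = -(σ * dd (ex 3) (X 2) b) ∧
      dd (ex 1) (X 1) b + b.2.2 1 * dd eu (X 1) b = σ * dd (ex 2) (X 2) b ∧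
      ρ b * h b = f b * (σ ^ 3 * δ) ∧ f b * (σ ^ 2 * δ) *
        (∑ k, dd (totVec b 0) (X k) b * dd (totVec b 0) (p k) b) =
        ρ b * (dd (totVec b 0) (X 0) b * dd (totVec b 3) (X 1) b -
          dd (totVec b 0) (X 1) b * dd (totVec b 3) (X 0) b) := by
    intro b hb
    have hsym : ((totJac X b).transpose * totJac p b).IsSymm := by
      rw [Matrix.IsSymm, (C.isSymplecticData hb).left]
      simp [(C.isSymplecticData hb).left]
    obtain ⟨b20, b21, b30, b31⟩ := block_of_point_iff (C.r_ne b hb) (C.f_ne b hb) (C.det_ne hb)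
      (fun H hH => C.point_iff hb hH)
    obtain ⟨σ, δ, h1, h2, h3, h4, h5, h6, h7, h8, h9, h10⟩ := coeffs_of_point_iff (C.r_ne b hb)
      (C.det_ne hb) hsym b20 b21 b30 b31 (fun H hH => C.point_iff hb hH)
    have l2 : ∀ j, totJac X b 2 j = dd (ex j) (X 2) b := fun j => by
      rw [totJac, Matrix.of_apply, dd_totVec, (C.dd_lower hb (Or.inl rfl) (Or.inl rfl)).1, mul_zero,
        add_zero]
    have l3 : ∀ j, totJac X b 3 j = dd (ex j) (X 3) b := fun j => by
      rw [totJac, Matrix.of_apply, dd_totVec, (C.dd_lower hb (Or.inr rfl) (Or.inl rfl)).1, mul_zero,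
        add_zero]
    have l0 : ∀ k j, totJac X b k j = dd (ex j) (X k) b + b.2.2 j * dd eu (X k) b := fun k j => by
      rw [totJac, Matrix.of_apply, dd_totVec]
    rw [l2, l3, l2, l3] at h2
    rw [l2, l2] at h3
    rw [l3] at h4 h5
    rw [l2] at h6 h7
    rw [l0] at h4 h5 h6 h7
    rw [l0, l0] at h3
    exact ⟨σ, δ, h1, h2, h3, h8, h4, h5, h6, h7, h9, h10⟩
  refine ⟨fun b => ((dd (ex 0) (X 0) b + b.2.2 0 * dd eu (X 0) b) * dd (ex 2) (X 2) b +
        (dd (ex 1) (X 0) b + b.2.2 1 * dd eu (X 0) b) * dd (ex 3) (X 2) b) *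
    (dd (ex 2) (X 2) b * dd (ex 3) (X 3) b - dd (ex 3) (X 2) b * dd (ex 2) (X 3) b)⁻¹, ?_, ?_⟩
  · refine ContDiffOn.mul ?_ (ContDiffOn.inv (((hs _ _).mul (hs _ _)).sub ((hs _ _).mul (hs _ _)))
      fun b hb => ?_)
    · have p0 : ∀ i, ContDiffOn ℝ ∞ (fun b : J1 => b.2.2 i) D := fun i => by fun_prop
      exact (((hs _ _).add ((p0 0).mul (hs _ _))).mul (hs _ _)).add
        (((hs _ _).add ((p0 1).mul (hs _ _))).mul (hs _ _))
    · obtain ⟨σ, δ, h1, h2, -⟩ := key b hb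
      rwa [← h2]
  · intro b hb
    obtain ⟨σ, δ, h1, h2, h3, h4⟩ := key b hb
    have e : σ = ((dd (ex 0) (X 0) b + b.2.2 0 * dd eu (X 0) b) * dd (ex 2) (X 2) b +
        (dd (ex 1) (X 0) b + b.2.2 1 * dd eu (X 0) b) * dd (ex 3) (X 2) b) *
      (dd (ex 2) (X 2) b * dd (ex 3) (X 3) b - dd (ex 3) (X 2) b * dd (ex 2) (X 3) b)⁻¹ := by
      rw [← h2, ← h3]
      field_simp
    dsimp only
    rw [← e, ← h2]
    exact ⟨h1, h4⟩

end ContactSystem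

/-! ### Independence of the coefficient from x₁ -/

namespace ContactSystem

variable {D : Set J1} {X : Fin 4 → J1 → ℝ} {U : J1 → ℝ} {p : Fin 4 → J1 → ℝ} {ρ f h : J1 → ℝ}
  {a : J1}

/-- The coefficient does not depend on `x₁` if the transformed coefficient depends only on the last
two of the original variables. -/
theorem dd_coeff_eq_zero (C : ContactSystem D X U p ρ f h)
    (hf : ∀ b ∈ D, dd (ep 0) f b = 0 ∧ dd eu f b = 0)
    (hh : ∀ b ∈ D, dd (ep 0) h b = 0 ∧ dd eu h b = 0 ∧ dd (ex 0) h b = 0) (ha : a ∈ D) :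
    dd (ex 0) f a = 0 := by
  obtain ⟨σ, hσ, K⟩ := C.exists_factor
  have dX : ∀ a ∈ D, ∀ v k, DifferentiableAt ℝ (dd v (X k)) a := fun a ha v k =>
    diffAt_of_smooth C.isOpen (smooth_dd C.isOpen (C.smooth_X k) v) ha
  have ds : ∀ a ∈ D, DifferentiableAt ℝ σ a := fun a ha => diffAt_of_smooth C.isOpen hσ ha
  have dr : ∀ a ∈ D, DifferentiableAt ℝ ρ a := fun a ha => diffAt_of_smooth C.isOpen C.smooth_r ha
  have df : ∀ a ∈ D, DifferentiableAt ℝ f a := fun a ha => diffAt_of_smooth C.isOpen C.smooth_f ha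
  have dh : ∀ a ∈ D, DifferentiableAt ℝ h a := fun a ha => diffAt_of_smooth C.isOpen C.smooth_h ha
  have dp : ∀ a ∈ D, ∀ k, DifferentiableAt ℝ (p k) a := fun a ha k =>
    diffAt_of_smooth C.isOpen (C.smooth_p k) ha
  have ze : ∀ a ∈ D, ∀ j k w, dd (ep j) (dd w (X k)) a = 0 := fun a ha j k w =>
    C.dd_dd_eq_zero ha (fun b hb => C.dd_ep hb j k) w
  have z2 : ∀ a ∈ D, ∀ w, dd eu (dd w (X 2)) a = 0 ∧ dd (ex 0) (dd w (X 2)) a = 0 ∧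
      dd (ex 1) (dd w (X 2)) a = 0 := fun a ha w =>
    ⟨C.dd_dd_eq_zero ha (fun b hb => (C.dd_lower hb (Or.inl rfl) (Or.inl rfl)).1) w,
      C.dd_dd_eq_zero ha (fun b hb => (C.dd_lower hb (Or.inl rfl) (Or.inl rfl)).2) w,
      C.dd_dd_eq_zero ha (fun b hb => (C.dd_lower hb (Or.inl rfl) (Or.inr rfl)).2) w⟩
  have z3 : ∀ a ∈ D, ∀ w, dd eu (dd w (X 3)) a = 0 ∧ dd (ex 0) (dd w (X 3)) a = 0 ∧
      dd (ex 1) (dd w (X 3)) a = 0 := fun a ha w =>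
    ⟨C.dd_dd_eq_zero ha (fun b hb => (C.dd_lower hb (Or.inr rfl) (Or.inl rfl)).1) w,
      C.dd_dd_eq_zero ha (fun b hb => (C.dd_lower hb (Or.inr rfl) (Or.inl rfl)).2) w,
      C.dd_dd_eq_zero ha (fun b hb => (C.dd_lower hb (Or.inr rfl) (Or.inr rfl)).2) w⟩
  have of_col : ∀ a ∈ D, ∀ t : ℝ, t * dd (ex 2) (X 3) a = 0 → t * dd (ex 2) (X 2) a = 0 → t = 0 := by
    intro a ha t h1 h2
    by_contra ht
    apply (K a ha).1
    rw [(mul_eq_zero.1 h1).resolve_left ht, (mul_eq_zero.1 h2).resolve_left ht]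
    ring
  -- Two of the four relations for σ do not contain p₁; their p₁-derivatives give ∂σ/∂p₁ times a
  -- nonzero column.
  have sp : ∀ a ∈ D, dd (ep 0) σ a = 0 := by
    intro a ha
    have := dX a ha
    have := ds a ha
    have e1 := dd_congr_on C.isOpen ha (fun b hb => (K b hb).2.2.2.1) (ep 0)
    have e2 := dd_congr_on C.isOpen ha (fun b hb => (K b hb).2.2.2.2.2.1) (ep 0)
    simp (disch := fun_prop) only [dd_add, dd_mul, dd_neg, dd_thd, ze a ha] at e1 e2
    simp [ep] at e1 e2
    exact of_col a ha _ (mul_eq_zero.2 e1) (mul_eq_zero.2 e2)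
  -- The other two relations contain p₁ linearly, with coefficient ∂ᵤX.
  have xu : ∀ a ∈ D, ∀ k, dd eu (X k) a = 0 := by
    intro a ha
    have := dX a ha
    have := ds a ha
    have e1 := dd_congr_on C.isOpen ha (fun b hb => (K b hb).2.2.1) (ep 0)
    have e2 := dd_congr_on C.isOpen ha (fun b hb => (K b hb).2.2.2.2.1) (ep 0)
    simp (disch := fun_prop) only [dd_add, dd_mul, dd_neg, dd_thd, ze a ha, sp a ha] at e1 e2
    simp [ep] at e1 e2
    exact forall_fin_four.2 ⟨e1, e2, (C.dd_lower ha (Or.inl rfl) (Or.inl rfl)).1,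
      (C.dd_lower ha (Or.inr rfl) (Or.inl rfl)).1⟩
  have zu : ∀ a ∈ D, ∀ k w, dd eu (dd w (X k)) a = 0 := fun a ha k w =>
    C.dd_dd_eq_zero ha (fun b hb => xu b hb k) w
  have x00 : ∀ b ∈ D, dd (ex 0) (X 0) b = σ b * dd (ex 3) (X 3) b := fun b hb => by
    have := (K b hb).2.2.1
    rwa [xu b hb, mul_zero, add_zero] at this
  have x01 : ∀ b ∈ D, dd (ex 1) (X 0) b = -(σ b * dd (ex 2) (X 3) b) := fun b hb => by
    have := (K b hb).2.2.2.1
    rwa [xu b hb, mul_zero, add_zero] at this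
  have x10 : ∀ b ∈ D, dd (ex 0) (X 1) b = -(σ b * dd (ex 3) (X 2) b) := fun b hb => by
    have := (K b hb).2.2.2.2.1
    rwa [xu b hb, mul_zero, add_zero] at this
  have x11 : ∀ b ∈ D, dd (ex 1) (X 1) b = σ b * dd (ex 2) (X 2) b := fun b hb => by
    have := (K b hb).2.2.2.2.2.1
    rwa [xu b hb, mul_zero, add_zero] at this
  have su : ∀ a ∈ D, dd eu σ a = 0 := by
    intro a ha
    have := dX a ha
    have := ds a ha
    have e1 := dd_congr_on C.isOpen ha x01 eu
    have e2 := dd_congr_on C.isOpen ha x11 eu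
    simp (disch := fun_prop) only [dd_mul, dd_neg, zu a ha] at e1 e2
    simp at e1 e2
    exact of_col a ha _ (mul_eq_zero.2 e1) (mul_eq_zero.2 e2)
  -- Equality of mixed x₁, x₂-derivatives of X₁ and X₂: the terms with derivatives of σ form a
  -- linear system of determinant δ.
  have s0 : ∀ a ∈ D, dd (ex 0) σ a = 0 := by
    intro a ha
    have := dX a ha
    have := ds a ha
    have e1 := dd_congr_on C.isOpen ha x00 (ex 1)
    have e2 := dd_congr_on C.isOpen ha x01 (ex 0)
    have e3 := dd_congr_on C.isOpen ha x10 (ex 1)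
    have e4 := dd_congr_on C.isOpen ha x11 (ex 0)
    rw [dd_comm C.isOpen (C.smooth_X _) ha] at e1 e3
    rw [e2] at e1
    rw [e4] at e3
    simp (disch := fun_prop) only [dd_mul, dd_neg, (z2 a ha _).2.1, (z2 a ha _).2.2,
      (z3 a ha _).2.1, (z3 a ha _).2.2] at e1 e3
    refine (mul_eq_zero.1 (?_ : dd (ex 0) σ a * (dd (ex 2) (X 2) a * dd (ex 3) (X 3) a -
      dd (ex 3) (X 2) a * dd (ex 2) (X 3) a) = 0)).resolve_right (K a ha).1
    linear_combination dd (ex 3) (X 2) a * e1 + dd (ex 3) (X 3) a * e3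
  have rp : ∀ a ∈ D, dd (ep 0) ρ a = 0 := by
    intro a ha
    have := dX a ha
    have := ds a ha
    have := dr a ha
    have := df a ha
    have := dh a ha
    have e1 := dd_congr_on C.isOpen ha (fun b hb => (K b hb).2.2.2.2.2.2.1) (ep 0)
    simp (disch := fun_prop) only [dd_mul, dd_sub, dd_pow, ze a ha, sp a ha, (hf a ha).1,
      (hh a ha).1] at e1
    simpa [C.h_ne a ha] using e1
  have ru : ∀ a ∈ D, dd eu ρ a = 0 := by
    intro a ha
    have := dX a ha
    have := ds a ha
    have := dr a ha
    have := df a ha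
    have := dh a ha
    have e1 := dd_congr_on C.isOpen ha (fun b hb => (K b hb).2.2.2.2.2.2.1) eu
    simp (disch := fun_prop) only [dd_mul, dd_sub, dd_pow, zu a ha, su a ha, (hf a ha).2,
      (hh a ha).2.1] at e1
    simpa [C.h_ne a ha] using e1
  -- Since σ, δ and h do not involve x₁, it remains to show that ρ does not.
  have r0 : ∀ a ∈ D, dd (ex 0) ρ a * h a = dd (ex 0) f a * (σ a ^ 3 *
      (dd (ex 2) (X 2) a * dd (ex 3) (X 3) a - dd (ex 3) (X 2) a * dd (ex 2) (X 3) a)) := by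
    intro a ha
    have := dX a ha
    have := ds a ha
    have := dr a ha
    have := df a ha
    have := dh a ha
    have e1 := dd_congr_on C.isOpen ha (fun b hb => (K b hb).2.2.2.2.2.2.1) (ex 0)
    simp (disch := fun_prop) only [dd_mul, dd_sub, dd_pow, (z2 a ha _).2.1, (z3 a ha _).2.1,
      s0 a ha, (hh a ha).2.2] at e1
    linear_combination e1
  have uu : ∀ b ∈ D, dd eu U b = ρ b := fun b hb => by
    rw [C.contact b hb, contactForm_eu]
    simp [xu b hb]
  have up : ∀ b ∈ D, dd (ep 0) U b = 0 := fun b hb => by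
    rw [C.contact b hb, contactForm_ep]
    simp [C.dd_ep hb]
  have ux : ∀ b ∈ D, dd (ex 0) U b + b.2.2 0 * ρ b = p 0 b * dd (ex 0) (X 0) b +
      p 1 b * dd (ex 0) (X 1) b := fun b hb => by
    have := C.contact b hb (totVec b 0)
    rw [contactForm_totVec, dd_totVec, uu b hb] at this
    rw [this, Fin.sum_univ_four]
    simp only [dd_totVec, xu b hb, (C.dd_lower hb (Or.inl rfl) (Or.inl rfl)).2,
      (C.dd_lower hb (Or.inr rfl) (Or.inl rfl)).2]
    ring
  -- Total x₁-derivative of the contact identity `ux`; the result is affine in p₁ with slope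
  -- 2∂ρ/∂x₁.
  have G0 : ∀ a ∈ D, ∑ k, dd (totVec a 0) (X k) a * dd (totVec a 0) (p k) a =
      dd (ex 0) (dd (ex 0) U) a + 2 * a.2.2 0 * dd (ex 0) ρ a := by
    intro a ha
    have := dX a ha
    have := ds a ha
    have := dr a ha
    have := dp a ha
    have dU : DifferentiableAt ℝ (dd (ex 0) U) a :=
      diffAt_of_smooth C.isOpen (smooth_dd C.isOpen C.smooth_U _) ha
    have e1 := dd_congr_on C.isOpen ha ux (totVec a 0)
    have c1 : dd (ex 0) (dd (ex 0) (X 0)) a = 0 := by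
      rw [dd_congr_on C.isOpen ha x00]
      simp (disch := fun_prop) only [dd_mul, s0 a ha, (z3 a ha _).2.1]
      ring
    have c2 : dd (ex 0) (dd (ex 0) (X 1)) a = 0 := by
      rw [dd_congr_on C.isOpen ha x10]
      simp (disch := fun_prop) only [dd_neg, dd_mul, s0 a ha, (z2 a ha _).2.1]
      ring
    have c3 : dd eu (dd (ex 0) U) a = dd (ex 0) ρ a := by
      rw [dd_comm C.isOpen C.smooth_U ha, dd_congr_on C.isOpen ha uu]
    have c4 : (totVec a 0).2.2 0 = 0 := by simp [totVec, ex, eu]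
    simp (disch := fun_prop) only [dd_add, dd_mul, dd_thd, dd_totVec, c1, c2, c3, c4, zu a ha,
      ru a ha] at e1
    rw [Fin.sum_univ_four]
    simp only [dd_totVec, xu a ha, (C.dd_lower ha (Or.inl rfl) (Or.inl rfl)).2,
      (C.dd_lower ha (Or.inr rfl) (Or.inl rfl)).2]
    linear_combination -e1
  -- In the last relation of `exists_factor` everything else is independent of p₁, so this slope
  -- must vanish.
  have r00 : dd (ex 0) ρ a = 0 := by
    have := dX a ha
    have := ds a ha
    have := dr a ha
    have := df a ha
    have dU : DifferentiableAt ℝ (dd (ex 0) (dd (ex 0) U)) a :=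
      diffAt_of_smooth C.isOpen (smooth_dd C.isOpen (smooth_dd C.isOpen C.smooth_U _) _) ha
    have dr0 : DifferentiableAt ℝ (dd (ex 0) ρ) a :=
      diffAt_of_smooth C.isOpen (smooth_dd C.isOpen C.smooth_r _) ha
    have e0 : ∀ b ∈ D, f b * (σ b ^ 2 * (dd (ex 2) (X 2) b * dd (ex 3) (X 3) b -
        dd (ex 3) (X 2) b * dd (ex 2) (X 3) b)) *
        (dd (ex 0) (dd (ex 0) U) b + 2 * b.2.2 0 * dd (ex 0) ρ b) =
        ρ b * (dd (ex 0) (X 0) b * dd (ex 3) (X 1) b - dd (ex 0) (X 1) b * dd (ex 3) (X 0) b) := by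
      intro b hb
      have := (K b hb).2.2.2.2.2.2.2
      rw [G0 b hb] at this
      simpa only [dd_totVec, xu b hb, mul_zero, add_zero] using this
    have e1 := dd_congr_on C.isOpen ha e0 (ep 0)
    have c1 : dd (ep 0) (dd (ex 0) (dd (ex 0) U)) a = 0 := by
      rw [dd_comm C.isOpen (smooth_dd C.isOpen C.smooth_U _) ha]
      refine dd_eq_zero_on C.isOpen ha (fun b hb => ?_) _
      rw [dd_comm C.isOpen C.smooth_U hb]
      exact dd_eq_zero_on C.isOpen hb up _
    have c2 : dd (ep 0) (dd (ex 0) ρ) a = 0 := by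
      rw [dd_comm C.isOpen C.smooth_r ha]
      exact dd_eq_zero_on C.isOpen ha rp _
    simp (disch := fun_prop) only [dd_add, dd_mul, dd_sub, dd_pow, dd_const, dd_thd, c1, c2, ze a ha,
      sp a ha, rp a ha, (hf a ha).1] at e1
    simpa [ep, C.f_ne a ha, (K a ha).1, (K a ha).2.1] using e1
  have := r0 a ha
  rw [r00, zero_mul, eq_comm] at this
  exact (mul_eq_zero.1 this).resolve_right (mul_ne_zero (pow_ne_zero 3 (K a ha).2.1) (K a ha).1)

end ContactSystem

/-! ### The two contact classes -/

theorem eq_of_mem_jetPlane {a : J1} {H : Mat4} {v w : J1} (hv : v ∈ jetPlane a H)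
    (hw : w ∈ jetPlane a H) (e : v.1 = w.1) : v = w := by
  obtain ⟨v1, v2⟩ := hv
  obtain ⟨w1, w2⟩ := hw
  refine Prod.ext e (Prod.ext ?_ ?_)
  · rw [v1, w1, e]
  · rw [v2, w2, e]

theorem contactForm_liftVec (a : J1) (H : Mat4) (ξ : Pt) : contactForm a (liftVec a H ξ) = 0 :=
  sub_self _

section Components

variable {F : J1 → J1} {a : J1}

theorem contactForm_fderiv (hF : DifferentiableAt ℝ F a) (v : J1) :
    contactForm (F a) (fderiv ℝ F a v) = dd v (fun b => (F b).2.1) a -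
      ∑ i, (F a).2.2 i * dd v (fun b => (F b).1 i) a := by
  obtain ⟨h1, h2, -⟩ := hasFDerivAt_components (v := v) hF
  simp only [contactForm, h1, h2]

theorem dd_liftVec (φ : Fin 4 → J1 → ℝ) (H : Mat4) (ξ : Pt) (k : Fin 4) :
    dd (liftVec a H ξ) (φ k) a = (totJac φ a + vertJac φ a * H).mulVec ξ k := by
  rw [dd_decomp, Matrix.add_mulVec, ← Matrix.mulVec_mulVec]
  simp only [liftVec, Pi.add_apply, Matrix.mulVec, dotProduct, totJac, vertJac, Matrix.of_apply,
    dd_totVec, Fin.sum_univ_four]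
  ring

/-- The lift of ξ is sent to the lift of (P + QH)ξ; invertibility of P + QH makes the image the
whole plane. -/
theorem transfersOp_of_equation (hF : DifferentiableAt ℝ F a) {f h : J1 → ℝ} {ρ : ℝ}
    (hc : ∀ v, contactForm (F a) (fderiv ℝ F a v) = ρ * contactForm a v)
    (he : ∀ H H' : Mat4, H.IsSymm → H'.IsSymm →
      (jetPlane a H).map (fderiv ℝ F a : J1 →ₗ[ℝ] J1) = jetPlane (F a) H' →
      (heavenlyOp f a H = 0 ↔ heavenlyOp h (F a) H' = 0)) :
    TransfersOp (totJac (fun i b => (F b).1 i) a) (vertJac (fun i b => (F b).1 i) a)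
      (totJac (fun i b => (F b).2.2 i) a) (vertJac (fun i b => (F b).2.2 i) a) (f a) (h (F a)) := by
  intro H H' hH hH' hJ hE
  refine he H H' hH hH' ?_
  have e1 : ∀ ξ, (fderiv ℝ F a (liftVec a H ξ)).1 =
      (totJac (fun i b => (F b).1 i) a + vertJac (fun i b => (F b).1 i) a * H).mulVec ξ := by
    intro ξ
    funext k
    rw [← (hasFDerivAt_components hF).1]
    exact dd_liftVec (fun i b => (F b).1 i) H ξ k
  have e2 : ∀ ξ, (fderiv ℝ F a (liftVec a H ξ)).2.2 =
      (totJac (fun i b => (F b).2.2 i) a + vertJac (fun i b => (F b).2.2 i) a * H).mulVec ξ := by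
    intro ξ
    funext k
    rw [← (hasFDerivAt_components hF).2.2]
    exact dd_liftVec (fun i b => (F b).2.2 i) H ξ k
  have mem : ∀ ξ, fderiv ℝ F a (liftVec a H ξ) ∈ jetPlane (F a) H' := by
    intro ξ
    refine ⟨?_, ?_⟩
    · have := hc (liftVec a H ξ)
      rw [contactForm_liftVec, mul_zero] at this
      exact sub_eq_zero.1 this
    · rw [e1, e2, Matrix.mulVec_mulVec, hE]
  refine le_antisymm ?_ fun w hw => ?_
  · rintro _ ⟨v, hv, rfl⟩
    have : v = liftVec a H v.1 := eq_of_mem_jetPlane hv (liftVec_mem a H v.1) rfl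
    rw [this]
    exact mem _
  · refine ⟨liftVec a H ((totJac (fun i b => (F b).1 i) a +
      vertJac (fun i b => (F b).1 i) a * H)⁻¹.mulVec w.1), liftVec_mem _ _ _, ?_⟩
    refine eq_of_mem_jetPlane (mem _) hw ?_
    refine (e1 _).trans ?_
    rw [Matrix.mulVec_mulVec, Matrix.mul_nonsing_inv _ (isUnit_iff_ne_zero.2 hJ),
      Matrix.one_mulVec]

end Components

/-- The factor ρ, given only pointwise, is recovered by evaluating the contact forms on ∂ᵤ, which
shows that it is smooth. -/
theorem IsContactEquivalence.contactSystem {Φ : OpenPartialHomeomorph J1 J1} {f h : J1 → ℝ}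
    (E : IsContactEquivalence Φ f h) (hf : ContDiff ℝ ∞ f) (hh : ContDiff ℝ ∞ h) {D : Set J1}
    (hD : IsOpen D) (hD' : D ⊆ Φ.source) (f_ne : ∀ a ∈ D, f a ≠ 0) (h_ne : ∀ a ∈ D, h (Φ a) ≠ 0) :
    ContactSystem D (fun i b => (Φ b).1 i) (fun b => (Φ b).2.1) (fun i b => (Φ b).2.2 i)
      (fun b => dd eu (fun b => (Φ b).2.1) b - ∑ i, (Φ b).2.2 i * dd eu (fun b => (Φ b).1 i) b)
      f (fun b => h (Φ b)) := by
  have hΦ : ContDiffOn ℝ ∞ Φ D := E.smooth.mono hD'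
  have sX : ∀ i, ContDiffOn ℝ ∞ (fun b => (Φ b).1 i) D := contDiffOn_pi.1 hΦ.fst
  have sU : ContDiffOn ℝ ∞ (fun b => (Φ b).2.1) D := hΦ.snd.fst
  have sp : ∀ i, ContDiffOn ℝ ∞ (fun b => (Φ b).2.2 i) D := contDiffOn_pi.1 hΦ.snd.snd
  have dΦ : ∀ a ∈ D, DifferentiableAt ℝ Φ a := fun a ha =>
    (hΦ.contDiffAt (hD.mem_nhds ha)).differentiableAt (by simp)
  have cont : ∀ a ∈ D, (dd eu (fun b => (Φ b).2.1) a -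
      ∑ i, (Φ a).2.2 i * dd eu (fun b => (Φ b).1 i) a ≠ 0) ∧ ∀ v,
      contactForm (Φ a) (fderiv ℝ Φ a v) = (dd eu (fun b => (Φ b).2.1) a -
        ∑ i, (Φ a).2.2 i * dd eu (fun b => (Φ b).1 i) a) * contactForm a v := by
    intro a ha
    obtain ⟨ρ, hρ, hc⟩ := E.contact a (hD' ha)
    have e := hc eu
    rw [contactForm_fderiv (dΦ a ha), contactForm_eu, mul_one] at e
    rw [e]
    exact ⟨hρ, hc⟩
  refine ⟨hD, sX, sU, sp, ?_, hf.contDiffOn, hh.comp_contDiffOn hΦ, fun b hb => (cont b hb).1, f_ne,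
    h_ne, fun b hb v => ?_, fun b hb => ?_⟩
  · exact (smooth_dd hD sU eu).sub (ContDiffOn.sum fun i _ => (sp i).mul (smooth_dd hD (sX i) eu))
  · have := (cont b hb).2 v
    rw [contactForm_fderiv (dΦ b hb)] at this
    linarith
  · exact transfersOp_of_equation (dΦ b hb) (cont b hb).2 (E.equation b (hD' hb))

theorem exists_ne_of_dd_ne {D : Set J1} (hD : IsOpen D) (hne : D.Nonempty) {φ : J1 → ℝ} {v : J1}
    (hv : ∀ a ∈ D, dd v φ a ≠ 0) : ∃ a ∈ D, φ a ≠ 0 := by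
  by_contra! h0
  obtain ⟨a, ha⟩ := hne
  exact hv a ha (dd_eq_zero_on hD ha h0 v)

theorem normalForm_contDiff (i : Fin 4) : ContDiff ℝ ∞ (normalForm i) := by
  revert i
  refine forall_fin_four.2 ⟨?_, ?_, ?_, ?_⟩ <;> simp only [normalForm, Matrix.cons_val] <;> fun_prop

theorem dd_normalForm {i : Fin 4} (hi : i = 0 ∨ i = 1) {a : J1} :
    dd (ep 0) (normalForm i) a = 0 ∧ dd eu (normalForm i) a = 0 ∧
      (a.1 2 ≠ 0 → dd (ex 0) (normalForm i) a ≠ 0) := by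
  rcases hi with rfl | rfl <;> simp only [normalForm, Matrix.cons_val] <;>
    simp (disch := fun_prop) only [dd_add, dd_mul, dd_fst] <;> simp [ep, eu, ex]

/-- The domain is shrunk until x₃ and both coefficients are nonzero; it stays nonempty because none
of these functions vanishes on an open set. -/
theorem not_isContactEquivalence {Φ : OpenPartialHomeomorph J1 J1} {i j : Fin 4}
    (hne : Φ.source.Nonempty) (hi : i = 0 ∨ i = 1) (hj : j = 2 ∨ j = 3) :
    ¬ IsContactEquivalence Φ (normalForm i) (normalForm j) := by
  intro E
  have n1 : (Φ.source ∩ {a | a.1 2 ≠ 0}).Nonempty :=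
    exists_ne_of_dd_ne (v := ex 2) (φ := fun a => a.1 2) Φ.open_source hne fun a _ => by
      rw [dd_fst]
      simp [ex]
  have o1 := Φ.open_source.inter isOpen_ne
  have n2 : (Φ.source ∩ {a | a.1 2 ≠ 0} ∩ {a | normalForm i a ≠ 0}).Nonempty :=
    exists_ne_of_dd_ne o1 n1 fun a ha => (dd_normalForm hi).2.2 ha.2
  have o2 := o1.inter (isOpen_compl_singleton.preimage (normalForm_contDiff i).continuous (t := {0}ᶜ))
  have hsub : Φ.source ∩ {a | a.1 2 ≠ 0} ∩ {a | normalForm i a ≠ 0} ⊆ Φ.source := fun a ha => ha.1.1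
  have n3 : ∃ b ∈ Φ '' (Φ.source ∩ {a | a.1 2 ≠ 0} ∩ {a | normalForm i a ≠ 0}),
      normalForm j b ≠ 0 := by
    have o3 := Φ.isOpen_image_of_subset_source o2 hsub
    rcases hj with rfl | rfl
    · exact exists_ne_of_dd_ne (v := ex 2) (φ := fun a => a.1 2) o3 (n2.image _) fun a _ => by
        rw [dd_fst]
        simp [ex]
    · obtain ⟨b, hb⟩ := n2.image Φ
      exact ⟨b, hb, by simp [normalForm]⟩
  obtain ⟨_, ⟨a, ha, rfl⟩, ha'⟩ := n3
  have hD : IsOpen (Φ.source ∩ {a | a.1 2 ≠ 0} ∩ {a | normalForm i a ≠ 0} ∩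
      {a | normalForm j (Φ a) ≠ 0}) :=
    ((normalForm_contDiff j).continuous.comp_continuousOn
      (Φ.continuousOn.mono hsub)).isOpen_inter_preimage o2 isOpen_compl_singleton
  have C := E.contactSystem (normalForm_contDiff i) (normalForm_contDiff j) hD
    (fun a ha => ha.1.1.1) (fun a ha => ha.1.2) (fun a ha => ha.2)
  refine (dd_normalForm hi).2.2 ha.1.2 (C.dd_coeff_eq_zero
    (fun b _ => ⟨(dd_normalForm hi).1, (dd_normalForm hi).2.1⟩) (fun b hb => ?_) ⟨ha, ha'⟩)
  rcases hj with rfl | rfl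
  · exact ⟨C.dd_ep hb 0 2, (C.dd_lower hb (Or.inl rfl) (Or.inl rfl)).1,
      (C.dd_lower hb (Or.inl rfl) (Or.inl rfl)).2⟩
  · exact ⟨dd_const _ 1 _, dd_const _ 1 _, dd_const _ 1 _⟩

end SecondHeavenly

open SecondHeavenly in
theorem mainTheorem5 :
    -- half-flatness of the conformal structure on all solutions
    (∀ (D : Set J1) (f : J1 → ℝ), IsOpen D → IsConnected D → ContDiffOn ℝ ∞ f D →
      (WeylMinusVanishes D f ↔ ∃ c : Fin 6 → ℝ, Constraint c ∧ ∀ a ∈ D, f a = quadCoeff c a) ∧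
      (WeylPlusVanishes D f ↔ ∀ a ∈ D, f a = 0)) ∧
    -- the four normal forms modulo affine changes of `x` (and `u ↦ -u`, needed only if `c 0 < 0`)
    (∀ c : Fin 6 → ℝ, Constraint c → c ≠ 0 →
      (∃! k : Fin 4, ∃ (A : Pt ≃ᵃ[ℝ] Pt) (ε : ℝ), (ε = 1 ∨ ε = -1) ∧
        AffineCarries A ε (quadCoeff c) (normalForm k)) ∧
      (0 ≤ c 0 → ∃ (k : Fin 4) (A : Pt ≃ᵃ[ℝ] Pt),
        AffineCarries A 1 (quadCoeff c) (normalForm k))) ∧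
    -- the first two normal forms are point equivalent, and so are the last two
    (∃ Φ : OpenPartialHomeomorph J1 J1,
      Φ.source = {a | a.1 2 ≠ 0} ∧ Φ.target = {a | a.1 2 ≠ 0} ∧
      IsContactEquivalence Φ (normalForm 0) (normalForm 1) ∧
      ∀ a ∈ Φ.source,
        (Φ a).1 = ![a.1 0 + a.1 1 * a.1 3 / a.1 2, a.1 1 / a.1 2, -(1 / a.1 2), a.1 3 / a.1 2] ∧
        (Φ a).2.1 = a.1 2 * a.2.1) ∧
    (∃ Φ : OpenPartialHomeomorph J1 J1,
      Φ.source = {a | 0 < a.1 2} ∧ Φ.target = {a | a.1 2 < 0} ∧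
      IsContactEquivalence Φ (normalForm 2) (normalForm 3) ∧
      ∀ a ∈ Φ.source,
        (Φ a).1 = ![a.1 0 * a.1 2, a.1 1 / a.1 2 ^ 2, -(1 / (2 * a.1 2 ^ 2)), a.1 3] ∧
        (Φ a).2.1 = a.1 2 * a.2.1 + a.1 0 * a.1 1 ^ 2 / (2 * a.1 2)) ∧
    -- the first two are not contact equivalent to the last two, even locally
    (∀ (Φ : OpenPartialHomeomorph J1 J1) (i j : Fin 4), Φ.source.Nonempty →
      (i = 0 ∨ i = 1) → (j = 2 ∨ j = 3) →
      ¬ IsContactEquivalence Φ (normalForm i) (normalForm j)) := by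
  refine ⟨fun D f hD hD' hf => ⟨weylMinusVanishes_iff hD hD' hf, weylPlusVanishes_iff hD hf⟩,
    fun c hC hc => existsUnique_normalForm hC hc,
    ⟨linearFirstHomeomorph, rfl, rfl, linearFirst_isContactEquivalence, fun a _ => ?_⟩,
    ⟨constHomeomorph, rfl, rfl, const_isContactEquivalence, fun a _ => ?_⟩,
    fun Φ i j hne hi hj => not_isContactEquivalence hne hi hj⟩
  · change (toLinearFirst a).1 = _ ∧ (toLinearFirst a).2.1 = _
    simp only [toLinearFirst, div_eq_mul_inv, one_mul, and_self]
  · change (toConst a).1 = _ ∧ (toConst a).2.1 = _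
    simp only [toConst, div_eq_mul_inv, one_mul, mul_inv, inv_pow]
    exact ⟨trivial, by ring⟩
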